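/- Let $M$ be a closed (compact, without boundary, possibly disconnected) smooth 3-manifold, let $4\le r\le\infty$, and let $\eta$ be a $C^r$ plane field on $M$: a 2-dimensional subspace $\eta_p\subset T_pM$ for each $p$, locally spanned by $C^r$ vector fields. Let $\Gamma^r(\eta)$ be the space of $C^r$ vector fields $X$ with $X(p)\in\eta_p$ for all $p$, with the $C^r$ topology. An *adapted atlas* $\mathcal A$ for $\eta$ is a countable family of smooth charts $(x,y,z)$ which cover $M$ and in each of which $\partial/\partial z$ is everywhere transverse to $\eta$. Let $X\in\Gamma^r(\eta)$, and suppose that $\mathrm{Fix}(X)=\{p: X(p)=0\}$ is a link $L$, i.e. a disjoint union of finitely many (possibly no) $C^r$ embedded circles. For $p\in L$ the linearization $DX(p):T_pM\to T_pM$ kills $T_pL$; the two *transverse eigenvalues* at $p$ are the eigenvalues of the endomorphism induced on $T_pM/T_pL$, and $p$ is *transversally hyperbolic* if neither has zero real part. A point $p\in L$ is * a *codimension-one saddle-node* if the transverse eigenvalues are real near $p$, exactly one of them vanishes at $p$, and this one passes through zero with nonzero speed along $L$; * a *codimension-one Hopf point* (relative to $\mathcal A$) if the transverse eigenvalues near $p$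 are a complex conjugate pair $a\pm ib$, with $a=0\neq b$ at $p$, crossing the imaginary axis with nonzero speed along $L$, and moreover, for every chart $(x,y,z)$ of $\mathcal A$ around $p$, the following planar vector field has nonzero first Lyapunov coefficient at $p$ (the coefficient $a_3$ in its normal form $\dot\rho=a_3\rho^3+\cdots$, $\dot\theta=\omega+\cdots$): restrict $X$ to the affine coordinate plane through $p$ tangent to $\eta_p$ and project to that plane along $\partial/\partial z$. Call $X$ *nondegenerate* (relative to $\mathcal A$) if $\mathrm{Fix}(X)$ is a link all but finitely many of whose points are transversally hyperbolic, the remaining ones being codimension-one saddle-node or Hopf points. **Proposition.** Adapted atlases for $\eta$ exist, and for every adapted atlas the nondegenerate sections form a residual subset of $\Gamma^r(\eta)$ (a set containing a countable intersection of dense open sets). -/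

import Mathlib

open Set Filter Topology
open scoped Manifold ContDiff

noncomputable section

/-- The model space `ℝ³`. -/
abbrev E3 : Type := EuclideanSpace ℝ (Fin 3)

instance tangentSpaceFiniteDimensional {M : Type*} [TopologicalSpace M] [ChartedSpace E3 M]
    (p : M) : FiniteDimensional ℝ (TangentSpace (𝓡 3) p) :=
  inferInstanceAs (FiniteDimensional ℝ E3)

/-! ## Plane fields and the space of their sections -/

/-- A `C^r` plane field on a 3-manifold: a 2-dimensional subspace of each tangent space, locally
spanned by `C^r` vector fields. -/
structure PlaneField (r : ℕ∞) (M : Type*) [TopologicalSpace M] [ChartedSpace E3 M]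
    [IsManifold (𝓡 3) ∞ M] where
  plane : ∀ p : M, Submodule ℝ (TangentSpace (𝓡 3) p)
  finrank_plane : ∀ p : M, Module.finrank ℝ (plane p) = 2
  locally_spanned : ∀ p : M, ∃ U ∈ 𝓝 p, ∃ V W : ∀ q : M, TangentSpace (𝓡 3) q,
    ContMDiffOn (𝓡 3) (𝓡 3).tangent r (fun q => (⟨q, V q⟩ : TangentBundle (𝓡 3) M)) U ∧
    ContMDiffOn (𝓡 3) (𝓡 3).tangent r (fun q => (⟨q, W q⟩ : TangentBundle (𝓡 3) M)) U ∧
    ∀ q ∈ U, plane q = Submodule.span ℝ {V q, W q}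

section Manifold

variable {M : Type*} [TopologicalSpace M] [ChartedSpace E3 M]

/-- The coordinate expression `ℝ³ → ℝ³` of a vector field in a chart `φ`; it is meaningful
on `φ.target`. -/
def chartRep (φ : OpenPartialHomeomorph M E3) (X : ∀ p : M, TangentSpace (𝓡 3) p) : E3 → E3 :=
  fun x => mfderiv (𝓡 3) (𝓡 3) φ (φ.symm x) (X (φ.symm x))

variable [IsManifold (𝓡 3) ∞ M]

/-- The space of `C^r` sections of a plane field: the `C^r` vector fields tangent to it. -/
def PlaneField.Sections {r : ℕ∞} (η : PlaneField r M) : Type _ :=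
  {X : ContMDiffSection (𝓡 3) E3 r (fun p : M => TangentSpace (𝓡 3) p) //
    ∀ p : M, X p ∈ η.plane p}

/-- The vector field underlying a section. -/
def PlaneField.Sections.field {r : ℕ∞} {η : PlaneField r M} (X : η.Sections) :
    ∀ p : M, TangentSpace (𝓡 3) p :=
  fun p => X.1 p

/-- The `C^r` topology: uniform convergence, on compact subsets of each smooth chart, of the
coordinate expressions together with their derivatives of every finite order `k ≤ r`. -/
instance PlaneField.Sections.topology {r : ℕ∞} (η : PlaneField r M) :
    TopologicalSpace η.Sections :=
  ⨅ φ ∈ IsManifold.maximalAtlas (𝓡 3) ∞ M, ⨅ k : ℕ, ⨅ _ : (k : ℕ∞) ≤ r,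
    TopologicalSpace.induced
      (fun X : η.Sections =>
        UniformOnFun.ofFun {K : Set E3 | IsCompact K ∧ K ⊆ φ.target}
          (iteratedFDeriv ℝ k (chartRep φ X.field)))
      inferInstance

end Manifold

section Nondegenerate

variable {M : Type*} [TopologicalSpace M] [ChartedSpace E3 M]

/-! ## Links of fixed points and their transverse linearization -/

/-- The fixed point set of (the flow of) a vector field. -/
def fixedSet (X : ∀ p : M, TangentSpace (𝓡 3) p) : Set M := {p | X p = 0}

/-- `γ` parametrizes a `C^r` embedded circle `ℝ / ℤ → M`: it is a 1-periodic regular curve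
of class `C^r` which is injective modulo its period. -/
structure IsEmbeddedCircle (r : ℕ∞) (γ : ℝ → M) : Prop where
  contMDiff : ContMDiff 𝓘(ℝ, ℝ) (𝓡 3) r γ
  periodic : Function.Periodic γ 1
  injective_mod : ∀ s t : ℝ, γ s = γ t → ∃ n : ℤ, s = t + n
  regular : ∀ t : ℝ, mfderiv 𝓘(ℝ, ℝ) (𝓡 3) γ t (1 : ℝ) ≠ 0

/-- The finite family of curves `γ` parametrizes the components of the link `L`, a disjoint union
of finitely many (possibly no) embedded circles. -/
structure IsLink (r : ℕ∞) (L : Set M) {n : ℕ} (γ : Fin n → ℝ → M) : Prop where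
  embedded : ∀ i, IsEmbeddedCircle r (γ i)
  disjoint : Pairwise fun i j => Disjoint (range (γ i)) (range (γ j))
  iUnion_range : ⋃ i, range (γ i) = L

/-- The linearization `DX(p) : T_p M → T_p M` of a vector field at a fixed point `p`. (At a fixed
point it does not depend on the chart used to compute it.) -/
def linearization (X : ∀ p : M, TangentSpace (𝓡 3) p) (p : M) :
    TangentSpace (𝓡 3) p →ₗ[ℝ] TangentSpace (𝓡 3) p :=
  let φ := chartAt E3 p
  let dφ : TangentSpace (𝓡 3) p →L[ℝ] E3 := mfderiv (𝓡 3) (𝓡 3) φ p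
  (dφ.inverse ∘L fderiv ℝ (chartRep φ X) (φ p) ∘L dφ).toLinearMap

/-- The tangent line at time `t` of a curve. -/
def tangentLine (γ : ℝ → M) (t : ℝ) : Submodule ℝ (TangentSpace (𝓡 3) (γ t)) :=
  Submodule.span ℝ {mfderiv 𝓘(ℝ, ℝ) (𝓡 3) γ t (1 : ℝ)}

open Classical in
/-- The transverse linearization along a curve `γ` of fixed points: the endomorphism induced
by `DX` on the quotient of the tangent space by the tangent line of the curve.
(Along a curve of fixed points `DX` annihilates the tangent line, so the first branch applies.) -/
def transverseLinearization (X : ∀ p : M, TangentSpace (𝓡 3) p) (γ : ℝ → M) (t : ℝ) :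
    (TangentSpace (𝓡 3) (γ t) ⧸ tangentLine γ t) →ₗ[ℝ]
      (TangentSpace (𝓡 3) (γ t) ⧸ tangentLine γ t) :=
  if h : tangentLine γ t ≤ (tangentLine γ t).comap (linearization X (γ t)) then
    (tangentLine γ t).mapQ (tangentLine γ t) (linearization X (γ t)) h
  else 0

/-- The characteristic polynomial of the transverse linearization; its complex roots are
the two transverse eigenvalues. -/
def transverseCharpoly (X : ∀ p : M, TangentSpace (𝓡 3) p) (γ : ℝ → M) (t : ℝ) :
    Polynomial ℝ :=
  (transverseLinearization X γ t).charpoly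

/-- Transverse hyperbolicity at `γ t`: no transverse eigenvalue has zero real part. -/
def IsTransversallyHyperbolic (X : ∀ p : M, TangentSpace (𝓡 3) p) (γ : ℝ → M) (t : ℝ) : Prop :=
  ∀ z : ℂ, ((transverseCharpoly X γ t).map (algebraMap ℝ ℂ)).IsRoot z → z.re ≠ 0

/-! ## Codimension-one degeneracies -/

/-- Saddle-node: the transverse eigenvalues are real near `t₀`, and exactly one of them vanishes
at `t₀`, passing through zero with nonzero speed along the curve. -/
def IsSaddleNode (X : ∀ p : M, TangentSpace (𝓡 3) p) (γ : ℝ → M) (t₀ : ℝ) : Prop :=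
  ∃ ev₁ ev₂ : ℝ → ℝ, ∃ speed : ℝ,
    (∀ᶠ t in 𝓝 t₀, transverseCharpoly X γ t =
      (Polynomial.X - Polynomial.C (ev₁ t)) * (Polynomial.X - Polynomial.C (ev₂ t))) ∧
    ev₁ t₀ = 0 ∧ ev₂ t₀ ≠ 0 ∧ HasDerivAt ev₁ speed t₀ ∧ speed ≠ 0

/-- The transverse eigenvalues are, near `t₀`, a complex conjugate pair `a ± b i`, which crosses the
imaginary axis at `t₀` away from the origin with nonzero speed. -/
def HasImaginaryCrossing (X : ∀ p : M, TangentSpace (𝓡 3) p) (γ : ℝ → M) (t₀ : ℝ) : Prop :=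
  ∃ a b : ℝ → ℝ, ∃ speed : ℝ,
    (∀ᶠ t in 𝓝 t₀, transverseCharpoly X γ t =
      (Polynomial.X - Polynomial.C (a t)) ^ 2 + Polynomial.C (b t ^ 2)) ∧
    a t₀ = 0 ∧ b t₀ ≠ 0 ∧ HasDerivAt a speed t₀ ∧ speed ≠ 0

/-- Partial derivative in the first variable. -/
def partialX (f : ℝ → ℝ → ℝ) : ℝ → ℝ → ℝ := fun x y => deriv (fun s => f s y) x

/-- Partial derivative in the second variable. -/
def partialY (f : ℝ → ℝ → ℝ) : ℝ → ℝ → ℝ := fun x y => deriv (fun s => f x s) y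

/-- The coefficient `a` of the cubic normal form `ṙ = a r³ + …`, `θ̇ = freq + …` (first Lyapunov
coefficient) at the origin of a planar vector field `ẋ = f(x,y)`, `ẏ = g(x,y)` whose linear part
is `(-freq y, freq x)`. -/
def hopfCoefficient (freq : ℝ) (f g : ℝ → ℝ → ℝ) : ℝ :=
  let fxx := partialX (partialX f) 0 0
  let fxy := partialX (partialY f) 0 0
  let fyy := partialY (partialY f) 0 0
  let gxx := partialX (partialX g) 0 0
  let gxy := partialX (partialY g) 0 0
  let gyy := partialY (partialY g) 0 0
  (1 / 16) * (partialX (partialX (partialX f)) 0 0 + partialX (partialY (partialY f)) 0 0 +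
      partialX (partialX (partialY g)) 0 0 + partialY (partialY (partialY g)) 0 0) +
    (1 / (16 * freq)) *
      (fxy * (fxx + fyy) - gxy * (gxx + gyy) - fxx * gxx + fyy * gyy)

/-- `X` has a nonzero cubic Hopf coefficient at the fixed point `p`, measured in the chart
`φ = (x,y,z)`, where `∂/∂z` is transverse to the plane `P ⊂ T_p M`.
In this chart restrict `X` to the affine plane through `φ p` tangent to `P` and project the result
to that plane along `∂/∂z`. This gives a planar vector field, which is written
in a basis `e₁, e₂` of `P` that puts its linear part in the form `(-freq y, freq x)`. The functionals
`ℓ₁, ℓ₂` are the coordinates of the projection in this basis. -/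
def HasNonzeroHopfCoefficient (φ : OpenPartialHomeomorph M E3)
    (X : ∀ p : M, TangentSpace (𝓡 3) p) (p : M) (P : Submodule ℝ (TangentSpace (𝓡 3) p)) : Prop :=
  let dφ : TangentSpace (𝓡 3) p →L[ℝ] E3 := mfderiv (𝓡 3) (𝓡 3) φ p
  ∃ freq : ℝ, freq ≠ 0 ∧ ∃ e₁ ∈ P, ∃ e₂ ∈ P, ∃ ℓ₁ ℓ₂ : E3 →ₗ[ℝ] ℝ,
    linearization X p e₁ = freq • e₂ ∧ linearization X p e₂ = -(freq • e₁) ∧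
    ℓ₁ (dφ e₁) = 1 ∧ ℓ₁ (dφ e₂) = 0 ∧ ℓ₁ (EuclideanSpace.single 2 1) = 0 ∧
    ℓ₂ (dφ e₁) = 0 ∧ ℓ₂ (dφ e₂) = 1 ∧ ℓ₂ (EuclideanSpace.single 2 1) = 0 ∧
    hopfCoefficient freq
      (fun u v => ℓ₁ (chartRep φ X (φ p + u • dφ e₁ + v • dφ e₂)))
      (fun u v => ℓ₂ (chartRep φ X (φ p + u • dφ e₁ + v • dφ e₂))) ≠ 0

variable [IsManifold (𝓡 3) ∞ M]

/-- An atlas adapted to a plane field: countably many smooth charts `(x,y,z)` covering `M`, in each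
of which `∂/∂z` is everywhere transverse to the plane field. -/
structure AdaptedAtlas {r : ℕ∞} (η : PlaneField r M) where
  charts : Set (OpenPartialHomeomorph M E3)
  countable : charts.Countable
  smooth : charts ⊆ IsManifold.maximalAtlas (𝓡 3) ∞ M
  covers : ∀ p : M, ∃ φ ∈ charts, p ∈ φ.source
  transverse : ∀ φ ∈ charts, ∀ p ∈ φ.source, ∀ v ∈ η.plane p,
    (∃ c : ℝ, mfderiv (𝓡 3) (𝓡 3) φ p v = c • (EuclideanSpace.single 2 1 : E3)) → v = 0

/-- Codimension-one Hopf point: a conjugate pair of transverse eigenvalues crosses the imaginary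
axis transversally, and the cubic coefficient is nonzero in every chart of the adapted atlas
around the point. -/
def IsHopf {r : ℕ∞} {η : PlaneField r M} (𝒜 : AdaptedAtlas η)
    (X : ∀ p : M, TangentSpace (𝓡 3) p) (γ : ℝ → M) (t₀ : ℝ) : Prop :=
  HasImaginaryCrossing X γ t₀ ∧
    ∀ φ ∈ 𝒜.charts, γ t₀ ∈ φ.source →
      HasNonzeroHopfCoefficient φ X (γ t₀) (η.plane (γ t₀))

/-- Nondegenerate sections: the fixed point set is a link, transversally hyperbolic at all but
finitely many points, which are codimension-one saddle-node or Hopf points. -/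
def IsNondegenerate {r : ℕ∞} {η : PlaneField r M} (𝒜 : AdaptedAtlas η) (X : η.Sections) : Prop :=
  ∃ (n : ℕ) (γ : Fin n → ℝ → M), IsLink r (fixedSet X.field) γ ∧
    {p : M | ∃ i t, γ i t = p ∧ ¬ IsTransversallyHyperbolic X.field (γ i) t}.Finite ∧
    ∀ i t, ¬ IsTransversallyHyperbolic X.field (γ i) t →
      IsSaddleNode X.field (γ i) t ∨ IsHopf 𝒜 X.field (γ i) t

end Nondegenerate

end

/-!
# Generic sections of a plane field on a closed 3-manifold

In a chart of an adapted atlas the plane field is the graph of a linear form in the first two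
coordinates, whose coefficients, the slopes, are functions of class `C^r` (`exists_slopes`). A
section is therefore the same, in this chart, as a pair of functions, its first two components, which
can be perturbed independently and arbitrarily. All the conditions in the definition of a
nondegenerate section are expressed by the derivatives of order at most three of this pair at its
zeros, and by the slopes and their first derivatives. These data form a `Jet`. It is `Jet.Bad` if it
is the jet at a zero and one of the following holds: the zero set is not regular; the transverse
eigenvalue zero is double; the determinant of the transverse linearization and its derivative along
the zero set vanish; the trace and its derivative along the zero set vanish; or the eigenvalues
are imaginary and the Lyapunov coefficient vanishes. A section is good (`IsGood`) if none of its jets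
in the charts of the atlas is bad.

Genericity. The bad jets form a closed set (`Jet.isOpen_not_bad`), so on a compact part of a chart
goodness is an open condition (`isOpen_not_bad_on`). They lie in finitely many sets each of which is
cut out by four equations, the two components and two more, and the equations are independent along
explicit polynomial perturbations of the pair: constants, coordinate functions, products of two linear
forms and cubes of linear forms (`Jet.exists_thin_cover`). Consider the space of pairs (polynomial
perturbation, point of the chart). Those for which the jet is bad form a set of Hausdorff codimension
at least four, while there are only three dimensions of points; so the perturbations which produce a
bad jet somewhere form a set of positive Hausdorff codimension, whose complement is dense
(`dimH_fst_image_lt_of_triangular`, `dense_good_params`). This count needs the equations to be of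
class `C^1` only, hence the pair of functions to be of class `C^4`, and it replaces Sard's theorem.
With a countable cover by balls the good sections form a residual set (`residual_isGood`).

Good sections are nondegenerate (`IsGood.isNondegenerate`). By the implicit function theorem the fixed
point set is locally a regular arc (`exists_arc_of_regular`). That it is a link is the
classification of compact one-dimensional manifolds: parametrized by arc length in a Euclidean
embedding of the manifold, two such arcs through a common point agree up to translation and
reflection of the parameter, so they can be continued for all time; the resulting curves have open
and closed images and, by compactness, are periodic (`RigidArcs.exists_circles`, `exists_isLink`). The
differentials of the two components identify the normal space of the link with the plane, and the
transverse linearization with the matrix `Jet.mat` (`transverseCharpoly_eq`); the derivatives of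
its trace and determinant along the link are those in the jet, up to a common nonzero factor
(`hasDerivAt_tr_det`), and the Hopf coefficient of the definition is the Lyapunov coefficient of the jet
(`hopfCoefficient_eq_lyapunov`). A point fails to be transversally hyperbolic where the determinant
vanishes, which makes it a saddle-node, or where the trace vanishes and the determinant is
positive, which makes it a Hopf point; both are simple zeros along the link, hence isolated.

Adapted atlases exist because after a permutation of the coordinates any chart is adapted near a given
point (`exists_adapted_chart`).
-/


noncomputable section

/-! ### Vector fields in charts -/

section ChartFields

variable {M : Type*} [TopologicalSpace M] [ChartedSpace E3 M]
  {φ : OpenPartialHomeomorph M E3}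

theorem mdifferentiable_of_mem_maximalAtlas (hφ : φ ∈ IsManifold.maximalAtlas (𝓡 3) ∞ M) :
    φ.MDifferentiable (𝓡 3) (𝓡 3) :=
  ⟨(contMDiffOn_of_mem_maximalAtlas hφ).mdifferentiableOn (by simp),
    (contMDiffOn_symm_of_mem_maximalAtlas hφ).mdifferentiableOn (by simp)⟩

theorem contMDiffAt_chart (hφ : φ ∈ IsManifold.maximalAtlas (𝓡 3) ∞ M) {p : M}
    (hp : p ∈ φ.source) : ContMDiffAt (𝓡 3) (𝓡 3) ∞ φ p :=
  (contMDiffOn_of_mem_maximalAtlas hφ).contMDiffAt (φ.open_source.mem_nhds hp)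

theorem contMDiffAt_chart_symm (hφ : φ ∈ IsManifold.maximalAtlas (𝓡 3) ∞ M) {x : E3}
    (hx : x ∈ φ.target) : ContMDiffAt (𝓡 3) (𝓡 3) ∞ φ.symm x :=
  (contMDiffOn_symm_of_mem_maximalAtlas hφ).contMDiffAt (φ.open_target.mem_nhds hx)

/-- The differential of a smooth chart at a point of its source, as an isomorphism. -/
def chartDeriv (hφ : φ ∈ IsManifold.maximalAtlas (𝓡 3) ∞ M) {p : M} (hp : p ∈ φ.source) :
    TangentSpace (𝓡 3) p ≃L[ℝ] E3 :=
  (mdifferentiable_of_mem_maximalAtlas hφ).mfderiv hp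

theorem chartDeriv_apply (hφ : φ ∈ IsManifold.maximalAtlas (𝓡 3) ∞ M) {p : M}
    (hp : p ∈ φ.source) (v : TangentSpace (𝓡 3) p) :
    chartDeriv hφ hp v = mfderiv (𝓡 3) (𝓡 3) φ p v := rfl

theorem chartDeriv_coe (hφ : φ ∈ IsManifold.maximalAtlas (𝓡 3) ∞ M) {p : M}
    (hp : p ∈ φ.source) :
    (chartDeriv hφ hp : TangentSpace (𝓡 3) p →L[ℝ] E3) = mfderiv (𝓡 3) (𝓡 3) φ p := rfl

theorem mfderiv_chart_symm_eq (hφ : φ ∈ IsManifold.maximalAtlas (𝓡 3) ∞ M) {x : E3}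
    (hx : x ∈ φ.target) :
    mfderiv (𝓡 3) (𝓡 3) φ.symm x =
      ((chartDeriv hφ (φ.map_target hx)).symm : E3 →L[ℝ] TangentSpace (𝓡 3) (φ.symm x)) := by
  have h : ∀ y, y = x → mfderiv (𝓡 3) (𝓡 3) φ.symm x = mfderiv (𝓡 3) (𝓡 3) φ.symm y := by
    rintro y rfl; rfl
  exact h _ (φ.right_inv hx)

theorem chartRep_apply (hφ : φ ∈ IsManifold.maximalAtlas (𝓡 3) ∞ M) {p : M}
    (hp : p ∈ φ.source) (X : ∀ p : M, TangentSpace (𝓡 3) p) :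
    chartRep φ X (φ p) = chartDeriv hφ hp (X p) := by
  simp only [chartRep, chartDeriv_apply]
  rw [φ.left_inv hp]

/-- The coordinate expression is the pullback of the field by the inverse chart; smoothness of the
one is thus smoothness of the other. -/
theorem chartRep_eq_mpullback (hφ : φ ∈ IsManifold.maximalAtlas (𝓡 3) ∞ M) {x : E3}
    (hx : x ∈ φ.target) (X : ∀ p : M, TangentSpace (𝓡 3) p) :
    chartRep φ X x = VectorField.mpullback (𝓡 3) (𝓡 3) φ.symm X x := by
  have hp := φ.map_target hx
  rw [VectorField.mpullback_apply, mfderiv_chart_symm_eq hφ hx]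
  erw [ContinuousLinearMap.inverse_equiv]
  rfl

theorem isInvertible_mfderiv_chart_symm (hφ : φ ∈ IsManifold.maximalAtlas (𝓡 3) ∞ M) {x : E3}
    (hx : x ∈ φ.target) : (mfderiv (𝓡 3) (𝓡 3) φ.symm x).IsInvertible := by
  exact ⟨(chartDeriv hφ (φ.map_target hx)).symm, (mfderiv_chart_symm_eq hφ hx).symm⟩

theorem chartRep_eq_zero_iff (hφ : φ ∈ IsManifold.maximalAtlas (𝓡 3) ∞ M) {p : M}
    (hp : p ∈ φ.source) (X : ∀ p : M, TangentSpace (𝓡 3) p) :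
    chartRep φ X (φ p) = 0 ↔ X p = 0 := by
  rw [chartRep_apply hφ hp]; exact (chartDeriv hφ hp).map_eq_zero_iff

/-- The vector field on `M` with prescribed coordinate expression `Y` in the chart `φ`; it is
meaningful on `φ.source`. -/
def fieldOfChart (φ : OpenPartialHomeomorph M E3) (Y : E3 → E3) : ∀ p : M, TangentSpace (𝓡 3) p :=
  VectorField.mpullback (𝓡 3) (𝓡 3) φ (fun x => (Y x : TangentSpace (𝓡 3) x))

theorem fieldOfChart_apply (hφ : φ ∈ IsManifold.maximalAtlas (𝓡 3) ∞ M) {p : M}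
    (hp : p ∈ φ.source) (Y : E3 → E3) :
    fieldOfChart φ Y p = (chartDeriv hφ hp).symm (Y (φ p)) := by
  have h : (mfderiv (𝓡 3) (𝓡 3) φ p).inverse =
      ((chartDeriv hφ hp).symm : E3 →L[ℝ] TangentSpace (𝓡 3) p) := by
    rw [← chartDeriv_coe hφ hp]
    exact ContinuousLinearMap.inverse_equiv _
  exact DFunLike.congr_fun h (Y (φ p))

theorem chartRep_smul_fieldOfChart (hφ : φ ∈ IsManifold.maximalAtlas (𝓡 3) ∞ M) {x : E3}
    (hx : x ∈ φ.target) (c : M → ℝ) (Y : E3 → E3) :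
    chartRep φ (fun p => c p • fieldOfChart φ Y p) x = c (φ.symm x) • Y x := by
  have hp := φ.map_target hx
  have := chartRep_apply hφ hp (fun p => c p • fieldOfChart φ Y p)
  rw [φ.right_inv hx] at this
  rw [this, map_smul, fieldOfChart_apply hφ hp, φ.right_inv hx]
  simp

variable [IsManifold (𝓡 3) ∞ M]

/-- No derivative is lost, since the charts are smooth. -/
theorem contDiffAt_chartRep {r : ℕ∞} (hφ : φ ∈ IsManifold.maximalAtlas (𝓡 3) ∞ M) {x : E3}
    (hx : x ∈ φ.target) {X : ∀ p : M, TangentSpace (𝓡 3) p}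
    (hX : ContMDiffAt (𝓡 3) (𝓡 3).tangent r
      (fun q => (⟨q, X q⟩ : TangentBundle (𝓡 3) M)) (φ.symm x)) :
    ContDiffAt ℝ r (chartRep φ X) x := by
  have : IsManifold (𝓡 3) 1 M := IsManifold.of_le (n := ∞) (by simp)
  have h1 := hX.mpullback_vectorField_preimage (n := ∞) (contMDiffAt_chart_symm hφ hx)
    (isInvertible_mfderiv_chart_symm hφ hx) (by
      have : ((r : WithTop ℕ∞) + 1) = ((r + 1 : ℕ∞) : WithTop ℕ∞) := by simp
      rw [this]; exact_mod_cast le_top)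
  have h2 := contMDiffAt_vectorSpace_iff_contDiffAt.1 h1
  refine h2.congr_of_eventuallyEq ?_
  filter_upwards [φ.open_target.mem_nhds hx] with y hy
  exact chartRep_eq_mpullback hφ hy X

theorem contMDiffAt_fieldOfChart {r : ℕ∞} (hφ : φ ∈ IsManifold.maximalAtlas (𝓡 3) ∞ M) {p : M}
    (hp : p ∈ φ.source) {Y : E3 → E3} (hY : ContDiffAt ℝ r Y (φ p)) :
    ContMDiffAt (𝓡 3) (𝓡 3).tangent r
      (fun q => (⟨q, fieldOfChart φ Y q⟩ : TangentBundle (𝓡 3) M)) p := by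
  have : IsManifold (𝓡 3) 1 M := IsManifold.of_le (n := ∞) (by simp)
  refine ContMDiffAt.mpullback_vectorField_preimage (n := ∞) ?_ (contMDiffAt_chart hφ hp)
    ⟨chartDeriv hφ hp, rfl⟩ ?_
  · exact contMDiffAt_vectorSpace_iff_contDiffAt.2 hY
  · have : ((r : WithTop ℕ∞) + 1) = ((r + 1 : ℕ∞) : WithTop ℕ∞) := by simp
    rw [this]; exact_mod_cast le_top

/-- A pair of vectors spanning a plane is linearly independent. -/
theorem eq_zero_of_finrank_span_pair {V : Type*} [AddCommGroup V] [Module ℝ V] {v w : V}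
    (h : Module.finrank ℝ (Submodule.span ℝ {v, w}) = 2) {a b : ℝ} (hab : a • v + b • w = 0) :
    a = 0 ∧ b = 0 := by
  have : LinearIndependent ℝ ![v, w] := by
    rw [linearIndependent_iff_card_eq_finrank_span, Set.finrank, Matrix.range_cons_cons_empty, h]
    rfl
  exact LinearIndependent.pair_iff.1 this a b hab

/-- In a chart in which `∂/∂z` is transverse to the plane field, the plane field is the graph of
a pair of `C^r` slope functions. -/
theorem exists_slopes {r : ℕ∞} (η : PlaneField r M) (hφ : φ ∈ IsManifold.maximalAtlas (𝓡 3) ∞ M)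
    (htr : ∀ p ∈ φ.source, ∀ v ∈ η.plane p,
      (∃ c : ℝ, mfderiv (𝓡 3) (𝓡 3) φ p v = c • (EuclideanSpace.single 2 1 : E3)) → v = 0) :
    ∃ A : E3 → Fin 2 → ℝ, ContDiffOn ℝ r A φ.target ∧
      ∀ p (hp : p ∈ φ.source) (v : TangentSpace (𝓡 3) p),
        v ∈ η.plane p ↔ (chartDeriv hφ hp v) 2 =
          A (φ p) 0 * (chartDeriv hφ hp v) 0 + A (φ p) 1 * (chartDeriv hφ hp v) 1 := by
  -- pointwise: from a spanning pair the slopes are given by Cramer's rule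
  have key : ∀ p (hp : p ∈ φ.source) (V W : TangentSpace (𝓡 3) p),
      η.plane p = Submodule.span ℝ {V, W} →
      let v := chartDeriv hφ hp V
      let w := chartDeriv hφ hp W
      v 0 * w 1 - v 1 * w 0 ≠ 0 ∧ ∀ u : TangentSpace (𝓡 3) p, u ∈ η.plane p ↔
        (chartDeriv hφ hp u) 2 =
          ((w 1 * v 2 - v 1 * w 2) / (v 0 * w 1 - v 1 * w 0)) * (chartDeriv hφ hp u) 0 +
          ((v 0 * w 2 - w 0 * v 2) / (v 0 * w 1 - v 1 * w 0)) * (chartDeriv hφ hp u) 1 := by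
    intro p hp V W hspan v w
    have hcomb : ∀ a b : ℝ, a * v 0 + b * w 0 = 0 → a * v 1 + b * w 1 = 0 → a • V + b • W = 0 := by
      intro a b h0 h1
      refine htr p hp _ ?_ ⟨a * v 2 + b * w 2, ?_⟩
      · rw [hspan]; exact Submodule.mem_span_pair.2 ⟨a, b, rfl⟩
      · have : chartDeriv hφ hp (a • V + b • W) =
            (a * v 2 + b * w 2) • (EuclideanSpace.single 2 1 : E3) := by
          rw [map_add, map_smul, map_smul]
          change a • v + b • w = _
          ext i
          fin_cases i <;> simp [h0, h1]
        exact this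
    have hind : ∀ a b : ℝ, a • V + b • W = 0 → a = 0 ∧ b = 0 := fun a b =>
      eq_zero_of_finrank_span_pair (hspan ▸ η.finrank_plane p)
    have hdet : v 0 * w 1 - v 1 * w 0 ≠ 0 := by
      intro h0
      have h1 := hind _ _ (hcomb (w 0) (-v 0) (by ring) (by linarith))
      have h2 := hind _ _ (hcomb (w 1) (-v 1) (by linarith) (by ring))
      have h3 := hind _ _ (hcomb 1 0 (by linarith [h1.2]) (by linarith [h2.2]))
      exact one_ne_zero h3.1
    refine ⟨hdet, fun u => ?_⟩
    rw [hspan, Submodule.mem_span_pair]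
    constructor
    · rintro ⟨a, b, rfl⟩
      simp only [map_add, map_smul, PiLp.add_apply, PiLp.smul_apply, smul_eq_mul]
      change a * v 2 + b * w 2 = _ * (a * v 0 + b * w 0) + _ * (a * v 1 + b * w 1)
      rw [div_mul_eq_mul_div, div_mul_eq_mul_div, ← add_div, eq_div_iff hdet]
      ring
    · intro hu
      set y := chartDeriv hφ hp u with hy
      refine ⟨(w 1 * y 0 - w 0 * y 1) / (v 0 * w 1 - v 1 * w 0),
        (v 0 * y 1 - v 1 * y 0) / (v 0 * w 1 - v 1 * w 0), ?_⟩
      apply (chartDeriv hφ hp).injective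
      rw [map_add, map_smul, map_smul, ← hy]
      ext i
      change _ * v i + _ * w i = y i
      fin_cases i
      · simp only [Fin.zero_eta]
        rw [div_mul_eq_mul_div, div_mul_eq_mul_div, ← add_div, div_eq_iff hdet]
        ring
      · simp only [Fin.mk_one]
        rw [div_mul_eq_mul_div, div_mul_eq_mul_div, ← add_div, div_eq_iff hdet]
        ring
      · simp only [Fin.reduceFinMk]
        rw [hu, div_mul_eq_mul_div, div_mul_eq_mul_div, div_mul_eq_mul_div, div_mul_eq_mul_div,
          ← add_div, ← add_div]
        congr 1
        ring
  have hex : ∀ p (hp : p ∈ φ.source), ∃ A : Fin 2 → ℝ, ∀ u : TangentSpace (𝓡 3) p,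
      u ∈ η.plane p ↔ (chartDeriv hφ hp u) 2 =
        A 0 * (chartDeriv hφ hp u) 0 + A 1 * (chartDeriv hφ hp u) 1 := by
    intro p hp
    obtain ⟨U, hU, V, W, -, -, hs⟩ := η.locally_spanned p
    have := (key p hp (V p) (W p) (hs p (mem_of_mem_nhds hU))).2
    exact ⟨![_, _], this⟩
  -- the slopes are determined by the plane
  have huniq : ∀ p (hp : p ∈ φ.source) (A B : Fin 2 → ℝ),
      (∀ u : TangentSpace (𝓡 3) p, u ∈ η.plane p ↔ (chartDeriv hφ hp u) 2 =
        A 0 * (chartDeriv hφ hp u) 0 + A 1 * (chartDeriv hφ hp u) 1) →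
      (∀ u : TangentSpace (𝓡 3) p, u ∈ η.plane p ↔ (chartDeriv hφ hp u) 2 =
        B 0 * (chartDeriv hφ hp u) 0 + B 1 * (chartDeriv hφ hp u) 1) → A = B := by
    intro p hp A B hA hB
    have h0 := (hB ((chartDeriv hφ hp).symm !₂[1, 0, A 0])).1 ((hA _).2 (by simp))
    have h1 := (hB ((chartDeriv hφ hp).symm !₂[0, 1, A 1])).1 ((hA _).2 (by simp))
    simp only [ContinuousLinearEquiv.apply_symm_apply] at h0 h1
    simp at h0 h1
    ext i; fin_cases i
    · exact h0
    · exact h1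
  choose A₀ hA₀ using hex
  classical
  refine ⟨fun x => if h : x ∈ φ.target then A₀ (φ.symm x) (φ.map_target h) else 0, ?_, ?_⟩
  · intro x hx
    apply ContDiffAt.contDiffWithinAt
    obtain ⟨U, hU, V, W, hV, hW, hs⟩ := η.locally_spanned (φ.symm x)
    have hVx := contDiffAt_chartRep hφ hx (hV.contMDiffAt hU)
    have hWx := contDiffAt_chartRep hφ hx (hW.contMDiffAt hU)
    have hcomp : ∀ (Y : E3 → E3), ContDiffAt ℝ r Y x → ∀ i, ContDiffAt ℝ r (fun y => Y y i) x :=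
      fun Y hY i => by fun_prop
    have hx0 := (key _ (φ.map_target hx) _ _ (hs _ (mem_of_mem_nhds hU))).1
    simp only [← chartRep_apply, φ.right_inv hx] at hx0
    have hnum : ContDiffAt ℝ r (fun y => (![
        (chartRep φ W y 1 * chartRep φ V y 2 - chartRep φ V y 1 * chartRep φ W y 2) /
          (chartRep φ V y 0 * chartRep φ W y 1 - chartRep φ V y 1 * chartRep φ W y 0),
        (chartRep φ V y 0 * chartRep φ W y 2 - chartRep φ W y 0 * chartRep φ V y 2) /
          (chartRep φ V y 0 * chartRep φ W y 1 - chartRep φ V y 1 * chartRep φ W y 0)]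
            : Fin 2 → ℝ)) x := by
      have hv := hcomp _ hVx
      have hw := hcomp _ hWx
      rw [contDiffAt_pi]
      intro i
      fin_cases i
      · exact (((hw 1).mul (hv 2)).sub ((hv 1).mul (hw 2))).div
          (((hv 0).mul (hw 1)).sub ((hv 1).mul (hw 0))) hx0
      · exact (((hv 0).mul (hw 2)).sub ((hw 0).mul (hv 2))).div
          (((hv 0).mul (hw 1)).sub ((hv 1).mul (hw 0))) hx0
    refine hnum.congr_of_eventuallyEq ?_
    have hcont : Tendsto φ.symm (𝓝 x) (𝓝 (φ.symm x)) := φ.continuousAt_symm hx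
    filter_upwards [φ.open_target.mem_nhds hx, hcont hU] with y hy hyU
    rw [dif_pos hy]
    have hk := (key _ (φ.map_target hy) _ _ (hs _ hyU)).2
    simp only [← chartRep_apply, φ.right_inv hy] at hk
    exact huniq _ (φ.map_target hy) _ _ (hA₀ _ _) (fun u => by simpa using hk u)
  · intro p hp v
    simp only [dif_pos (φ.map_source hp)]
    have : ∀ q (hq : q ∈ φ.source), q = p → A₀ q hq = A₀ p hp := by
      intro q hq h; subst h; rfl
    rw [this _ _ (φ.left_inv hp)]
    exact hA₀ p hp v

end ChartFields

/-! ### Transversality by dimension count -/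

section Transversality

variable {H G E B : Type*} [NormedAddCommGroup H] [NormedSpace ℝ H] [FiniteDimensional ℝ H]
  [NormedAddCommGroup G] [NormedSpace ℝ G]
  [NormedAddCommGroup E] [NormedSpace ℝ E] [FiniteDimensional ℝ E]
  [NormedAddCommGroup B] [NormedSpace ℝ B] [FiniteDimensional ℝ B]

/-- A set cut out locally by regular `C^1` equations with values in `G` has Hausdorff codimension
at least `dim G`: by the inverse function theorem it is locally a Lipschitz image of an open subset
of the kernel. -/
theorem dimH_le_of_regular_zeros {Z : Set H} (hZ : Z.Nonempty) (Ψ : H → G)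
    (hΨ : ∀ z ∈ Z, ContDiffAt ℝ 1 Ψ z ∧ (∀ g, ∃ v, fderiv ℝ Ψ z v = g) ∧ Ψ z = 0) :
    dimH Z + Module.finrank ℝ G ≤ Module.finrank ℝ H := by
  have hloc : ∀ z ∈ Z, ∃ t ∈ 𝓝[Z] z, dimH t + Module.finrank ℝ G ≤ Module.finrank ℝ H := by
    intro z hz
    obtain ⟨hC, hsurj, h0⟩ := hΨ z hz
    set L := fderiv ℝ Ψ z with hL
    -- `Ψ` together with a projection to the kernel of its derivative is a local diffeomorphism, which
    -- maps `Z` into the kernel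
    obtain ⟨π, hπ⟩ := Submodule.ClosedComplemented.of_finiteDimensional_quotient
      (p := L.ker) L.isClosed_ker
    have hbij : Function.Bijective (L.prod π) := by
      constructor
      · rw [injective_iff_map_eq_zero]
        intro x hx
        have h1 : L x = 0 := congrArg Prod.fst hx
        have h2 : π x = 0 := congrArg Prod.snd hx
        have h3 := hπ ⟨x, h1⟩
        simp only at h3
        rw [h2] at h3
        exact (congrArg Subtype.val h3).symm
      · rintro ⟨g, k⟩
        obtain ⟨x, hx⟩ := hsurj g
        refine ⟨x + ((k - π x : L.ker) : H), ?_⟩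
        have hk : L ((k - π x : L.ker) : H) = 0 := (k - π x).2
        simp only [ContinuousLinearMap.prod_apply, map_add, hk, hπ, hx]
        simp
    let e : H ≃L[ℝ] G × L.ker :=
      (LinearEquiv.ofBijective (L.prod π : H →ₗ[ℝ] G × L.ker) hbij).toContinuousLinearEquiv
    let Θ : H → G × L.ker := fun w => (Ψ w, π w)
    have hΘ : ContDiffAt ℝ 1 Θ z := hC.prodMk π.contDiff.contDiffAt
    have hΘ' : HasFDerivAt Θ (e : H →L[ℝ] G × L.ker) z :=
      ((hC.differentiableAt (by simp)).hasFDerivAt).prodMk π.hasFDerivAt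
    let Φ := hΘ.toOpenPartialHomeomorph Θ hΘ' (by simp)
    have hinv : ContDiffAt ℝ 1 Φ.symm (Θ z) := hΘ.to_localInverse hΘ' (by simp)
    have hσ : ContDiffAt ℝ 1 (fun k : L.ker => Φ.symm (0, k)) (π z) := by
      have h1 : Θ z = (0, π z) := by simp only [Θ, h0]
      rw [h1] at hinv
      exact hinv.comp (π z) (contDiffAt_const.prodMk contDiffAt_id)
    obtain ⟨K, t, ht, hlip⟩ := hσ.exists_lipschitzOnWith
    have hsrc : Φ.source ∈ 𝓝 z :=
      Φ.open_source.mem_nhds (hΘ.mem_toOpenPartialHomeomorph_source hΘ' (by simp))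
    refine ⟨(fun k : L.ker => Φ.symm (0, k)) '' t, ?_, ?_⟩
    · filter_upwards [mem_nhdsWithin_of_mem_nhds hsrc,
        mem_nhdsWithin_of_mem_nhds (π.continuous.continuousAt.preimage_mem_nhds ht),
        self_mem_nhdsWithin] with w hw1 hw2 hw3
      refine ⟨π w, hw2, ?_⟩
      have h1 : Φ.symm (Φ w) = w := Φ.left_inv hw1
      have h2 : Φ w = (0, π w) := by
        change Θ w = _
        simp only [Θ, (hΨ w hw3).2.2]
      rw [h2] at h1
      exact h1
    · have h1 : dimH ((fun k : L.ker => Φ.symm (0, k)) '' t) ≤ Module.finrank ℝ L.ker :=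
        (hlip.dimH_image_le).trans
          ((dimH_mono (subset_univ t)).trans (Real.dimH_univ_eq_finrank _).le)
      have h2 : Module.finrank ℝ G + Module.finrank ℝ L.ker = Module.finrank ℝ H := by
        rw [← LinearMap.finrank_range_add_finrank_ker (L : H →ₗ[ℝ] G),
          LinearMap.range_eq_top.2 hsurj, finrank_top]
      calc _ ≤ (Module.finrank ℝ L.ker : ENNReal) + Module.finrank ℝ G := by gcongr
        _ = _ := by rw [← h2]; push_cast; ring
  -- Hausdorff dimension is determined locally
  by_contra! hlt
  obtain ⟨z, hz⟩ := hZ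
  have hGH : Module.finrank ℝ G ≤ Module.finrank ℝ H := by
    obtain ⟨t, -, ht⟩ := hloc z hz
    exact_mod_cast le_add_self.trans ht
  have h1 : ((Module.finrank ℝ H - Module.finrank ℝ G : ℕ) : ENNReal) < dimH Z := by
    by_contra! h
    refine hlt.not_ge ?_
    calc _ ≤ ((Module.finrank ℝ H - Module.finrank ℝ G : ℕ) : ENNReal) + Module.finrank ℝ G := by
          gcongr
      _ = _ := by norm_cast; omega
  obtain ⟨z, hz, hzt⟩ := exists_mem_nhdsWithin_lt_dimH_of_lt_dimH h1
  obtain ⟨t, ht, hle⟩ := hloc z hz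
  have h2 := hzt t ht
  have h3 : ((Module.finrank ℝ H : ℕ) : ENNReal) < dimH t + Module.finrank ℝ G := by
    calc ((Module.finrank ℝ H : ℕ) : ENNReal)
        = ((Module.finrank ℝ H - Module.finrank ℝ G : ℕ) : ENNReal) + Module.finrank ℝ G := by
          norm_cast; omega
      _ < _ := ENNReal.add_lt_add_right (by simp) h2
  exact absurd hle h3.not_ge

/-- Parametric transversality by dimension count: if the set `Z` of pairs (parameter, point) is cut
out by more regular equations than there are dimensions in the space `B` of points, then the
parameters that occur in `Z` form a set of positive Hausdorff codimension. -/
theorem dimH_fst_image_lt_of_regular_zeros {Z : Set (E × B)} (Ψ : E × B → G)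
    (hΨ : ∀ z ∈ Z, ContDiffAt ℝ 1 Ψ z ∧ (∀ g, ∃ v, fderiv ℝ Ψ z v = g) ∧ Ψ z = 0)
    (hdim : Module.finrank ℝ B < Module.finrank ℝ G) (hE : 0 < Module.finrank ℝ E) :
    dimH (Prod.fst '' Z) < Module.finrank ℝ E := by
  rcases Z.eq_empty_or_nonempty with rfl | hne
  · simpa using hE
  refine ((LipschitzWith.prod_fst (α := E) (β := B)).dimH_image_le Z).trans_lt ?_
  by_contra! hle
  have h := dimH_le_of_regular_zeros hne Ψ hΨ
  rw [Module.finrank_prod] at h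
  have h2 : ((Module.finrank ℝ E : ℕ) : ENNReal) + Module.finrank ℝ G ≤
      ((Module.finrank ℝ E + Module.finrank ℝ B : ℕ) : ENNReal) := le_trans (by gcongr) h
  have h3 : Module.finrank ℝ E + Module.finrank ℝ G ≤
    Module.finrank ℝ E + Module.finrank ℝ B := by exact_mod_cast h2
  omega

end Transversality

/-- A linear map is surjective if its coordinates on suitable vectors form an invertible triangular
matrix. -/
theorem surjective_of_upperTriangular {V : Type*} [AddCommGroup V] [Module ℝ V] {n : ℕ}
    (L : V →ₗ[ℝ] Fin n → ℝ) (v : Fin n → V) (h0 : ∀ i j, j < i → L (v i) j = 0)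
    (h1 : ∀ i, L (v i) i ≠ 0) : Function.Surjective L := by
  let m : Matrix (Fin n) (Fin n) ℝ := Matrix.of fun i j => L (v i) j
  have hdet : IsUnit m := by
    have htri : m.IsUpperTriangular := fun i j hij => h0 i j hij
    rw [Matrix.isUnit_iff_isUnit_det, Matrix.det_of_isUpperTriangular htri, isUnit_iff_ne_zero]
    exact Finset.prod_ne_zero_iff.2 fun i _ => h1 i
  intro g
  obtain ⟨c, hc⟩ := Matrix.vecMul_surjective_iff_isUnit.2 hdet g
  refine ⟨∑ i, c i • v i, ?_⟩
  rw [← hc]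
  ext j
  simp [Matrix.vecMul, dotProduct, m]

/-- The form in which parametric transversality is used: four equations in a three-dimensional space
of points, regular because along suitable parameter directions the derivatives of the equations form
a triangular matrix. -/
theorem dimH_fst_image_lt_of_triangular {E B : Type*} [NormedAddCommGroup E] [NormedSpace ℝ E]
    [FiniteDimensional ℝ E] [NormedAddCommGroup B] [NormedSpace ℝ B] [FiniteDimensional ℝ B]
    (hB : Module.finrank ℝ B = 3) (hE : 0 < Module.finrank ℝ E) {Z : Set (E × B)}
    (Ψ : Fin 4 → E × B → ℝ)
    (hΨ : ∀ z ∈ Z, (∀ j, ContDiffAt ℝ 1 (Ψ j) z) ∧ (∀ j, Ψ j z = 0) ∧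
      ∃ (v : Fin 4 → E) (m : Fin 4 → Fin 4 → ℝ), (∀ i j, j ≤ i →
        HasDerivAt (fun t : ℝ => Ψ j (z.1 + t • v i, z.2)) (m i j) 0) ∧
        (∀ i j, j < i → m i j = 0) ∧ ∀ i, m i i ≠ 0) :
    dimH (Prod.fst '' Z) < Module.finrank ℝ E := by
  refine dimH_fst_image_lt_of_regular_zeros (fun z j => Ψ j z) (fun z hz => ?_) (by simp [hB]) hE
  obtain ⟨hC, h0, v, m, hder, hm0, hm1⟩ := hΨ z hz
  have hC' : ContDiffAt ℝ 1 (fun z j => Ψ j z) z := contDiffAt_pi.2 hC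
  refine ⟨hC', ?_, funext h0⟩
  have hval : ∀ i j, j ≤ i → fderiv ℝ (fun z j => Ψ j z) z (v i, 0) j = m i j := by
    intro i j hij
    have h1 : HasFDerivAt (Ψ j) ((ContinuousLinearMap.proj j : (Fin 4 → ℝ) →L[ℝ] ℝ) ∘L
        fderiv ℝ (fun z j => Ψ j z) z) z :=
      (ContinuousLinearMap.proj (R := ℝ) (φ := fun _ : Fin 4 => ℝ) j).hasFDerivAt.comp z
        (hC'.differentiableAt (by simp)).hasFDerivAt
    have h2 : HasDerivAt (fun t : ℝ => (z.1 + t • v i, z.2)) (v i, (0 : B)) 0 := by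
      refine HasDerivAt.prodMk ?_ (hasDerivAt_const _ _)
      simpa using ((hasDerivAt_id (0 : ℝ)).smul_const (v i)).const_add z.1
    have h3 : HasFDerivAt (Ψ j) ((ContinuousLinearMap.proj j : (Fin 4 → ℝ) →L[ℝ] ℝ) ∘L
        fderiv ℝ (fun z j => Ψ j z) z) (z.1 + (0 : ℝ) • v i, z.2) := by simpa using h1
    exact (h3.comp_hasDerivAt (0 : ℝ) h2).unique (hder i j hij)
  refine surjective_of_upperTriangular (fderiv ℝ (fun z j => Ψ j z) z : E × B →ₗ[ℝ] Fin 4 → ℝ)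
    (fun i => (v i, 0)) (fun i j hij => ?_) (fun i => ?_)
  · exact (hval i j hij.le).trans (hm0 i j hij)
  · exact fun h => hm1 i ((hval i i le_rfl).symm.trans h)

/-! ### Compact spaces covered by rigid arcs -/

/-- An atlas of rigid arcs on a one-dimensional space `S`: around each point `p` a parametrized open
arc `arc p : (-rad p, rad p) → S` such that two arcs through a common point agree near it up to
translation and reflection of the parameter. Compatible arc-length parametrizations have this
property. -/
structure RigidArcs (S : Type*) [TopologicalSpace S] where
  rad : S → ℝ
  arc : S → ℝ → S
  rad_pos : ∀ p, 0 < rad p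
  arc_zero : ∀ p, arc p 0 = p
  cont : ∀ p s, |s| < rad p → ContinuousAt (arc p) s
  inj : ∀ p s t, |s| < rad p → |t| < rad p → arc p s = arc p t → s = t
  isOpen_image : ∀ p s, |s| < rad p → ∀ U ∈ 𝓝 s, arc p '' U ∈ 𝓝 (arc p s)
  compat : ∀ p q s t, |s| < rad p → |t| < rad q → arc p s = arc q t →
    ∃ e : ℝ, (e = 1 ∨ e = -1) ∧ ∀ᶠ u in 𝓝 (0 : ℝ), arc p (s + u) = arc q (t + e * u)

namespace RigidArcs

variable {S : Type*} [TopologicalSpace S] (𝒮 : RigidArcs S)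

/-- The curve `γ` is, near time `t`, one of the rigid arcs up to translation and reflection. -/
def GeodesicAt (γ : ℝ → S) (t : ℝ) : Prop :=
  ∃ p s e, |s| < 𝒮.rad p ∧ (e = 1 ∨ e = -1) ∧ ∀ᶠ u in 𝓝 (0 : ℝ), γ (t + u) = 𝒮.arc p (s + e * u)

variable {𝒮}

theorem tendsto_sign_mul {e : ℝ} : Tendsto (fun u : ℝ => e * u) (𝓝 0) (𝓝 0) := by
  have : Tendsto (fun u : ℝ => e * u) (𝓝 0) (𝓝 (e * 0)) := tendsto_id.const_mul e
  simpa using this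

theorem eventually_shift {P : ℝ → Prop} {t : ℝ} : (∀ᶠ u in 𝓝 (0 : ℝ), P (t + u)) ↔
    ∀ᶠ w in 𝓝 t, P w := by
  have : map (fun u => t + u) (𝓝 (0 : ℝ)) = 𝓝 t := by simp
  rw [← this, eventually_map]

namespace GeodesicAt

theorem congr {γ γ' : ℝ → S} {t : ℝ} (h : 𝒮.GeodesicAt γ t) (hγ : γ' =ᶠ[𝓝 t] γ) :
    𝒮.GeodesicAt γ' t := by
  obtain ⟨p, s, e, hs, he, hu⟩ := h
  refine ⟨p, s, e, hs, he, ?_⟩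
  filter_upwards [hu, eventually_shift.2 hγ] with u h1 h2
  rw [h2, h1]

theorem apply_eq {γ : ℝ → S} {t : ℝ} {p : S} {s e : ℝ}
    (hu : ∀ᶠ u in 𝓝 (0 : ℝ), γ (t + u) = 𝒮.arc p (s + e * u)) : γ t = 𝒮.arc p s := by
  simpa using hu.self_of_nhds

/-- A geodesic can be written near `t` in terms of any arc through its position. -/
theorem exists_sign {γ : ℝ → S} {t : ℝ} (h : 𝒮.GeodesicAt γ t) {q : S} {s' : ℝ}
    (hs' : |s'| < 𝒮.rad q) (hq : γ t = 𝒮.arc q s') :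
    ∃ e, (e = 1 ∨ e = -1) ∧ ∀ᶠ u in 𝓝 (0 : ℝ), γ (t + u) = 𝒮.arc q (s' + e * u) := by
  obtain ⟨p, s, e, hs, he, hu⟩ := h
  obtain ⟨e', he', hu'⟩ := 𝒮.compat p q s s' hs hs' ((apply_eq hu).symm.trans hq)
  refine ⟨e' * e, ?_, ?_⟩
  · rcases he with rfl | rfl <;> rcases he' with rfl | rfl <;> simp
  · filter_upwards [hu, tendsto_sign_mul.eventually hu'] with u h1 h2
    rw [h1, h2, mul_assoc]

theorem exists_sign_self {γ : ℝ → S} {t : ℝ} (h : 𝒮.GeodesicAt γ t) :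
    ∃ e, (e = 1 ∨ e = -1) ∧ ∀ᶠ u in 𝓝 (0 : ℝ), γ (t + u) = 𝒮.arc (γ t) (e * u) := by
  simpa using h.exists_sign (q := γ t) (s' := 0) (by simpa using 𝒮.rad_pos _)
    (𝒮.arc_zero _).symm

theorem continuousAt {γ : ℝ → S} {t : ℝ} (h : 𝒮.GeodesicAt γ t) : ContinuousAt γ t := by
  obtain ⟨p, s, e, hs, he, hu⟩ := h
  have h1 : ∀ᶠ w in 𝓝 t, γ w = 𝒮.arc p (s + e * (w - t)) := by
    rw [← eventually_shift]; simpa using hu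
  refine ContinuousAt.congr ?_ (EventuallyEq.symm h1)
  have h2 : ContinuousAt (𝒮.arc p) (s + e * (t - t)) := by simpa using 𝒮.cont p s hs
  exact ContinuousAt.comp (f := fun w => s + e * (w - t)) h2 (by fun_prop)

/-- Geodesics are invariant under reparametrization by isometries of the line. -/
theorem comp_affine {γ : ℝ → S} {t c a : ℝ} (ha : a = 1 ∨ a = -1)
    (h : 𝒮.GeodesicAt γ (c + a * t)) : 𝒮.GeodesicAt (fun w => γ (c + a * w)) t := by
  obtain ⟨p, s, e, hs, he, hu⟩ := h
  refine ⟨p, s, e * a, hs, ?_, ?_⟩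
  · rcases he with rfl | rfl <;> rcases ha with rfl | rfl <;> simp
  · filter_upwards [(tendsto_sign_mul (e := a)).eventually hu] with u h1
    rw [mul_assoc, ← h1]; congr 1; ring

theorem arc {p : S} {s : ℝ} (hs : |s| < 𝒮.rad p) : 𝒮.GeodesicAt (𝒮.arc p) s :=
  ⟨p, s, 1, hs, Or.inl rfl, by simp⟩

/-- Geodesics are locally injective. -/
theorem exists_injOn {γ : ℝ → S} {t : ℝ} (h : 𝒮.GeodesicAt γ t) :
    ∃ ε > 0, ∀ u v, |u| < ε → |v| < ε → γ (t + u) = γ (t + v) → u = v := by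
  obtain ⟨e, he, hu⟩ := h.exists_sign_self
  have hr : ∀ᶠ u in 𝓝 (0 : ℝ), |u| < 𝒮.rad (γ t) :=
    (continuous_abs.tendsto' (0 : ℝ) 0 abs_zero).eventually (gt_mem_nhds (𝒮.rad_pos _))
  obtain ⟨ε, hε, hb⟩ := Metric.eventually_nhds_iff.1 (hu.and hr)
  refine ⟨ε, hε, fun u v hu' hv' huv => ?_⟩
  obtain ⟨h1, h2⟩ := hb (y := u) (by simpa using hu')
  obtain ⟨h3, h4⟩ := hb (y := v) (by simpa using hv')
  have := 𝒮.inj _ _ _ (by rcases he with rfl | rfl <;> simpa using h2)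
    (by rcases he with rfl | rfl <;> simpa using h4) (h1.symm.trans (huv.trans h3))
  rcases he with rfl | rfl <;> simpa using this

/-- Geodesics are open maps. -/
theorem range_mem_nhds {γ : ℝ → S} {t : ℝ} (h : 𝒮.GeodesicAt γ t) {U : Set ℝ} (hU : U ∈ 𝓝 t) :
    γ '' U ∈ 𝓝 (γ t) := by
  obtain ⟨p, s, e, hs, he, hu⟩ := h
  have hU' : ∀ᶠ u in 𝓝 (0 : ℝ), t + u ∈ U := eventually_shift.2 hU
  have hee : e * e = 1 := by rcases he with rfl | rfl <;> simp
  have h1 : {w | γ (t + e * (w - s)) = 𝒮.arc p w ∧ t + e * (w - s) ∈ U} ∈ 𝓝 s := by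
    have h2 : Tendsto (fun w => e * (w - s)) (𝓝 s) (𝓝 0) := by
      have : ContinuousAt (fun w => e * (w - s)) s := by fun_prop
      simpa [ContinuousAt] using this
    filter_upwards [h2.eventually hu, h2.eventually hU'] with w h3 h4
    refine ⟨?_, h4⟩
    rw [h3, ← mul_assoc, hee]; congr 1; ring
  have h3 := 𝒮.isOpen_image p s hs _ h1
  rw [apply_eq hu]
  refine mem_of_superset h3 ?_
  rintro _ ⟨w, ⟨hw1, hw2⟩, rfl⟩
  exact ⟨_, hw2, hw1⟩

/-- Geodesics which agree at points accumulating at `t` have the same position and direction at `t`,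
hence agree near `t`. -/
theorem eventuallyEq_of_frequently [T2Space S] {γ₁ γ₂ : ℝ → S} {t : ℝ} (h₁ : 𝒮.GeodesicAt γ₁ t)
    (h₂ : 𝒮.GeodesicAt γ₂ t) (h : ∃ᶠ w in 𝓝[≠] t, γ₁ w = γ₂ w) : γ₁ =ᶠ[𝓝 t] γ₂ := by
  have heq : γ₁ t = γ₂ t := tendsto_nhds_unique_of_frequently_eq
    (h₁.continuousAt.tendsto.mono_left nhdsWithin_le_nhds)
    (h₂.continuousAt.tendsto.mono_left nhdsWithin_le_nhds) h
  obtain ⟨e₁, he₁, hu₁⟩ := h₁.exists_sign_self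
  obtain ⟨e₂, he₂, hu₂⟩ := h₂.exists_sign_self
  rw [← heq] at hu₂
  by_cases he : e₁ = e₂
  · subst he
    refine eventually_shift.1 ?_
    filter_upwards [hu₁, hu₂] with u h1 h2
    rw [h1, h2]
  · exfalso
    have hr : ∀ᶠ u in 𝓝 (0 : ℝ), |u| < 𝒮.rad (γ₁ t) :=
      (continuous_abs.tendsto' (0 : ℝ) 0 abs_zero).eventually (gt_mem_nhds (𝒮.rad_pos _))
    have hall : ∀ᶠ w in 𝓝[≠] t, ¬ γ₁ w = γ₂ w := by
      rw [eventually_nhdsWithin_iff]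
      refine eventually_shift.1 ?_
      filter_upwards [hu₁, hu₂, hr] with u h1 h2 h3 hne h4
      rw [h1, h2] at h4
      have h5 := 𝒮.inj _ _ _ (by rcases he₁ with rfl | rfl <;> simpa using h3)
        (by rcases he₂ with rfl | rfl <;> simpa using h3) h4
      have hu0 : u ≠ 0 := fun h0 => hne (by simp [h0])
      exact he (mul_right_cancel₀ hu0 h5)
    exact h hall

end GeodesicAt

/-- Unique continuation of geodesics. -/
theorem eqOn_of_geodesicAt [T2Space S] {γ₁ γ₂ : ℝ → S} {I : Set ℝ} (hI : IsPreconnected I)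
    (h₁ : ∀ t ∈ I, 𝒮.GeodesicAt γ₁ t) (h₂ : ∀ t ∈ I, 𝒮.GeodesicAt γ₂ t) {t₀ : ℝ}
    (ht₀ : t₀ ∈ I) (h : γ₁ =ᶠ[𝓝 t₀] γ₂) : EqOn γ₁ γ₂ I := by
  have hsub : I ⊆ {t | γ₁ =ᶠ[𝓝 t] γ₂} := by
    refine hI.subset_of_closure_inter_subset (isOpen_setOfPred_eventually_nhds) ⟨t₀, ht₀, h⟩ ?_
    rintro t ⟨htc, htI⟩
    by_contra hne
    refine hne ((h₁ t htI).eventuallyEq_of_frequently (h₂ t htI) ?_)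
    have h3 := mem_closure_iff_frequently.1 htc
    rw [frequently_nhdsWithin_iff]
    refine h3.mono fun w hw => ⟨hw.self_of_nhds, ?_⟩
    rintro rfl
    exact hne hw
  exact fun t ht => (hsub ht).self_of_nhds

/-- By compactness every point lies on an arc at a uniform distance `ρ` from its ends. -/
theorem exists_uniform_rad [CompactSpace S] (𝒮 : RigidArcs S) :
    ∃ ρ > 0, ∀ p, ∃ q s, 𝒮.arc q s = p ∧ |s| + ρ < 𝒮.rad q := by
  have hcov : ∀ q : S, 𝒮.arc q '' (Ioo (-(𝒮.rad q / 2)) (𝒮.rad q / 2)) ∈ 𝓝 q := by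
    intro q
    have hq := 𝒮.rad_pos q
    have := 𝒮.isOpen_image q 0 (by simpa using hq) (Ioo (-(𝒮.rad q / 2)) (𝒮.rad q / 2))
      (Ioo_mem_nhds (by linarith) (by linarith))
    rwa [𝒮.arc_zero] at this
  obtain ⟨t, ht⟩ := CompactSpace.elim_nhds_subcover _ hcov
  obtain ⟨ρ, hρ, hρt⟩ : ∃ ρ > 0, ∀ q ∈ t, ρ < 𝒮.rad q / 2 := by
    have : ∀ᶠ ρ in 𝓝[>] (0 : ℝ), ∀ q ∈ t, ρ < 𝒮.rad q / 2 := by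
      rw [Filter.eventually_all_finset]
      intro q _
      exact mem_nhdsWithin_of_mem_nhds (gt_mem_nhds (by linarith [𝒮.rad_pos q]))
    obtain ⟨ρ, h1, h2⟩ := (this.and self_mem_nhdsWithin).exists
    exact ⟨ρ, h2, h1⟩
  refine ⟨ρ, hρ, fun p => ?_⟩
  have hp : p ∈ (⊤ : Set S) := trivial
  rw [← ht] at hp
  simp only [mem_iUnion] at hp
  obtain ⟨q, hq, s, hs, rfl⟩ := hp
  refine ⟨q, s, rfl, ?_⟩
  have := hρt q hq
  have h2 : |s| < 𝒮.rad q / 2 := abs_lt.2 hs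
  linarith

/-- A geodesic can be continued beyond the end of its interval by a definite amount. -/
theorem exists_extend_right {ρ : ℝ} (hρ : 0 < ρ)
    (hq : ∀ p, ∃ q s, 𝒮.arc q s = p ∧ |s| + ρ < 𝒮.rad q) {γ : ℝ → S} {a c b : ℝ} (hac : a < c)
    (hcb : c < b) (hγ : ∀ t ∈ Ioo a b, 𝒮.GeodesicAt γ t) :
    ∃ γ' : ℝ → S, γ' =ᶠ[𝓝 c] γ ∧ ∀ t ∈ Ioo a (b + ρ / 2), 𝒮.GeodesicAt γ' t := by
  obtain ⟨t₁, ht₁⟩ : ∃ t₁, max c (b - ρ / 2) < t₁ ∧ t₁ < b := exists_between (by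
    rw [max_lt_iff]; exact ⟨hcb, by linarith⟩)
  obtain ⟨⟨hct, hbt⟩, htb⟩ := (max_lt_iff.1 ht₁.1), ht₁.2
  obtain ⟨q, s, hqs, hsr⟩ := hq (γ t₁)
  obtain ⟨e, he, hu⟩ := (hγ t₁ ⟨hac.trans hct, htb⟩).exists_sign (q := q) (s' := s)
    (by linarith) hqs.symm
  have hτ : ∀ t, |t - t₁| < ρ →
      𝒮.GeodesicAt (fun w => 𝒮.arc q ((s - e * t₁) + e * w)) t := by
    intro t ht
    refine GeodesicAt.comp_affine he (GeodesicAt.arc ?_)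
    have h1 : s - e * t₁ + e * t = s + e * (t - t₁) := by ring
    rw [h1]
    have h2 : |e * (t - t₁)| = |t - t₁| := by rcases he with rfl | rfl <;> simp [abs_sub_comm]
    linarith [abs_add_le s (e * (t - t₁))]
  have hγτ : γ =ᶠ[𝓝 t₁] fun w => 𝒮.arc q ((s - e * t₁) + e * w) := by
    refine eventually_shift.1 ?_
    filter_upwards [hu] with u h1
    rw [h1]; congr 1; ring
  let γ' : ℝ → S := fun t => if t < t₁ then γ t else 𝒮.arc q ((s - e * t₁) + e * t)
  have hlt : ∀ t < t₁, γ' =ᶠ[𝓝 t] γ := fun t ht => by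
    filter_upwards [gt_mem_nhds ht] with w hw
    exact if_pos hw
  refine ⟨γ', hlt c hct, fun t ht => ?_⟩
  rcases lt_trichotomy t t₁ with h | rfl | h
  · exact (hγ t ⟨ht.1, h.trans htb⟩).congr (hlt t h)
  · refine (hγ t ⟨hac.trans hct, htb⟩).congr ?_
    filter_upwards [hγτ] with w hw
    by_cases hwt : w < t
    · exact if_pos hwt
    · exact (if_neg hwt).trans hw.symm
  · refine (hτ t ?_).congr ?_
    · rw [abs_of_pos (by linarith)]; linarith [ht.2]
    · filter_upwards [lt_mem_nhds h] with w hw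
      exact if_neg hw.le.not_gt

/-- Iterating the continuation, geodesics exist on arbitrarily long intervals. -/
theorem exists_geodesic_Ioo [CompactSpace S] (𝒮 : RigidArcs S) (p : S) (a : ℝ) :
    ∃ γ : ℝ → S, γ =ᶠ[𝓝 0] 𝒮.arc p ∧ ∀ t ∈ Ioo (-a) a, 𝒮.GeodesicAt γ t := by
  obtain ⟨ρ, hρ, hq⟩ := 𝒮.exists_uniform_rad
  have hn : ∀ n : ℕ, ∃ γ : ℝ → S, γ =ᶠ[𝓝 0] 𝒮.arc p ∧
      ∀ t ∈ Ioo (-(𝒮.rad p + n * (ρ / 2))) (𝒮.rad p + n * (ρ / 2)), 𝒮.GeodesicAt γ t := by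
    intro n
    induction n with
    | zero =>
      refine ⟨𝒮.arc p, EventuallyEq.rfl, fun t ht => GeodesicAt.arc (abs_lt.2 ?_)⟩
      simpa using ht
    | succ n ih =>
      obtain ⟨γ, hγ0, hγ⟩ := ih
      have hpos : 0 < 𝒮.rad p + n * (ρ / 2) := by have := 𝒮.rad_pos p; positivity
      obtain ⟨γ₁, h10, h1⟩ := exists_extend_right hρ hq (neg_lt_zero.2 hpos) hpos hγ
      -- the extension to the left is the extension to the right of the reversed geodesic
      have h2 : ∀ t ∈ Ioo (-(𝒮.rad p + n * (ρ / 2) + ρ / 2)) (𝒮.rad p + n * (ρ / 2)),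
          𝒮.GeodesicAt (fun w => γ₁ (0 + (-1) * w)) t := by
        intro t ht
        refine GeodesicAt.comp_affine (Or.inr rfl) (h1 _ ⟨?_, ?_⟩) <;> linarith [ht.1, ht.2]
      obtain ⟨γ₂, h20, h3⟩ := exists_extend_right hρ hq (c := 0) (by linarith) hpos h2
      refine ⟨fun w => γ₂ (0 + (-1) * w), ?_, fun t ht => ?_⟩
      · have hneg : Tendsto (fun w : ℝ => 0 + (-1) * w) (𝓝 0) (𝓝 0) := by
          have : ContinuousAt (fun w : ℝ => 0 + (-1) * w) 0 := by fun_prop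
          simpa [ContinuousAt] using this
        filter_upwards [hneg.eventually h20, h10, hγ0] with w hw1 hw2 hw3
        rw [hw1, ← hw3, ← hw2]; congr 1; ring
      · push_cast at ht
        refine GeodesicAt.comp_affine (Or.inr rfl) (h3 _ ⟨?_, ?_⟩) <;> linarith [ht.1, ht.2]
  obtain ⟨n, hna⟩ := exists_nat_gt (a / (ρ / 2))
  obtain ⟨γ, hγ0, hγ⟩ := hn n
  refine ⟨γ, hγ0, fun t ht => hγ t ?_⟩
  rw [div_lt_iff₀ (by positivity)] at hna
  have := 𝒮.rad_pos p
  exact ⟨by linarith [ht.1], by linarith [ht.2]⟩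

/-- The geodesics on long intervals agree with each other and define one on the whole line. -/
theorem exists_geodesic [CompactSpace S] [T2Space S] (𝒮 : RigidArcs S) (p : S) :
    ∃ γ : ℝ → S, γ 0 = p ∧ ∀ t, 𝒮.GeodesicAt γ t := by
  choose γ h0 hγ using 𝒮.exists_geodesic_Ioo p
  refine ⟨fun t => γ (|t| + 1) t, ?_, fun t => ?_⟩
  · exact (h0 _).self_of_nhds.trans (𝒮.arc_zero p)
  · refine (hγ (|t| + 1) t ?_).congr ?_
    · constructor <;> linarith [le_abs_self t, neg_abs_le t]
    · have hab : ∀ᶠ w in 𝓝 t, |w| < |t| + 1 :=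
        continuous_abs.continuousAt.eventually (gt_mem_nhds (by linarith))
      filter_upwards [hab] with w hw
      let m := min (|w| + 1) (|t| + 1)
      have hm0 : |w| < m := lt_min (by linarith) hw
      refine eqOn_of_geodesicAt (𝒮 := 𝒮) (I := Ioo (-m) m) isPreconnected_Ioo
        (fun u hu => hγ _ u ?_) (fun u hu => hγ _ u ?_) (t₀ := 0) ?_
        ((h0 _).trans (h0 _).symm) (abs_lt.1 hm0)
      · have : m ≤ |w| + 1 := min_le_left _ _
        exact ⟨by linarith [hu.1], by linarith [hu.2]⟩
      · have : m ≤ |t| + 1 := min_le_right _ _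
        exact ⟨by linarith [hu.1], by linarith [hu.2]⟩
      · have : 0 < m := (abs_nonneg w).trans_lt hm0
        exact ⟨by linarith, by linarith⟩

section Global

variable {γ : ℝ → S} (hγ : ∀ t, 𝒮.GeodesicAt γ t)
include hγ

theorem isOpen_range_geodesic : IsOpen (range γ) := by
  rw [isOpen_iff_mem_nhds]
  rintro _ ⟨t, rfl⟩
  simpa using (hγ t).range_mem_nhds univ_mem

variable [T2Space S]

/-- The arc through a limit point of a geodesic meets it, hence is part of it. -/
theorem isClosed_range_geodesic : IsClosed (range γ) := by
  rw [← closure_subset_iff_isClosed]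
  intro p hp
  have hr := 𝒮.rad_pos p
  have hN := 𝒮.isOpen_image p 0 (by simpa using hr) (Ioo (-𝒮.rad p) (𝒮.rad p))
      (Ioo_mem_nhds (by linarith) (by linarith))
  rw [𝒮.arc_zero] at hN
  obtain ⟨_, ⟨s, hs, rfl⟩, ⟨t, ht⟩⟩ := mem_closure_iff_nhds.1 hp _ hN
  obtain ⟨e, he, hu⟩ := (hγ t).exists_sign (abs_lt.2 hs) ht
  have hee : e * e = 1 := by rcases he with rfl | rfl <;> simp
  have heab : ∀ x, |e * x| = |x| := by intro x; rcases he with rfl | rfl <;> simp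
  let c := t - e * s
  have hsub : ∀ w, (s - e * t) + e * w = e * (w - c) := by
    intro w
    have : e * (w - c) = e * w - e * t + (e * e) * s := by simp only [c]; ring
    rw [this, hee]; ring
  -- continuing `γ` along the arc around `p`, it passes through `p` at the time `c`
  have heq : EqOn γ (fun w => 𝒮.arc p ((s - e * t) + e * w)) (Ioo (c - 𝒮.rad p) (c + 𝒮.rad p)) := by
    refine eqOn_of_geodesicAt (𝒮 := 𝒮) isPreconnected_Ioo (fun w _ => hγ w) (fun w hw => ?_)
      (t₀ := t) ?_ ?_
    · refine GeodesicAt.comp_affine he (GeodesicAt.arc ?_)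
      rw [hsub, heab, abs_lt]
      constructor <;> linarith [hw.1, hw.2]
    · have h1 : |t - c| < 𝒮.rad p := by
        have : t - c = e * s := by simp only [c]; ring
        rw [this, heab]; exact abs_lt.2 hs
      rw [abs_lt] at h1
      constructor <;> linarith [h1.1, h1.2]
    · refine eventually_shift.1 ?_
      filter_upwards [hu] with u h1
      rw [h1]; congr 1; ring
  refine ⟨c, ?_⟩
  rw [heq ⟨by linarith, by linarith⟩]
  simp only [hsub]
  simp [𝒮.arc_zero]

/-- An injective geodesic would be a closed embedding of the line into a compact space. -/
theorem not_injective_geodesic [CompactSpace S] : ¬ Function.Injective γ := by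
  intro hinj
  have hcont : Continuous γ := continuous_iff_continuousAt.2 fun t => (hγ t).continuousAt
  have hopen : IsOpenMap γ := by
    refine isOpenMap_iff_nhds_le.2 fun t => ?_
    intro V hV
    exact mem_of_superset ((hγ t).range_mem_nhds hV) (by simp)
  have hemb : IsClosedEmbedding γ :=
    ⟨(IsOpenEmbedding.of_continuous_injective_isOpenMap hcont hinj hopen).isEmbedding,
      isClosed_range_geodesic hγ⟩
  have := hemb.compactSpace
  exact not_compactSpace_iff.2 (inferInstance : NoncompactSpace ℝ) this

/-- A self-intersection of a geodesic is a period: it cannot return with reversed direction, since it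
would then be folded at the midpoint. -/
theorem periodic_of_apply_eq {s t : ℝ} (hst : γ s = γ t) : ∀ w, γ (w + (t - s)) = γ w := by
  obtain ⟨e₁, he₁, hu₁⟩ := (hγ s).exists_sign_self
  obtain ⟨e₂, he₂, hu₂⟩ := (hγ t).exists_sign_self
  rw [← hst] at hu₂
  by_cases he : e₁ = e₂
  · subst he
    have heq : EqOn (fun w => γ ((t - s) + 1 * w)) γ univ := by
      refine eqOn_of_geodesicAt (𝒮 := 𝒮) isPreconnected_univ
        (fun w _ => GeodesicAt.comp_affine (Or.inl rfl) (hγ _)) (fun w _ => hγ w) (mem_univ s) ?_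
      refine eventually_shift.1 ?_
      filter_upwards [hu₁, hu₂] with u h1 h2
      rw [h1, ← h2]; congr 1; ring
    intro w
    rw [← heq (mem_univ w)]
    simp only; congr 1; ring
  · have he' : ∀ u, e₁ * u = e₂ * (-u) := by
      intro u
      rcases he₁ with rfl | rfl <;> rcases he₂ with rfl | rfl <;> simp at *
    have heq : EqOn (fun w => γ ((s + t) + (-1) * w)) γ univ := by
      refine eqOn_of_geodesicAt (𝒮 := 𝒮) isPreconnected_univ
        (fun w _ => GeodesicAt.comp_affine (Or.inr rfl) (hγ _)) (fun w _ => hγ w) (mem_univ s) ?_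
      refine eventually_shift.1 ?_
      have hneg : Tendsto (fun w : ℝ => -w) (𝓝 0) (𝓝 0) := by
        simpa using (continuous_neg (G := ℝ)).tendsto 0
      filter_upwards [hu₁, hneg.eventually hu₂] with u h1 h2
      rw [h1, he' u, ← h2]; congr 1; ring
    exfalso
    obtain ⟨ε, hε, hinj⟩ := (hγ ((s + t) / 2)).exists_injOn
    have h1 : |ε / 2| < ε := by rw [abs_of_pos (by linarith)]; linarith
    have h2 := hinj (ε / 2) (-(ε / 2)) h1 (by rwa [abs_neg]) (by
      rw [← heq (mem_univ _)]; simp only; congr 1; ring)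
    linarith

/-- The periods form a discrete subgroup of the line, which is not trivial as the geodesic is not
injective. -/
theorem exists_period [CompactSpace S] :
    ∃ T > 0, Function.Periodic γ T ∧ ∀ s t, γ s = γ t → ∃ n : ℤ, s = t + n * T := by
  let P : AddSubgroup ℝ :=
    { carrier := {T | ∀ w, γ (w + T) = γ w}
      add_mem' := fun {a b} ha hb w => by rw [← add_assoc, hb, ha]
      zero_mem' := by simp
      neg_mem' := fun {a} ha w => by
        have := ha (w + -a)
        rw [← this]; congr 1; ring }
  have hP : ∀ T, T ∈ P ↔ ∀ w, γ (w + T) = γ w := fun T => Iff.rfl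
  obtain ⟨ε, hε, hinj⟩ := (hγ 0).exists_injOn
  have hnd : ¬ Dense (P : Set ℝ) := by
    intro hd
    obtain ⟨T, hT, hTP⟩ := hd.exists_mem_open (isOpen_Ioo (a := 0) (b := ε)) ⟨ε / 2, by
      constructor <;> linarith⟩
    have := hinj T 0 (by rw [abs_of_pos hTP.1]; exact hTP.2) (by simpa using hε) (by
      have := (hP T).1 hT 0
      simpa using this)
    linarith [hTP.1]
  obtain ⟨a, ha⟩ := (AddSubgroup.dense_or_cyclic P).resolve_left hnd
  have hmem : ∀ T, T ∈ P ↔ ∃ n : ℤ, n * a = T := by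
    intro T; rw [ha, AddSubgroup.mem_closure_singleton]; simp
  have ha0 : a ≠ 0 := by
    rintro rfl
    refine not_injective_geodesic hγ fun s t hst => ?_
    obtain ⟨n, hn⟩ := (hmem (t - s)).1 ((hP _).2 (periodic_of_apply_eq hγ hst))
    simp at hn; linarith
  refine ⟨|a|, abs_pos.2 ha0, ?_, fun s t hst => ?_⟩
  · rcases abs_choice a with h | h <;> rw [h]
    · exact (hP a).1 ((hmem a).2 ⟨1, by simp⟩)
    · exact (hP (-a)).1 ((hmem _).2 ⟨-1, by simp⟩)
  · obtain ⟨n, hn⟩ := (hmem (s - t)).1 ((hP _).2 (periodic_of_apply_eq hγ hst.symm))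
    rcases abs_choice a with h | h <;> rw [h]
    · exact ⟨n, by linarith⟩
    · exact ⟨-n, by push_cast; linarith⟩

/-- Geodesics which meet are equal up to reparametrization. -/
theorem range_subset_of_meet {γ' : ℝ → S} (hγ' : ∀ t, 𝒮.GeodesicAt γ' t) {t t' : ℝ}
    (h : γ t = γ' t') : range γ ⊆ range γ' := by
  obtain ⟨e₁, he₁, hu₁⟩ := (hγ t).exists_sign_self
  obtain ⟨e₂, he₂, hu₂⟩ := (hγ' t').exists_sign_self
  rw [← h] at hu₂
  have hee : e₂ * e₂ = 1 := by rcases he₂ with rfl | rfl <;> simp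
  let e := e₂ * e₁
  have heq : EqOn γ (fun w => γ' ((t' - e * t) + e * w)) univ := by
    refine eqOn_of_geodesicAt (𝒮 := 𝒮) isPreconnected_univ (fun w _ => hγ w)
      (fun w _ => GeodesicAt.comp_affine ?_ (hγ' _)) (mem_univ t) ?_
    · rcases he₁ with rfl | rfl <;> rcases he₂ with rfl | rfl <;> simp [e]
    · refine eventually_shift.1 ?_
      filter_upwards [hu₁, (tendsto_sign_mul (e := e)).eventually hu₂] with u h1 h2
      have h3 : e₂ * (e * u) = e₁ * u := by
        simp only [e]; rw [← mul_assoc, ← mul_assoc, hee, one_mul]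
      have h4 : t' - e * t + e * (t + u) = t' + e * u := by ring
      rw [h1, h4, h2, h3]
  rintro _ ⟨w, rfl⟩
  exact ⟨_, (heq (mem_univ w)).symm⟩

end Global

/-- A compact Hausdorff space with an atlas of rigid arcs is a finite disjoint union of circles,
parametrized by periodic geodesics. -/
theorem exists_circles [CompactSpace S] [T2Space S] (𝒮 : RigidArcs S) :
    ∃ (n : ℕ) (γ : Fin n → ℝ → S) (T : Fin n → ℝ), (∀ i, 0 < T i) ∧
      (∀ i t, 𝒮.GeodesicAt (γ i) t) ∧ (∀ i, Function.Periodic (γ i) (T i)) ∧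
      (∀ i s t, γ i s = γ i t → ∃ n : ℤ, s = t + n * T i) ∧
      (Pairwise fun i j => Disjoint (range (γ i)) (range (γ j))) ∧ ⋃ i, range (γ i) = univ := by
  choose γ h0 hγ using 𝒮.exists_geodesic
  have hnhds : ∀ p, range (γ p) ∈ 𝓝 p := fun p =>
    (isOpen_range_geodesic (hγ p)).mem_nhds ⟨0, h0 p⟩
  obtain ⟨t, ht⟩ := CompactSpace.elim_nhds_subcover _ hnhds
  classical
  -- one geodesic for each of the finitely many distinct ranges
  let R : Finset (Set S) := t.image fun p => range (γ p)
  have hR : ∀ c : R, ∃ p, range (γ p) = c := by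
    rintro ⟨c, hc⟩
    obtain ⟨p, -, hp⟩ := Finset.mem_image.1 hc
    exact ⟨p, hp⟩
  choose P hPR using hR
  let e := R.equivFin.symm
  choose T hT hper hinj using fun p => exists_period (hγ p)
  refine ⟨R.card, fun i => γ (P (e i)), fun i => T (P (e i)), fun i => hT _, fun i => hγ _,
    fun i => hper _, fun i => hinj _, fun i j hij => ?_, ?_⟩
  · refine Set.disjoint_iff_forall_ne.2 ?_
    rintro _ ⟨s, rfl⟩ _ ⟨s', rfl⟩ h
    refine hij (e.injective (Subtype.ext ?_))
    rw [← hPR, ← hPR]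
    exact (range_subset_of_meet (hγ _) (hγ _) h).antisymm (range_subset_of_meet (hγ _) (hγ _) h.symm)
  · refine eq_univ_of_forall fun p => ?_
    have hp : p ∈ (⊤ : Set S) := trivial
    rw [← ht] at hp
    simp only [mem_iUnion] at hp
    obtain ⟨q, hq, hpq⟩ := hp
    have hc : range (γ q) ∈ R := Finset.mem_image.2 ⟨q, hq, rfl⟩
    rw [mem_iUnion]
    refine ⟨e.symm ⟨_, hc⟩, ?_⟩
    simp only [Equiv.apply_symm_apply, hPR]
    exact hpq

end RigidArcs

/-! ### Jets and the degeneracy conditions -/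

/-- The data at a point on which all the nondegeneracy conditions depend: the slopes of the plane
field and their first partial derivatives, and the partial derivatives of order at most three of the
first two components of the vector field. -/
abbrev Jet : Type :=
  (Fin 2 → ℝ) × (Fin 2 → Fin 3 → ℝ) × (Fin 2 → ℝ) × (Fin 2 → Fin 3 → ℝ) ×
    (Fin 2 → Fin 3 → Fin 3 → ℝ) × (Fin 2 → Fin 3 → Fin 3 → Fin 3 → ℝ)

namespace Jet

/-- The slopes: the plane is spanned by `(1, 0, slope 0)` and `(0, 1, slope 1)`. -/
def slope (j : Jet) (d : Fin 2) : ℝ := j.1 d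

/-- `dslope d i` is the `i`-th partial derivative of the `d`-th slope. -/
def dslope (j : Jet) (d : Fin 2) (i : Fin 3) : ℝ := j.2.1 d i

/-- Values of the two components. -/
def y0 (j : Jet) (c : Fin 2) : ℝ := j.2.2.1 c

/-- First partial derivatives; the first index is the component. -/
def y1 (j : Jet) (c : Fin 2) (i : Fin 3) : ℝ := j.2.2.2.1 c i

/-- Second partial derivatives; the first index is the component. -/
def y2 (j : Jet) (c : Fin 2) (i k : Fin 3) : ℝ := j.2.2.2.2.1 c i k

/-- Third partial derivatives; the first index is the component. -/
def y3 (j : Jet) (c : Fin 2) (i k l : Fin 3) : ℝ := j.2.2.2.2.2 c i k l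

/-- The matrix of the derivative of the two components restricted to the plane field, in the basis
of the plane given by the slopes. At a zero it represents the transverse linearization. -/
def mat (j : Jet) (c d : Fin 2) : ℝ := j.y1 c d.castSucc + j.slope d * j.y1 c 2

/-- The trace of `mat`. -/
def tr (j : Jet) : ℝ := j.mat 0 0 + j.mat 1 1

/-- The determinant of `mat`. -/
def det (j : Jet) : ℝ := j.mat 0 0 * j.mat 1 1 - j.mat 0 1 * j.mat 1 0

/-- The `i`-th partial derivative of the entries of `mat`. -/
def dmat (j : Jet) (i : Fin 3) (c d : Fin 2) : ℝ :=
  j.y2 c i d.castSucc + j.dslope d i * j.y1 c 2 + j.slope d * j.y2 c i 2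

/-- The `i`-th partial derivative of the trace. -/
def dtr (j : Jet) (i : Fin 3) : ℝ := j.dmat i 0 0 + j.dmat i 1 1

/-- The `i`-th partial derivative of the determinant. -/
def ddet (j : Jet) (i : Fin 3) : ℝ :=
  j.dmat i 0 0 * j.mat 1 1 + j.mat 0 0 * j.dmat i 1 1 -
    (j.dmat i 0 1 * j.mat 1 0 + j.mat 0 1 * j.dmat i 1 0)

/-- The cross product of the gradients of the two components, a tangent vector of the zero set. -/
def ker (j : Jet) : Fin 3 → ℝ :=
  ![j.y1 0 1 * j.y1 1 2 - j.y1 0 2 * j.y1 1 1, j.y1 0 2 * j.y1 1 0 - j.y1 0 0 * j.y1 1 2,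
    j.y1 0 0 * j.y1 1 1 - j.y1 0 1 * j.y1 1 0]

/-- The derivative of the trace along the zero set. -/
def trAlong (j : Jet) : ℝ := j.ker 0 * j.dtr 0 + j.ker 1 * j.dtr 1 + j.ker 2 * j.dtr 2

/-- The derivative of the determinant along the zero set. -/
def detAlong (j : Jet) : ℝ := j.ker 0 * j.ddet 0 + j.ker 1 * j.ddet 1 + j.ker 2 * j.ddet 2

/-- The frequency at a Hopf point. -/
def freq (j : Jet) : ℝ := √ j.det

/-- First vector of the basis of the plane in which the linear part at a Hopf point is in
normal form. -/
def hopf₁ (j : Jet) : Fin 3 → ℝ := ![1, 0, j.slope 0]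

/-- Second vector of the basis of the plane in which the linear part at a Hopf point is in
normal form. -/
def hopf₂ (j : Jet) : Fin 3 → ℝ :=
  ![j.mat 0 0 / j.freq, j.mat 1 0 / j.freq,
    (j.slope 0 * j.mat 0 0 + j.slope 1 * j.mat 1 0) / j.freq]

/-- The first coordinate, in the basis `hopf₁, hopf₂`, of a vector of the plane with components
`v`. -/
def coord₁ (j : Jet) (v : Fin 2 → ℝ) : ℝ := v 0 - j.mat 0 0 / j.mat 1 0 * v 1

/-- The second coordinate, in the basis `hopf₁, hopf₂`, of a vector of the plane with components
`v`. -/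
def coord₂ (j : Jet) (v : Fin 2 → ℝ) : ℝ := j.freq / j.mat 1 0 * v 1

/-- The second derivative of the pair of components along the vectors `u, v`. -/
def quad (j : Jet) (u v : Fin 3 → ℝ) (c : Fin 2) : ℝ := ∑ i, ∑ k, j.y2 c i k * (u i * v k)

/-- The third derivative of the pair of components along the vectors `u, v, w`. -/
def cubic (j : Jet) (u v w : Fin 3 → ℝ) (c : Fin 2) : ℝ :=
  ∑ i, ∑ k, ∑ l, j.y3 c i k l * (u i * (v k * w l))

/-- The first Lyapunov coefficient at a Hopf point. -/
def lyapunov (j : Jet) : ℝ :=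
  (1 / 16) * (j.coord₁ (j.cubic j.hopf₁ j.hopf₁ j.hopf₁) +
      j.coord₁ (j.cubic j.hopf₁ j.hopf₂ j.hopf₂) + j.coord₂ (j.cubic j.hopf₁ j.hopf₁ j.hopf₂) +
      j.coord₂ (j.cubic j.hopf₂ j.hopf₂ j.hopf₂)) +
    (1 / (16 * j.freq)) *
      (j.coord₁ (j.quad j.hopf₁ j.hopf₂) *
          (j.coord₁ (j.quad j.hopf₁ j.hopf₁) + j.coord₁ (j.quad j.hopf₂ j.hopf₂)) -
        j.coord₂ (j.quad j.hopf₁ j.hopf₂) *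
          (j.coord₂ (j.quad j.hopf₁ j.hopf₁) + j.coord₂ (j.quad j.hopf₂ j.hopf₂)) -
        j.coord₁ (j.quad j.hopf₁ j.hopf₁) * j.coord₂ (j.quad j.hopf₁ j.hopf₁) +
        j.coord₁ (j.quad j.hopf₂ j.hopf₂) * j.coord₂ (j.quad j.hopf₂ j.hopf₂))

/-- The jets of fixed points at which one of the nondegeneracy conditions fails: the zero set is
not regular, the transverse eigenvalue zero is double, a zero eigenvalue or a pair with zero sum
does not move with nonzero speed, or the Lyapunov coefficient vanishes. -/
def Bad (j : Jet) : Prop :=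
  j.y0 = 0 ∧ (j.ker = 0 ∨ (j.tr = 0 ∧ j.det = 0) ∨ (j.det = 0 ∧ j.detAlong = 0) ∨
    (j.tr = 0 ∧ j.trAlong = 0) ∨ (j.tr = 0 ∧ 0 < j.det ∧ j.lyapunov = 0))

section Smooth

@[fun_prop] theorem contDiff_slope (d) : ContDiff ℝ ∞ fun j : Jet => j.slope d := by
  unfold slope; fun_prop
@[fun_prop] theorem contDiff_dslope (d i) : ContDiff ℝ ∞ fun j : Jet => j.dslope d i := by
  unfold dslope; fun_prop
@[fun_prop] theorem contDiff_y0 (c) : ContDiff ℝ ∞ fun j : Jet => j.y0 c := by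
  unfold y0; fun_prop
@[fun_prop] theorem contDiff_y1 (c i) : ContDiff ℝ ∞ fun j : Jet => j.y1 c i := by
  unfold y1; fun_prop
@[fun_prop] theorem contDiff_y2 (c i k) : ContDiff ℝ ∞ fun j : Jet => j.y2 c i k := by
  unfold y2; fun_prop
@[fun_prop] theorem contDiff_y3 (c i k l) : ContDiff ℝ ∞ fun j : Jet => j.y3 c i k l := by
  unfold y3; fun_prop
@[fun_prop] theorem contDiff_mat (c d) : ContDiff ℝ ∞ fun j : Jet => j.mat c d := by
  unfold mat; fun_prop
@[fun_prop] theorem contDiff_tr : ContDiff ℝ ∞ tr := by unfold tr; fun_prop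
@[fun_prop] theorem contDiff_det : ContDiff ℝ ∞ det := by unfold det; fun_prop
@[fun_prop] theorem contDiff_dmat (i c d) : ContDiff ℝ ∞ fun j : Jet => j.dmat i c d := by
  unfold dmat; fun_prop
@[fun_prop] theorem contDiff_dtr (i) : ContDiff ℝ ∞ fun j : Jet => j.dtr i := by
  unfold dtr; fun_prop
@[fun_prop] theorem contDiff_ddet (i) : ContDiff ℝ ∞ fun j : Jet => j.ddet i := by
  unfold ddet; fun_prop
@[fun_prop] theorem contDiff_ker (i) : ContDiff ℝ ∞ fun j : Jet => j.ker i := by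
  fin_cases i <;> simp only [ker, Fin.zero_eta, Fin.mk_one, Fin.reduceFinMk, Matrix.cons_val] <;>
    fun_prop
@[fun_prop] theorem contDiff_trAlong : ContDiff ℝ ∞ trAlong := by unfold trAlong; fun_prop
@[fun_prop] theorem contDiff_detAlong : ContDiff ℝ ∞ detAlong := by unfold detAlong; fun_prop

/-- Where the eigenvalues are imaginary the matrix is not triangular, so that its first basis vector
is cyclic; this makes the basis `hopf₁, hopf₂` meaningful. -/
theorem mat_one_zero_ne_zero {j : Jet} (ht : j.tr = 0) (hd : 0 < j.det) : j.mat 1 0 ≠ 0 := by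
  intro h
  simp only [tr, det] at ht hd
  rw [h] at hd
  have : j.mat 1 1 = -j.mat 0 0 := by linarith
  rw [this] at hd
  nlinarith [sq_nonneg (j.mat 0 0)]

theorem contDiffAt_lyapunov {j : Jet} (hd : 0 < j.det) (hm : j.mat 1 0 ≠ 0) :
    ContDiffAt ℝ 1 lyapunov j := by
  have hw : ContDiffAt ℝ 1 freq j :=
    (contDiff_det.contDiffAt.of_le (by simp)).sqrt hd.ne'
  have hw0 : j.freq ≠ 0 := (Real.sqrt_pos.2 hd).ne'
  have hmat : ∀ c d, ContDiffAt ℝ 1 (fun j : Jet => j.mat c d) j := fun c d =>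
    (contDiff_mat c d).contDiffAt.of_le (by simp)
  have hs : ∀ d, ContDiffAt ℝ 1 (fun j : Jet => j.slope d) j := fun d =>
    (contDiff_slope d).contDiffAt.of_le (by simp)
  have h1 : ∀ i, ContDiffAt ℝ 1 (fun j : Jet => j.hopf₁ i) j := by
    intro i
    fin_cases i
    · exact contDiffAt_const
    · exact contDiffAt_const
    · exact hs 0
  have h2 : ∀ i, ContDiffAt ℝ 1 (fun j : Jet => j.hopf₂ i) j := by
    intro i
    fin_cases i
    · exact (hmat 0 0).div hw hw0
    · exact (hmat 1 0).div hw hw0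
    · exact (((hs 0).mul (hmat 0 0)).add ((hs 1).mul (hmat 1 0))).div hw hw0
  have hc1 : ∀ v : Jet → Fin 2 → ℝ, (∀ c, ContDiffAt ℝ 1 (fun j => v j c) j) →
      ContDiffAt ℝ 1 (fun j => j.coord₁ (v j)) j := fun v hv =>
    (hv 0).sub (((hmat 0 0).div (hmat 1 0) hm).mul (hv 1))
  have hc2 : ∀ v : Jet → Fin 2 → ℝ, (∀ c, ContDiffAt ℝ 1 (fun j => v j c) j) →
      ContDiffAt ℝ 1 (fun j => j.coord₂ (v j)) j := fun v hv =>
    (hw.div (hmat 1 0) hm).mul (hv 1)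
  have hq : ∀ u v : Jet → Fin 3 → ℝ, (∀ c, ContDiffAt ℝ 1 (fun j => u j c) j) →
      (∀ c, ContDiffAt ℝ 1 (fun j => v j c) j) → ∀ c,
      ContDiffAt ℝ 1 (fun j => j.quad (u j) (v j) c) j := fun u v hu hv c => by
    unfold quad
    exact ContDiffAt.sum fun i _ => ContDiffAt.sum fun k _ =>
      ((contDiff_y2 c i k).contDiffAt.of_le (by simp)).mul ((hu i).mul (hv k))
  have hk : ∀ u v w : Jet → Fin 3 → ℝ, (∀ c, ContDiffAt ℝ 1 (fun j => u j c) j) →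
      (∀ c, ContDiffAt ℝ 1 (fun j => v j c) j) → (∀ c, ContDiffAt ℝ 1 (fun j => w j c) j) → ∀ c,
      ContDiffAt ℝ 1 (fun j => j.cubic (u j) (v j) (w j) c) j := fun u v w hu hv hw' c => by
    unfold cubic
    exact ContDiffAt.sum fun i _ => ContDiffAt.sum fun k _ => ContDiffAt.sum fun l _ =>
      ((contDiff_y3 c i k l).contDiffAt.of_le (by simp)).mul ((hu i).mul ((hv k).mul (hw' l)))
  have q11 := hq _ _ h1 h1
  have q12 := hq _ _ h1 h2
  have q22 := hq _ _ h2 h2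
  exact (contDiffAt_const.mul ((((hc1 _ (hk _ _ _ h1 h1 h1)).add (hc1 _ (hk _ _ _ h1 h2 h2))).add
      (hc2 _ (hk _ _ _ h1 h1 h2))).add (hc2 _ (hk _ _ _ h2 h2 h2)))).add
    ((contDiffAt_const.div (contDiffAt_const.mul hw) (by simpa using hw0)).mul
      (((((hc1 _ q12).mul ((hc1 _ q11).add (hc1 _ q22))).sub
        ((hc2 _ q12).mul ((hc2 _ q11).add (hc2 _ q22)))).sub ((hc1 _ q11).mul (hc2 _ q11))).add
        ((hc1 _ q22).mul (hc2 _ q22))))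

end Smooth

/-- The set of bad jets is closed: the Lyapunov coefficient is continuous where the trace vanishes
and the determinant is positive, and the boundary case of trace and determinant zero is itself bad.
-/
theorem isOpen_not_bad : IsOpen {j : Jet | ¬ j.Bad} := by
  have cy0 : Continuous fun j : Jet => j.y0 :=
    continuous_pi fun c => (contDiff_y0 c).continuous
  have cker : Continuous fun j : Jet => j.ker :=
    continuous_pi fun c => (contDiff_ker c).continuous
  have ctr := contDiff_tr.continuous
  have cdet := contDiff_det.continuous
  have hclosed : IsClosed ({j : Jet | j.y0 = 0 ∧ j.ker = 0} ∪
      {j | j.y0 = 0 ∧ j.tr = 0 ∧ j.det = 0} ∪ {j | j.y0 = 0 ∧ j.det = 0 ∧ j.detAlong = 0} ∪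
      {j | j.y0 = 0 ∧ j.tr = 0 ∧ j.trAlong = 0}) := by
    refine ((IsClosed.union ?_ ?_).union ?_).union ?_
    · exact (isClosed_eq cy0 continuous_const).inter (isClosed_eq cker continuous_const)
    · exact (isClosed_eq cy0 continuous_const).inter
        ((isClosed_eq ctr continuous_const).inter (isClosed_eq cdet continuous_const))
    · exact (isClosed_eq cy0 continuous_const).inter ((isClosed_eq cdet continuous_const).inter
        (isClosed_eq contDiff_detAlong.continuous continuous_const))
    · exact (isClosed_eq cy0 continuous_const).inter ((isClosed_eq ctr continuous_const).inter
        (isClosed_eq contDiff_trAlong.continuous continuous_const))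
  rw [isOpen_iff_mem_nhds]
  intro j hj
  have h1 := hclosed.isOpen_compl.mem_nhds (x := j) (by
    simp only [mem_compl_iff, mem_union, mem_ofPred_eq]
    simp only [Bad, mem_ofPred_eq] at hj
    tauto)
  -- near a jet that is not bad the Lyapunov coefficient is continuous wherever it matters
  have h2 : ∀ᶠ j' in 𝓝 j, ¬ (j'.y0 = 0 ∧ j'.tr = 0 ∧ 0 < j'.det ∧ j'.lyapunov = 0) := by
    by_cases hy : j.y0 = 0
    · by_cases ht : j.tr = 0
      · rcases lt_trichotomy j.det 0 with hd | hd | hd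
        · filter_upwards [cdet.continuousAt.eventually (gt_mem_nhds hd)] with j' h h'
          linarith [h'.2.2.1]
        · exact absurd ⟨hy, Or.inr (Or.inl ⟨ht, hd⟩)⟩ hj
        · have hl : j.lyapunov ≠ 0 := fun h =>
            hj ⟨hy, Or.inr (Or.inr (Or.inr (Or.inr ⟨ht, hd, h⟩)))⟩
          filter_upwards [(contDiffAt_lyapunov hd (mat_one_zero_ne_zero ht hd)).continuousAt.eventually
            (isOpen_ne.mem_nhds hl)] with j' h h'
          exact h h'.2.2.2
      · filter_upwards [ctr.continuousAt.eventually (isOpen_ne.mem_nhds ht)] with j' h h'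
        exact h h'.2.1
    · filter_upwards [cy0.continuousAt.eventually (isOpen_ne.mem_nhds hy)] with j' h h'
      exact h h'.1
  filter_upwards [h1, h2] with j' h3 h4 h5
  simp only [mem_compl_iff, mem_union, mem_ofPred_eq] at h3
  simp only [Bad] at h5
  tauto

/-! ### The degeneracies have codimension four -/

/-- The jets, at a given point, of the polynomials used as perturbations: a constant, a coordinate
function, a product of two linear forms, and the cube of a linear form, vanishing at the point and
placed in the component `c`. -/
inductive IsModel : Jet → Prop
  | cst (c : Fin 2) : IsModel (0, 0, Pi.single c 1, 0, 0, 0)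
  | lin (c : Fin 2) (i : Fin 3) : IsModel (0, 0, 0, Pi.single c (Pi.single i 1), 0, 0)
  | quad (c : Fin 2) (u v : Fin 3 → ℝ) :
      IsModel (0, 0, 0, 0, Pi.single c fun i k => u i * v k + u k * v i, 0)
  | cub (c : Fin 2) (u : Fin 3 → ℝ) :
      IsModel (0, 0, 0, 0, 0, Pi.single c fun i k l => 6 * (u i * u k * u l))

/-- A set of jets contained in the zero set of four equations `h 0, …, h 3` which are regular in the
triangular sense along four model directions: moving in the direction `δ i` changes `h i` at the
nonzero rate `m i` and leaves `h k` unchanged for `k < i`. -/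
def IsThin (S : Set Jet) : Prop :=
  ∃ h : Fin 4 → Jet → ℝ, ∀ j ∈ S, (∀ k, h k j = 0) ∧ (∀ k, ContDiffAt ℝ 1 (h k) j) ∧
    ∃ (δ : Fin 4 → Jet) (m : Fin 4 → ℝ), (∀ i, IsModel (δ i)) ∧ (∀ i, m i ≠ 0) ∧
      (∀ i k, k < i → ∀ t : ℝ, h k (j + t • δ i) = h k j) ∧
      ∀ i, ∀ t : ℝ, h i (j + t • δ i) = h i j + t * m i

end Jet

namespace Jet

section AddSmul

variable (j δ : Jet) (t : ℝ)

theorem slope_add_smul (d) : (j + t • δ).slope d = j.slope d + t * δ.slope d := rfl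
theorem dslope_add_smul (d i) : (j + t • δ).dslope d i = j.dslope d i + t * δ.dslope d i := rfl
theorem y0_add_smul (c) : (j + t • δ).y0 c = j.y0 c + t * δ.y0 c := rfl
theorem y1_add_smul (c i) : (j + t • δ).y1 c i = j.y1 c i + t * δ.y1 c i := rfl
theorem y2_add_smul (c i k) : (j + t • δ).y2 c i k = j.y2 c i k + t * δ.y2 c i k := rfl
theorem y3_add_smul (c i k l) : (j + t • δ).y3 c i k l = j.y3 c i k l + t * δ.y3 c i k l := rfl

end AddSmul

/-- The jet of a constant. -/
abbrev cst (c : Fin 2) : Jet := (0, 0, Pi.single c 1, 0, 0, 0)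
/-- The jet of a coordinate function. -/
abbrev lin (c : Fin 2) (i : Fin 3) : Jet := (0, 0, 0, Pi.single c (Pi.single i 1), 0, 0)
/-- The jet of a product of two linear forms. -/
abbrev prodForm (c : Fin 2) (u v : Fin 3 → ℝ) : Jet :=
  (0, 0, 0, 0, Pi.single c fun i k => u i * v k + u k * v i, 0)
/-- The jet of the cube of a linear form. -/
abbrev cube (c : Fin 2) (u : Fin 3 → ℝ) : Jet :=
  (0, 0, 0, 0, 0, Pi.single c fun i k l => 6 * (u i * u k * u l))

/-- Thinness, with the directions and the rates given as functions of the jet. -/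
theorem IsThin.of_equations {S : Set Jet} (h : Fin 4 → Jet → ℝ) (δ : Jet → Fin 4 → Jet)
    (m : Jet → Fin 4 → ℝ) (h0 : ∀ j ∈ S, ∀ k, h k j = 0)
    (hC : ∀ j ∈ S, ∀ k, ContDiffAt ℝ 1 (h k) j) (hδ : ∀ j i, IsModel (δ j i))
    (hm : ∀ j ∈ S, ∀ i, m j i ≠ 0)
    (hlow : ∀ j ∈ S, ∀ i k, k < i → ∀ t : ℝ, h k (j + t • δ j i) = h k j)
    (hdiag : ∀ j ∈ S, ∀ i, ∀ t : ℝ, h i (j + t • δ j i) = h i j + t * m j i) : IsThin S :=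
  ⟨h, fun j hj => ⟨h0 j hj, hC j hj, δ j, m j, hδ j, hm j hj, hlow j hj, hdiag j hj⟩⟩

theorem smooth_one {f : Jet → ℝ} (hf : ContDiff ℝ ∞ f) (j : Jet) : ContDiffAt ℝ 1 f j :=
  hf.contDiffAt.of_le (by simp)

theorem forall_fin_four {P : Fin 4 → Prop} (h0 : P 0) (h1 : P 1) (h2 : P 2) (h3 : P 3) :
    ∀ i, P i := by
  intro i; fin_cases i <;> assumption

theorem forall_lt_fin_four {P : Fin 4 → Fin 4 → Prop} (h10 : P 1 0) (h20 : P 2 0) (h21 : P 2 1)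
    (h30 : P 3 0) (h31 : P 3 1) (h32 : P 3 2) : ∀ i k, k < i → P i k := by
  intro i k hk
  fin_cases i <;> fin_cases k <;> first | assumption | exact absurd hk (by decide)

/-- A zero at which the gradient of the first component vanishes. If that gradient does not vanish,
two of the three components of the cross product of the gradients are independent equations; which
two depends on the nonzero partial derivative. -/
theorem isThin_critical₁ : IsThin {j | j.y0 0 = 0 ∧ j.y1 0 0 = 0 ∧ j.y1 0 1 = 0 ∧ j.y1 0 2 = 0} := by
  refine IsThin.of_equations
    ![fun j => j.y0 0, fun j => j.y1 0 0, fun j => j.y1 0 1, fun j => j.y1 0 2]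
    (fun _ => ![cst 0, lin 0 0, lin 0 1, lin 0 2]) (fun _ => ![1, 1, 1, 1]) ?_ ?_ ?_ ?_ ?_ ?_
  · rintro j ⟨h0, h1, h2, h3⟩
    exact forall_fin_four h0 h1 h2 h3
  · intro j _
    exact forall_fin_four (smooth_one (contDiff_y0 0) j) (smooth_one (contDiff_y1 0 0) j)
      (smooth_one (contDiff_y1 0 1) j) (smooth_one (contDiff_y1 0 2) j)
  · intro j
    exact forall_fin_four (.cst 0) (.lin 0 0) (.lin 0 1) (.lin 0 2)
  · intro j _
    refine forall_fin_four ?_ ?_ ?_ ?_ <;> simp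
  · intro j _
    refine forall_lt_fin_four ?_ ?_ ?_ ?_ ?_ ?_ <;> intro t <;>
      simp [y0, y1]
  · intro j _
    refine forall_fin_four ?_ ?_ ?_ ?_ <;> intro t <;>
      simp [y0, y1]

/-- The common form of the remaining degeneracies: both components vanish and two further equations,
which do not involve the values of the components, hold. -/
theorem IsThin.of_two {S : Set Jet} (f g : Jet → ℝ) (δ ε : Jet → Jet) (a b : Jet → ℝ)
    (hy : ∀ j ∈ S, j.y0 = 0) (hf : ∀ j ∈ S, f j = 0) (hg : ∀ j ∈ S, g j = 0)
    (hfC : ∀ j ∈ S, ContDiffAt ℝ 1 f j) (hgC : ∀ j ∈ S, ContDiffAt ℝ 1 g j)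
    (hδ : ∀ j, IsModel (δ j)) (hε : ∀ j, IsModel (ε j))
    (hδ0 : ∀ j, (δ j).y0 = 0) (hε0 : ∀ j, (ε j).y0 = 0)
    (ha : ∀ j ∈ S, a j ≠ 0) (hb : ∀ j ∈ S, b j ≠ 0)
    (hfδ : ∀ j ∈ S, ∀ t : ℝ, f (j + t • δ j) = f j + t * a j)
    (hfε : ∀ j ∈ S, ∀ t : ℝ, f (j + t • ε j) = f j)
    (hgε : ∀ j ∈ S, ∀ t : ℝ, g (j + t • ε j) = g j + t * b j) : IsThin S := by
  refine IsThin.of_equations ![fun j => j.y0 0, fun j => j.y0 1, f, g]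
    (fun j => ![cst 0, cst 1, δ j, ε j]) (fun j => ![1, 1, a j, b j]) ?_ ?_ ?_ ?_ ?_ ?_
  · intro j hj
    exact forall_fin_four (congrFun (hy j hj) 0) (congrFun (hy j hj) 1) (hf j hj) (hg j hj)
  · intro j hj
    exact forall_fin_four (smooth_one (contDiff_y0 0) j) (smooth_one (contDiff_y0 1) j)
      (hfC j hj) (hgC j hj)
  · intro j
    exact forall_fin_four (.cst 0) (.cst 1) (hδ j) (hε j)
  · intro j hj
    exact forall_fin_four one_ne_zero one_ne_zero (ha j hj) (hb j hj)
  · intro j hj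
    refine forall_lt_fin_four ?_ ?_ ?_ ?_ ?_ ?_ <;> intro t
    · simp [y0]
    · simp [y0_add_smul, hδ0]
    · simp [y0_add_smul, hδ0]
    · simp [y0_add_smul, hε0]
    · simp [y0_add_smul, hε0]
    · exact hfε j hj t
  · intro j hj
    refine forall_fin_four ?_ ?_ ?_ ?_ <;> intro t
    · simp [y0]
    · simp [y0]
    · exact hfδ j hj t
    · exact hgε j hj t

theorem ker_zero (j : Jet) : j.ker 0 = j.y1 0 1 * j.y1 1 2 - j.y1 0 2 * j.y1 1 1 := rfl
theorem ker_one (j : Jet) : j.ker 1 = j.y1 0 2 * j.y1 1 0 - j.y1 0 0 * j.y1 1 2 := rfl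
theorem ker_two (j : Jet) : j.ker 2 = j.y1 0 0 * j.y1 1 1 - j.y1 0 1 * j.y1 1 0 := rfl

theorem isThin_critical₂ : IsThin {j | j.y0 = 0 ∧ j.ker = 0 ∧ j.y1 0 0 ≠ 0} := by
  refine IsThin.of_two (fun j => j.ker 1) (fun j => j.ker 2) (fun _ => lin 1 2) (fun _ => lin 1 1)
    (fun j => -j.y1 0 0) (fun j => j.y1 0 0) (fun j h => h.1) (fun j h => congrFun h.2.1 1)
    (fun j h => congrFun h.2.1 2) (fun j _ => smooth_one (by fun_prop) j)
    (fun j _ => smooth_one (by fun_prop) j) (fun _ => .lin _ _) (fun _ => .lin _ _)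
    (fun _ => rfl) (fun _ => rfl) (fun j h => neg_ne_zero.2 h.2.2) (fun j h => h.2.2) ?_ ?_ ?_ <;>
  · intro j _ t
    simp only [ker_one, ker_two, y1_add_smul]
    simp [y1]
    try ring

theorem isThin_critical₃ : IsThin {j | j.y0 = 0 ∧ j.ker = 0 ∧ j.y1 0 1 ≠ 0} := by
  refine IsThin.of_two (fun j => j.ker 0) (fun j => j.ker 2) (fun _ => lin 1 2) (fun _ => lin 1 0)
    (fun j => j.y1 0 1) (fun j => -j.y1 0 1) (fun j h => h.1) (fun j h => congrFun h.2.1 0)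
    (fun j h => congrFun h.2.1 2) (fun j _ => smooth_one (by fun_prop) j)
    (fun j _ => smooth_one (by fun_prop) j) (fun _ => .lin _ _) (fun _ => .lin _ _)
    (fun _ => rfl) (fun _ => rfl) (fun j h => h.2.2) (fun j h => neg_ne_zero.2 h.2.2) ?_ ?_ ?_ <;>
  · intro j _ t
    simp only [ker_zero, ker_two, y1_add_smul]
    simp [y1]
    try ring

theorem isThin_critical₄ : IsThin {j | j.y0 = 0 ∧ j.ker = 0 ∧ j.y1 0 2 ≠ 0} := by
  refine IsThin.of_two (fun j => j.ker 0) (fun j => j.ker 1) (fun _ => lin 1 1) (fun _ => lin 1 0)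
    (fun j => -j.y1 0 2) (fun j => j.y1 0 2) (fun j h => h.1) (fun j h => congrFun h.2.1 0)
    (fun j h => congrFun h.2.1 1) (fun j _ => smooth_one (by fun_prop) j)
    (fun j _ => smooth_one (by fun_prop) j) (fun _ => .lin _ _) (fun _ => .lin _ _)
    (fun _ => rfl) (fun _ => rfl) (fun j h => neg_ne_zero.2 h.2.2) (fun j h => h.2.2) ?_ ?_ ?_ <;>
  · intro j _ t
    simp only [ker_zero, ker_one, y1_add_smul]
    simp [y1]
    try ring

/-- The zero matrix is the singular point of the nilpotent cone and of the set of singular matrices;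
it is treated through its two entries off the diagonal. -/
theorem isThin_diagonal : IsThin {j | j.y0 = 0 ∧ j.mat 0 1 = 0 ∧ j.mat 1 0 = 0} := by
  refine IsThin.of_two (fun j => j.mat 0 1) (fun j => j.mat 1 0) (fun _ => lin 0 1)
    (fun _ => lin 1 0) (fun j => 1) (fun j => 1) (fun j h => h.1) (fun j h => h.2.1)
    (fun j h => h.2.2) (fun j _ => smooth_one (by fun_prop) j)
    (fun j _ => smooth_one (by fun_prop) j) (fun _ => .lin _ _) (fun _ => .lin _ _)
    (fun _ => rfl) (fun _ => rfl) (fun j h => one_ne_zero) (fun j h => one_ne_zero) ?_ ?_ ?_ <;>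
  · intro j _ t
    simp only [mat, y1_add_smul, slope_add_smul]
    simp [y1, slope]
    try ring

/-- Trace and determinant are independent equations at the nilpotent matrices other than zero. -/
theorem isThin_nilpotent₁ : IsThin {j | j.y0 = 0 ∧ j.tr = 0 ∧ j.det = 0 ∧ j.mat 0 1 ≠ 0} := by
  refine IsThin.of_two tr det (fun _ => lin 0 0)
    (fun _ => lin 1 0) (fun j => 1) (fun j => -j.mat 0 1) (fun j h => h.1) (fun j h => h.2.1)
    (fun j h => h.2.2.1) (fun j _ => smooth_one (by fun_prop) j)
    (fun j _ => smooth_one (by fun_prop) j) (fun _ => .lin _ _) (fun _ => .lin _ _)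
    (fun _ => rfl) (fun _ => rfl) (fun j h => one_ne_zero) (fun j h => neg_ne_zero.2 h.2.2.2)
    ?_ ?_ ?_ <;>
  · intro j _ t
    simp only [tr, det, mat, y1_add_smul, slope_add_smul]
    simp [y1, slope]
    try ring

theorem isThin_nilpotent₂ : IsThin {j | j.y0 = 0 ∧ j.tr = 0 ∧ j.det = 0 ∧ j.mat 1 0 ≠ 0} := by
  refine IsThin.of_two tr det (fun _ => lin 0 0)
    (fun _ => lin 0 1) (fun j => 1) (fun j => -j.mat 1 0) (fun j h => h.1) (fun j h => h.2.1)
    (fun j h => h.2.2.1) (fun j _ => smooth_one (by fun_prop) j)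
    (fun j _ => smooth_one (by fun_prop) j) (fun _ => .lin _ _) (fun _ => .lin _ _)
    (fun _ => rfl) (fun _ => rfl) (fun j h => one_ne_zero) (fun j h => neg_ne_zero.2 h.2.2.2)
    ?_ ?_ ?_ <;>
  · intro j _ t
    simp only [tr, det, mat, y1_add_smul, slope_add_smul]
    simp [y1, slope]
    try ring

/-- The polarization of `⟨k, x⟩ ⟨w, x⟩` at `(k, w)`. -/
def polar (k w : Fin 3 → ℝ) : ℝ :=
  (k 0 ^ 2 + k 1 ^ 2 + k 2 ^ 2) * (w 0 ^ 2 + w 1 ^ 2 + w 2 ^ 2) +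
    (k 0 * w 0 + k 1 * w 1 + k 2 * w 2) ^ 2

theorem sum_sq_pos {k : Fin 3 → ℝ} (hk : k ≠ 0) : 0 < k 0 ^ 2 + k 1 ^ 2 + k 2 ^ 2 := by
  by_contra! h
  apply hk
  ext i
  fin_cases i <;> simp only [Fin.zero_eta, Fin.mk_one, Fin.reduceFinMk, Pi.zero_apply] <;>
    nlinarith [sq_nonneg (k 0), sq_nonneg (k 1), sq_nonneg (k 2)]

theorem polar_ne_zero {k w : Fin 3 → ℝ} (hk : k ≠ 0) (hw : w ≠ 0) : polar k w ≠ 0 := by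
  have := mul_pos (sum_sq_pos hk) (sum_sq_pos hw)
  unfold polar
  positivity

/-- The covector of the second derivatives of the first component on which the derivative of the
determinant depends. -/
def cof₁ (j : Jet) : Fin 3 → ℝ :=
  ![j.mat 1 1, -j.mat 1 0, j.mat 1 1 * j.slope 0 - j.mat 1 0 * j.slope 1]

/-- The covector of the second derivatives of the second component on which the derivative of the
determinant depends. -/
def cof₂ (j : Jet) : Fin 3 → ℝ :=
  ![-j.mat 0 1, j.mat 0 0, j.mat 0 0 * j.slope 1 - j.mat 0 1 * j.slope 0]

/-- The derivative of the determinant along the zero set depends on the second derivatives of the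
second component through their contraction with `ker` and the covector `cof₂`; the product of these
two forms, added to that component, changes it. The other component serves where `mat 1 1` does not
vanish. -/
theorem isThin_detAlong₁ :
    IsThin {j | j.y0 = 0 ∧ j.det = 0 ∧ j.detAlong = 0 ∧ j.ker ≠ 0 ∧ j.mat 0 0 ≠ 0} := by
  refine IsThin.of_two det detAlong (fun _ => lin 1 1)
    (fun j => prodForm 1 j.ker j.cof₂) (fun j => j.mat 0 0) (fun j => polar j.ker j.cof₂)
    (fun j h => h.1) (fun j h => h.2.1)
    (fun j h => h.2.2.1) (fun j _ => smooth_one (by fun_prop) j)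
    (fun j _ => smooth_one (by fun_prop) j) (fun _ => .lin _ _) (fun _ => .quad _ _ _)
    (fun _ => rfl) (fun _ => rfl) (fun j h => h.2.2.2.2) (fun j h => polar_ne_zero h.2.2.2.1
      fun h0 => h.2.2.2.2 (by simpa [cof₂] using congrFun h0 1)) ?_ ?_ ?_
  · intro j _ t
    simp only [det, mat, y1_add_smul, slope_add_smul]
    simp [y1, slope]
    try ring
  · intro j _ t
    simp only [det, mat, y1_add_smul, slope_add_smul]
    simp [y1, slope]
  · intro j _ t
    have hk : (j + t • prodForm 1 j.ker j.cof₂).ker = j.ker := by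
      simp only [ker, y1_add_smul]; simp [y1]
    have hm : ∀ c d, (j + t • prodForm 1 j.ker j.cof₂).mat c d = j.mat c d := by
      intro c d; simp only [mat, y1_add_smul, slope_add_smul]; simp [y1, slope]
    simp only [detAlong, hk, ddet, hm, dmat, y2_add_smul, y1_add_smul, slope_add_smul,
      dslope_add_smul, polar]
    simp only [y2, y1, slope, dslope, cof₂]
    simp
    ring

theorem isThin_detAlong₂ :
    IsThin {j | j.y0 = 0 ∧ j.det = 0 ∧ j.detAlong = 0 ∧ j.ker ≠ 0 ∧ j.mat 1 1 ≠ 0} := by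
  refine IsThin.of_two det detAlong (fun _ => lin 0 0)
    (fun j => prodForm 0 j.ker j.cof₁) (fun j => j.mat 1 1) (fun j => polar j.ker j.cof₁)
    (fun j h => h.1) (fun j h => h.2.1)
    (fun j h => h.2.2.1) (fun j _ => smooth_one (by fun_prop) j)
    (fun j _ => smooth_one (by fun_prop) j) (fun _ => .lin _ _) (fun _ => .quad _ _ _)
    (fun _ => rfl) (fun _ => rfl) (fun j h => h.2.2.2.2) (fun j h => polar_ne_zero h.2.2.2.1
      fun h0 => h.2.2.2.2 (by simpa [cof₁] using congrFun h0 0)) ?_ ?_ ?_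
  · intro j _ t
    simp only [det, mat, y1_add_smul, slope_add_smul]
    simp [y1, slope]
    try ring
  · intro j _ t
    simp only [det, mat, y1_add_smul, slope_add_smul]
    simp [y1, slope]
  · intro j _ t
    have hk : (j + t • prodForm 0 j.ker j.cof₁).ker = j.ker := by
      simp only [ker, y1_add_smul]; simp [y1]
    have hm : ∀ c d, (j + t • prodForm 0 j.ker j.cof₁).mat c d = j.mat c d := by
      intro c d; simp only [mat, y1_add_smul, slope_add_smul]; simp [y1, slope]
    simp only [detAlong, hk, ddet, hm, dmat, y2_add_smul, y1_add_smul, slope_add_smul,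
      dslope_add_smul, polar]
    simp only [y2, y1, slope, dslope, cof₁]
    simp
    ring

/-- As for the determinant, with the covector of the trace in place of `cof₂`; its coefficients are
those of `hopf₁`. -/
theorem isThin_trAlong : IsThin {j | j.y0 = 0 ∧ j.tr = 0 ∧ j.trAlong = 0 ∧ j.ker ≠ 0} := by
  refine IsThin.of_two tr trAlong (fun _ => lin 0 0)
    (fun j => prodForm 0 j.ker j.hopf₁) (fun j => 1) (fun j => polar j.ker j.hopf₁)
    (fun j h => h.1) (fun j h => h.2.1)
    (fun j h => h.2.2.1) (fun j _ => smooth_one (by fun_prop) j)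
    (fun j _ => smooth_one (by fun_prop) j) (fun _ => .lin _ _) (fun _ => .quad _ _ _)
    (fun _ => rfl) (fun _ => rfl) (fun j h => one_ne_zero) (fun j h => polar_ne_zero h.2.2.2
      fun h0 => by simpa [hopf₁] using congrFun h0 0) ?_ ?_ ?_
  · intro j _ t
    simp only [tr, mat, y1_add_smul, slope_add_smul]
    simp [y1, slope]
    try ring
  · intro j _ t
    simp only [tr, mat, y1_add_smul, slope_add_smul]
    simp [y1, slope]
  · intro j _ t
    have hk : (j + t • prodForm 0 j.ker j.hopf₁).ker = j.ker := by
      simp only [ker, y1_add_smul]; simp [y1]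
    simp only [trAlong, hk, dtr, dmat, y2_add_smul, y1_add_smul, slope_add_smul,
      dslope_add_smul, polar]
    simp only [y2, y1, slope, dslope, hopf₁]
    simp
    ring

/-- A linear form dual to the first vector of the basis `hopf₁, hopf₂`. -/
def hopfForm (j : Jet) : Fin 3 → ℝ := ![1, -(j.mat 0 0 / j.mat 1 0), 0]

/-- Adding the cube of the form dual to the first vector of the basis to the first component changes
a single third derivative in the Lyapunov coefficient, with the factor `6 / 16`. -/
theorem isThin_lyapunov : IsThin {j | j.y0 = 0 ∧ j.tr = 0 ∧ 0 < j.det ∧ j.lyapunov = 0} := by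
  refine IsThin.of_two tr lyapunov (fun _ => lin 0 0)
    (fun j => cube 0 j.hopfForm) (fun j => 1) (fun j => 3 / 8)
    (fun j h => h.1) (fun j h => h.2.1)
    (fun j h => h.2.2.2) (fun j _ => smooth_one (by fun_prop) j)
    (fun j h => contDiffAt_lyapunov h.2.2.1 (mat_one_zero_ne_zero h.2.1 h.2.2.1))
    (fun _ => .lin _ _) (fun _ => .cub _ _)
    (fun _ => rfl) (fun _ => rfl) (fun j h => one_ne_zero) (fun j h => by norm_num) ?_ ?_ ?_
  · intro j _ t
    simp only [tr, mat, y1_add_smul, slope_add_smul]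
    simp [y1, slope]
    try ring
  · intro j _ t
    simp only [tr, mat, y1_add_smul, slope_add_smul]
    simp [y1, slope]
  · intro j hj t
    have hw0 : j.freq ≠ 0 := (Real.sqrt_pos.2 hj.2.2.1).ne'
    have hm0 := mat_one_zero_ne_zero hj.2.1 hj.2.2.1
    set δ := cube 0 j.hopfForm with hδ
    have hsl : ∀ d, (j + t • δ).slope d = j.slope d := by
      intro d; rw [slope_add_smul]; simp [δ, slope]
    have hm : ∀ c d, (j + t • δ).mat c d = j.mat c d := by
      intro c d; simp only [mat, y1_add_smul, slope_add_smul]; simp [δ, y1, slope]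
    have hf : (j + t • δ).freq = j.freq := by simp only [freq, det, hm]
    have h1 : (j + t • δ).hopf₁ = j.hopf₁ := by simp only [hopf₁, hsl]
    have h2 : (j + t • δ).hopf₂ = j.hopf₂ := by simp only [hopf₂, hsl, hm, hf]
    have hq : ∀ u v, (j + t • δ).quad u v = j.quad u v := by
      intro u v; ext c; simp only [quad, y2_add_smul]; simp [δ, y2]
    have hc1 : ∀ v, (j + t • δ).coord₁ v = j.coord₁ v := by intro v; simp only [coord₁, hm]
    have hc2 : ∀ v, (j + t • δ).coord₂ v = j.coord₂ v := by intro v; simp only [coord₂, hm, hf]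
    -- only the first component of the third derivative changes, by the cube of the form
    have hk : ∀ u v w, (j + t • δ).cubic u v w = j.cubic u v w +
        Pi.single 0 (t * (6 * ((∑ i, j.hopfForm i * u i) * (∑ i, j.hopfForm i * v i) *
          (∑ i, j.hopfForm i * w i)))) := by
      intro u v w
      ext c
      simp only [cubic, y3_add_smul, Pi.add_apply, Fin.sum_univ_three]
      fin_cases c
      · simp [δ, y3]; ring
      · simp [δ, y3]
    have hc1a : ∀ v x, j.coord₁ (v + Pi.single 0 x) = j.coord₁ v + x := by
      intro v x; simp [coord₁]; ring
    have hc2a : ∀ v x, j.coord₂ (v + Pi.single 0 x) = j.coord₂ v := by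
      intro v x; simp [coord₂]
    have hu1 : ∑ i, j.hopfForm i * j.hopf₁ i = 1 := by
      simp [Fin.sum_univ_three, hopfForm, hopf₁]
    have hu2 : ∑ i, j.hopfForm i * j.hopf₂ i = 0 := by
      simp [Fin.sum_univ_three, hopfForm, hopf₂]; field_simp; ring
    simp only [lyapunov, h1, h2, hq, hc1, hc2, hk, hf, hc1a, hc2a, hu1, hu2]
    ring

/-- Every bad jet lies in one of finitely many thin sets. -/
theorem exists_thin_cover :
    ∃ l : List {S : Set Jet // IsThin S}, ∀ j : Jet, j.Bad → ∃ S ∈ l, j ∈ S.1 := by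
  refine ⟨[⟨_, isThin_critical₁⟩, ⟨_, isThin_critical₂⟩, ⟨_, isThin_critical₃⟩,
    ⟨_, isThin_critical₄⟩, ⟨_, isThin_diagonal⟩, ⟨_, isThin_nilpotent₁⟩, ⟨_, isThin_nilpotent₂⟩,
    ⟨_, isThin_detAlong₁⟩, ⟨_, isThin_detAlong₂⟩, ⟨_, isThin_trAlong⟩, ⟨_, isThin_lyapunov⟩], ?_⟩
  rintro j ⟨hy, h⟩
  simp only [List.mem_cons, List.not_mem_nil, or_false, exists_eq_or_imp, exists_eq_left,
    mem_ofPred_eq, hy, Pi.zero_apply, true_and]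
  have hmat : j.mat 0 0 = 0 → j.mat 1 1 = 0 → j.tr = 0 := fun h0 h1 => by simp [tr, h0, h1]
  by_cases hk : j.ker = 0
  · simp only [hk]; grind
  · rcases h with h | h | h | h | h <;> by_cases ht : j.tr = 0 <;> grind

end Jet

/-! ### Partial derivatives and polynomial perturbations -/

/-- The `i`-th partial derivative. -/
def pd (i : Fin 3) (f : E3 → ℝ) : E3 → ℝ := fun x => fderiv ℝ f x (EuclideanSpace.single i 1)

theorem ContDiffAt.pd {f : E3 → ℝ} {x : E3} {m n : WithTop ℕ∞} (hf : ContDiffAt ℝ n f x)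
    (hmn : m + 1 ≤ n) (i : Fin 3) : ContDiffAt ℝ m (pd i f) x :=
  (hf.fderiv_right hmn).clm_apply contDiffAt_const

@[fun_prop]
theorem ContDiff.pd {f : E3 → ℝ} (hf : ContDiff ℝ ∞ f) (i : Fin 3) : ContDiff ℝ ∞ (pd i f) :=
  contDiff_iff_contDiffAt.2 fun _ => hf.contDiffAt.pd (by simp) i

theorem pd_congr {f g : E3 → ℝ} {x : E3} (h : f =ᶠ[𝓝 x] g) (i : Fin 3) :
    pd i f =ᶠ[𝓝 x] pd i g :=
  h.fderiv.fun_comp fun L => L (EuclideanSpace.single i 1)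

theorem pd_add {f g : E3 → ℝ} {x : E3} (hf : ContDiffAt ℝ 1 f x) (hg : ContDiffAt ℝ 1 g x)
    (i : Fin 3) : pd i (fun y => f y + g y) =ᶠ[𝓝 x] fun y => pd i f y + pd i g y := by
  filter_upwards [hf.eventually (by simp), hg.eventually (by simp)] with y h1 h2
  simp only [pd]
  rw [fderiv_fun_add (h1.differentiableAt (by simp)) (h2.differentiableAt (by simp))]
  rfl

theorem pd_const_mul {f : E3 → ℝ} (hf : ContDiff ℝ ∞ f) (c : ℝ) (i : Fin 3) :
    pd i (fun y => c * f y) = fun y => c * pd i f y := by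
  ext y
  simp only [pd]
  rw [fderiv_const_mul ((hf.differentiable (by simp)) y)]
  rfl

theorem pd_sum {ι : Type*} (s : Finset ι) {f : ι → E3 → ℝ} (hf : ∀ k, ContDiff ℝ ∞ (f k))
    (i : Fin 3) : pd i (fun y => ∑ k ∈ s, f k y) = fun y => ∑ k ∈ s, pd i (f k) y := by
  ext y
  simp only [pd]
  rw [fderiv_fun_sum fun k _ => ((hf k).differentiable (by simp)) y]
  simp

theorem pd_mul {f g : E3 → ℝ} (hf : ContDiff ℝ ∞ f) (hg : ContDiff ℝ ∞ g) (i : Fin 3) :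
    pd i (fun y => f y * g y) = fun y => pd i f y * g y + f y * pd i g y := by
  ext y
  simp only [pd]
  rw [fderiv_fun_mul ((hf.differentiable (by simp)) y) ((hg.differentiable (by simp)) y)]
  simp
  ring

theorem pd_add_of_smooth {f g : E3 → ℝ} (hf : ContDiff ℝ ∞ f) (hg : ContDiff ℝ ∞ g) (i : Fin 3) :
    pd i (fun y => f y + g y) = fun y => pd i f y + pd i g y := by
  ext y
  exact (pd_add (hf.contDiffAt.of_le (by simp)) (hg.contDiffAt.of_le (by simp)) i).self_of_nhds

/-- The jet of a pair of functions `F`, together with that of the slopes `A`. -/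
def jetAt (A : E3 → Fin 2 → ℝ) (F : Fin 2 → E3 → ℝ) (x : E3) : Jet :=
  (A x, fun d i => pd i (fun y => A y d) x, fun c => F c x, fun c i => pd i (F c) x,
    fun c i k => pd i (pd k (F c)) x, fun c i k l => pd i (pd k (pd l (F c))) x)

/-- The jets involve three derivatives, hence are of class `C^1` for functions of class `C^4`. -/
theorem contDiffAt_jetAt {A : E3 → Fin 2 → ℝ} {F : Fin 2 → E3 → ℝ} {x : E3}
    (hA : ContDiffAt ℝ 2 A x) (hF : ∀ c, ContDiffAt ℝ 4 (F c) x) :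
    ContDiffAt ℝ 1 (jetAt A F) x := by
  have hA' : ∀ d, ContDiffAt ℝ 2 (fun y => A y d) x := fun d => contDiffAt_pi.1 hA d
  have h3 : ∀ c l, ContDiffAt ℝ 3 (pd l (F c)) x := fun c l => (hF c).pd (by norm_num) l
  have h2 : ∀ c k l, ContDiffAt ℝ 2 (pd k (pd l (F c))) x := fun c k l =>
    (h3 c l).pd (by norm_num) k
  refine (hA.of_le one_le_two).prodMk (ContDiffAt.prodMk ?_ (ContDiffAt.prodMk ?_
    (ContDiffAt.prodMk ?_ (ContDiffAt.prodMk ?_ ?_))))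
  · exact contDiffAt_pi.2 fun d => contDiffAt_pi.2 fun i => (hA' d).pd (by norm_num) i
  · exact contDiffAt_pi.2 fun c => (hF c).of_le (by norm_num)
  · exact contDiffAt_pi.2 fun c => contDiffAt_pi.2 fun i => (h3 c i).of_le (by norm_num)
  · exact contDiffAt_pi.2 fun c => contDiffAt_pi.2 fun i => contDiffAt_pi.2 fun k =>
      (h2 c i k).of_le (by norm_num)
  · exact contDiffAt_pi.2 fun c => contDiffAt_pi.2 fun i => contDiffAt_pi.2 fun k =>
      contDiffAt_pi.2 fun l => (h2 c k l).pd (by norm_num) i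

theorem jetAt_congr {A : E3 → Fin 2 → ℝ} {F G : Fin 2 → E3 → ℝ} {x : E3}
    (h : ∀ c, F c =ᶠ[𝓝 x] G c) : jetAt A F x = jetAt A G x := by
  simp only [jetAt]
  have h1 := fun c => (h c).self_of_nhds
  have h2 := fun c i => (pd_congr (h c) i).self_of_nhds
  have h3 := fun c i k => (pd_congr (pd_congr (h c) k) i).self_of_nhds
  have h4 := fun c i k l => (pd_congr (pd_congr (pd_congr (h c) l) k) i).self_of_nhds
  simp only [h1, h2, h3, h4]

theorem jetAt_add {A : E3 → Fin 2 → ℝ} {F G : Fin 2 → E3 → ℝ} {x : E3}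
    (hF : ∀ c, ContDiffAt ℝ 3 (F c) x) (hG : ∀ c, ContDiffAt ℝ 3 (G c) x) :
    jetAt A (fun c y => F c y + G c y) x = jetAt A F x + jetAt 0 G x := by
  have p1 : ∀ c l, pd l (fun y => F c y + G c y) =ᶠ[𝓝 x] fun y => pd l (F c) y + pd l (G c) y :=
    fun c l => pd_add ((hF c).of_le (by norm_num)) ((hG c).of_le (by norm_num)) l
  have p2 : ∀ c k l, pd k (pd l (fun y => F c y + G c y)) =ᶠ[𝓝 x]
      fun y => pd k (pd l (F c)) y + pd k (pd l (G c)) y := fun c k l =>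
    (pd_congr (p1 c l) k).trans (pd_add ((hF c).pd (by norm_num) l) ((hG c).pd (by norm_num) l) k)
  have p3 : ∀ c i k l, pd i (pd k (pd l (fun y => F c y + G c y))) =ᶠ[𝓝 x]
      fun y => pd i (pd k (pd l (F c))) y + pd i (pd k (pd l (G c))) y := fun c i k l =>
    (pd_congr (p2 c k l) i).trans (pd_add
      (((hF c).pd (m := 2) (by norm_num) l).pd (by norm_num) k)
      (((hG c).pd (m := 2) (by norm_num) l).pd (by norm_num) k) i)
  have q1 := fun c l => (p1 c l).self_of_nhds
  have q2 := fun c k l => (p2 c k l).self_of_nhds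
  have q3 := fun c i k l => (p3 c i k l).self_of_nhds
  have z : ∀ i, pd i (fun _ : E3 => (0 : ℝ)) x = 0 := fun i => by simp [pd]
  simp only [jetAt, q1, q2, q3, Prod.mk_add_mk, Pi.zero_apply, add_zero, z]
  refine Prod.ext ?_ (Prod.ext ?_ rfl)
  · simp
  · ext d i; simp

/-- The coordinates of a point completed by the constant `1`, so that affine functions are linear
combinations of these. -/
def affCoord (x : E3) : Fin 4 → ℝ := ![x 0, x 1, x 2, 1]

/-- The affine function with the given coefficients. -/
def aff (U : Fin 4 → ℝ) (x : E3) : ℝ := U 0 * x 0 + U 1 * x 1 + U 2 * x 2 + U 3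

/-- The parameter space of the polynomial perturbations. -/
abbrev Params : Type := Fin 2 → Fin 4 → Fin 4 → Fin 4 → ℝ

/-- A pair of polynomials of degree at most three, with (redundant) coefficients `a`. -/
def poly (a : Params) (c : Fin 2) (x : E3) : ℝ :=
  ∑ i, ∑ k, ∑ l, a c i k l * (affCoord x i * affCoord x k * affCoord x l)

@[fun_prop]
theorem contDiff_affCoord (i : Fin 4) : ContDiff ℝ ∞ fun x : E3 => affCoord x i := by
  fin_cases i
  · change ContDiff ℝ ∞ fun x : E3 => x 0; fun_prop
  · change ContDiff ℝ ∞ fun x : E3 => x 1; fun_prop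
  · change ContDiff ℝ ∞ fun x : E3 => x 2; fun_prop
  · change ContDiff ℝ ∞ fun x : E3 => (1 : ℝ); fun_prop

@[fun_prop]
theorem contDiff_aff (U : Fin 4 → ℝ) : ContDiff ℝ ∞ (aff U) := by unfold aff; fun_prop

theorem contDiff_poly (a : Params) (c : Fin 2) : ContDiff ℝ ∞ (poly a c) := by
  unfold poly; fun_prop

theorem aff_eq_sum (U : Fin 4 → ℝ) (x : E3) : aff U x = ∑ i, U i * affCoord x i := by
  simp [aff, affCoord, Fin.sum_univ_four]

theorem pd_aff (U : Fin 4 → ℝ) (i : Fin 3) : pd i (aff U) = fun _ => U i.castSucc := by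
  ext x
  have h : HasFDerivAt (aff U) (U 0 • (EuclideanSpace.proj 0 : E3 →L[ℝ] ℝ) +
      U 1 • (EuclideanSpace.proj 1 : E3 →L[ℝ] ℝ) +
      U 2 • (EuclideanSpace.proj 2 : E3 →L[ℝ] ℝ)) x := by
    have hp : ∀ i, HasFDerivAt (fun x : E3 => x i)
        (EuclideanSpace.proj i : E3 →L[ℝ] ℝ) x := fun i =>
      (EuclideanSpace.proj i : E3 →L[ℝ] ℝ).hasFDerivAt
    exact ((((hp 0).const_mul (U 0)).add ((hp 1).const_mul (U 1))).add
      ((hp 2).const_mul (U 2))).add_const _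
  rw [pd, h.fderiv]
  fin_cases i <;> simp

/-- The coefficients which give a product of three affine functions in one component and zero in the
other. -/
theorem poly_single (c : Fin 2) (U V W : Fin 4 → ℝ) :
    poly (Pi.single c fun i k l => U i * V k * W l) =
      Pi.single c fun x => aff U x * aff V x * aff W x := by
  ext c' x
  by_cases h : c' = c
  · subst h
    simp only [poly, Pi.single_eq_same, aff_eq_sum]
    rw [Finset.sum_mul_sum, Finset.sum_mul]
    refine Finset.sum_congr rfl fun i _ => ?_
    rw [Finset.sum_mul]
    refine Finset.sum_congr rfl fun k _ => ?_
    rw [Finset.mul_sum]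
    refine Finset.sum_congr rfl fun l _ => ?_
    ring
  · simp [poly, Pi.single_eq_of_ne h]

theorem pd_zero (i : Fin 3) : pd i (0 : E3 → ℝ) = 0 := by
  ext x; simp only [pd, Pi.zero_apply]
  rw [show (0 : E3 → ℝ) = fun _ => 0 from rfl]; simp

theorem jetAt_single (c : Fin 2) {f : E3 → ℝ} (x : E3) :
    jetAt 0 (Pi.single c f) x = (0, 0, Pi.single c (f x), Pi.single c fun i => pd i f x,
      Pi.single c fun i k => pd i (pd k f) x, Pi.single c fun i k l => pd i (pd k (pd l f)) x) := by
  have z : ∀ i, pd i (fun _ : E3 => (0 : ℝ)) x = 0 := fun i => by simp [pd]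
  simp only [jetAt]
  refine Prod.ext rfl (Prod.ext ?_ (Prod.ext ?_ (Prod.ext ?_ (Prod.ext ?_ ?_))))
  · ext d i; simp [z]
  all_goals
    ext c'
    by_cases h : c' = c
    · subst h; simp
    · simp [Pi.single_eq_of_ne h, pd_zero]

theorem pd_triple (U V W : Fin 4 → ℝ) (i : Fin 3) :
    pd i (fun x => aff U x * aff V x * aff W x) = fun x =>
      U i.castSucc * (aff V x * aff W x) + V i.castSucc * (aff U x * aff W x) +
        W i.castSucc * (aff U x * aff V x) := by
  rw [pd_mul (f := fun x => aff U x * aff V x) (by fun_prop) (by fun_prop),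
    pd_mul (by fun_prop) (by fun_prop)]
  ext x
  simp only [pd_aff]
  ring

theorem pd_pair (U V : Fin 4 → ℝ) (u : ℝ) (i : Fin 3) :
    pd i (fun x => u * (aff U x * aff V x)) = fun x =>
      u * (U i.castSucc * aff V x + V i.castSucc * aff U x) := by
  rw [pd_const_mul (by fun_prop), pd_mul (by fun_prop) (by fun_prop)]
  ext x
  simp only [pd_aff]
  ring

theorem pd_pd_triple (U V W : Fin 4 → ℝ) (i k : Fin 3) :
    pd i (pd k (fun x => aff U x * aff V x * aff W x)) = fun x =>
      U k.castSucc * (V i.castSucc * aff W x + W i.castSucc * aff V x) +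
      V k.castSucc * (U i.castSucc * aff W x + W i.castSucc * aff U x) +
      W k.castSucc * (U i.castSucc * aff V x + V i.castSucc * aff U x) := by
  rw [pd_triple, pd_add_of_smooth (by fun_prop) (by fun_prop),
    pd_add_of_smooth (by fun_prop) (by fun_prop), pd_pair, pd_pair, pd_pair]

theorem pd_lin₂ (U V : Fin 4 → ℝ) (w u v : ℝ) (i : Fin 3) :
    pd i (fun x => w * (u * aff V x + v * aff U x)) = fun _ =>
      w * (u * V i.castSucc + v * U i.castSucc) := by
  rw [pd_const_mul (by fun_prop), pd_add_of_smooth (by fun_prop) (by fun_prop),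
    pd_const_mul (by fun_prop), pd_const_mul (by fun_prop)]
  simp only [pd_aff]

theorem pd_pd_pd_triple (U V W : Fin 4 → ℝ) (i k l : Fin 3) :
    pd i (pd k (pd l (fun x => aff U x * aff V x * aff W x))) = fun _ =>
      U l.castSucc * (V k.castSucc * W i.castSucc + W k.castSucc * V i.castSucc) +
      V l.castSucc * (U k.castSucc * W i.castSucc + W k.castSucc * U i.castSucc) +
      W l.castSucc * (U k.castSucc * V i.castSucc + V k.castSucc * U i.castSucc) := by
  rw [pd_pd_triple, pd_add_of_smooth (by fun_prop) (by fun_prop),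
    pd_add_of_smooth (by fun_prop) (by fun_prop), pd_lin₂, pd_lin₂, pd_lin₂]

theorem jetAt_triple (c : Fin 2) (U V W : Fin 4 → ℝ) (x : E3) :
    jetAt 0 (Pi.single c fun x => aff U x * aff V x * aff W x) x =
      (0, 0, Pi.single c (aff U x * aff V x * aff W x), Pi.single c fun i =>
        U i.castSucc * (aff V x * aff W x) + V i.castSucc * (aff U x * aff W x) +
          W i.castSucc * (aff U x * aff V x), Pi.single c fun i k =>
        U k.castSucc * (V i.castSucc * aff W x + W i.castSucc * aff V x) +
          V k.castSucc * (U i.castSucc * aff W x + W i.castSucc * aff U x) +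
          W k.castSucc * (U i.castSucc * aff V x + V i.castSucc * aff U x), Pi.single c fun i k l =>
        U l.castSucc * (V k.castSucc * W i.castSucc + W k.castSucc * V i.castSucc) +
          V l.castSucc * (U k.castSucc * W i.castSucc + W k.castSucc * U i.castSucc) +
          W l.castSucc * (U k.castSucc * V i.castSucc + V k.castSucc * U i.castSucc)) := by
  rw [jetAt_single]
  simp only [pd_pd_pd_triple]
  simp only [pd_pd_triple]
  simp only [pd_triple]

/-- Every model jet is the jet of a perturbation at any given point. -/
theorem exists_poly_jet {δ : Jet} (hδ : δ.IsModel) (x : E3) : ∃ a : Params, jetAt 0 (poly a) x = δ := by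
  -- the affine function with linear part `u` vanishing at `x`
  let cen : (Fin 3 → ℝ) → Fin 4 → ℝ := fun u =>
    ![u 0, u 1, u 2, -(u 0 * x 0 + u 1 * x 1 + u 2 * x 2)]
  have hcen : ∀ u, aff (cen u) x = 0 := fun u => by simp [aff, cen]
  have hcen' : ∀ u i, cen u (Fin.castSucc i) = u i := fun u i => by fin_cases i <;> rfl
  let one : Fin 4 → ℝ := ![0, 0, 0, 1]
  have hone : aff one x = 1 := by simp [aff, one]
  have hone' : ∀ i : Fin 3, one i.castSucc = 0 := fun i => by fin_cases i <;> rfl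
  cases hδ with
  | cst c =>
    refine ⟨Pi.single c fun i k l => one i * one k * one l, ?_⟩
    rw [poly_single, jetAt_triple]
    simp only [hone, hone']
    refine Prod.ext rfl (Prod.ext rfl (Prod.ext ?_ (Prod.ext ?_ (Prod.ext ?_ ?_))))
    · simp
    all_goals
      simp only [zero_mul, add_zero, mul_zero]
      exact Pi.single_zero c
  | lin c i =>
    refine ⟨Pi.single c fun i' k l => cen (Pi.single i 1) i' * one k * one l, ?_⟩
    rw [poly_single, jetAt_triple]
    simp only [hone, hone', hcen, hcen']
    refine Prod.ext rfl (Prod.ext rfl (Prod.ext ?_ (Prod.ext ?_ (Prod.ext ?_ ?_))))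
    · simp
    · simp
    all_goals
      simp only [zero_mul, add_zero, mul_zero]
      exact Pi.single_zero c
  | quad c u v =>
    refine ⟨Pi.single c fun i' k l => cen u i' * cen v k * one l, ?_⟩
    rw [poly_single, jetAt_triple]
    simp only [hone, hone', hcen, hcen']
    refine Prod.ext rfl (Prod.ext rfl (Prod.ext ?_ (Prod.ext ?_ (Prod.ext ?_ ?_))))
    · simp
    · simp only [zero_mul, add_zero, mul_zero]
      exact Pi.single_zero c
    · change Pi.single c _ = Pi.single c _
      congr 1; ext i k; ring
    · simp only [zero_mul, add_zero, mul_zero]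
      exact Pi.single_zero c
  | cub c u =>
    refine ⟨Pi.single c fun i' k l => cen u i' * cen u k * cen u l, ?_⟩
    rw [poly_single, jetAt_triple]
    simp only [hcen, hcen']
    refine Prod.ext rfl (Prod.ext rfl (Prod.ext ?_ (Prod.ext ?_ (Prod.ext ?_ ?_))))
    · simp
    · simp only [add_zero, mul_zero]
      exact Pi.single_zero c
    · simp only [add_zero, mul_zero]
      exact Pi.single_zero c
    · change Pi.single c _ = Pi.single c _
      congr 1; ext i k l; ring

/-- The jets of the polynomial perturbations depend smoothly on the coefficients and the point. -/
theorem contDiff_jetAt_poly : ContDiff ℝ ∞ fun z : Params × E3 => jetAt 0 (poly z.1) z.2 := by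
  have hm : ∀ i k l : Fin 4, ContDiff ℝ ∞
      fun y : E3 => affCoord y i * affCoord y k * affCoord y l := fun i k l => by fun_prop
  have hsum : ∀ (f : Fin 4 → Fin 4 → Fin 4 → E3 → ℝ) (_ : ∀ i k l, ContDiff ℝ ∞ (f i k l))
      (b : Fin 4 → Fin 4 → Fin 4 → ℝ) (m : Fin 3),
      pd m (fun y => ∑ i, ∑ k, ∑ l, b i k l * f i k l y) =
        fun y => ∑ i, ∑ k, ∑ l, b i k l * pd m (f i k l) y := by
    intro f hf b m
    rw [pd_sum _ (fun i => by fun_prop)]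
    ext y; refine Finset.sum_congr rfl fun i _ => ?_
    rw [pd_sum _ (fun k => by fun_prop)]
    refine Finset.sum_congr rfl fun k _ => ?_
    rw [pd_sum _ (fun l => by fun_prop)]
    refine Finset.sum_congr rfl fun l _ => ?_
    rw [pd_const_mul (hf i k l)]
  have hpoly : ∀ (a : Params) c, poly a c = fun x =>
    ∑ i, ∑ k, ∑ l, a c i k l * (affCoord x i * affCoord x k * affCoord x l) := fun a c => rfl
  have h1 : ∀ (a : Params) c m, pd m (poly a c) = _ := fun a c m => by
    rw [hpoly, hsum _ hm]
  have h2 : ∀ (a : Params) c m n, pd n (pd m (poly a c)) = _ := fun a c m n => by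
    rw [h1, hsum _ fun i k l => (hm i k l).pd m]
  have h3 : ∀ (a : Params) c m n o, pd o (pd n (pd m (poly a c))) = _ := fun a c m n o => by
    rw [h2, hsum _ fun i k l => ((hm i k l).pd m).pd n]
  have hfin : ∀ f : Fin 4 → Fin 4 → Fin 4 → E3 → ℝ, (∀ i k l, ContDiff ℝ ∞ (f i k l)) →
      ∀ c, ContDiff ℝ ∞ fun z : Params × E3 => ∑ i, ∑ k, ∑ l, z.1 c i k l * f i k l z.2 :=
    fun f hf c => ContDiff.sum fun i _ => ContDiff.sum fun k _ => ContDiff.sum fun l _ =>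
      ContDiff.mul (by fun_prop) ((hf i k l).comp contDiff_snd)
  refine contDiff_const.prodMk (ContDiff.prodMk ?_ (ContDiff.prodMk ?_ (ContDiff.prodMk ?_
    (ContDiff.prodMk ?_ ?_))))
  · have z : ∀ x i, pd i (fun _ : E3 => (0 : ℝ)) x = 0 := fun x i => by simp [pd]
    simp only [Pi.zero_apply, z]
    exact contDiff_const
  · exact contDiff_pi.2 fun c => by simp only [hpoly]; exact hfin _ hm c
  · exact contDiff_pi.2 fun c => contDiff_pi.2 fun i => by
      simp only [h1]; exact hfin _ (fun _ _ _ => (hm _ _ _).pd i) c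
  · exact contDiff_pi.2 fun c => contDiff_pi.2 fun i => contDiff_pi.2 fun k => by
      simp only [h2]; exact hfin _ (fun _ _ _ => ((hm _ _ _).pd k).pd i) c
  · exact contDiff_pi.2 fun c => contDiff_pi.2 fun i => contDiff_pi.2 fun k =>
      contDiff_pi.2 fun l => by
        simp only [h3]; exact hfin _ (fun _ _ _ => (((hm _ _ _).pd l).pd k).pd i) c

theorem jetAt_poly_add_smul (a b : Params) (t : ℝ) (x : E3) :
    jetAt 0 (poly (a + t • b)) x = jetAt 0 (poly a) x + t • jetAt 0 (poly b) x := by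
  have hp : poly (a + t • b) = fun c y => poly a c y + t * poly b c y := by
    ext c y
    simp only [poly, Pi.add_apply, Pi.smul_apply, smul_eq_mul, add_mul, Finset.sum_add_distrib,
      Finset.mul_sum, mul_assoc]
  have hb : jetAt 0 (fun c y => t * poly b c y) x = t • jetAt 0 (poly b) x := by
    have h1 : ∀ c i, pd i (fun y => t * poly b c y) = fun y => t * pd i (poly b c) y :=
      fun c i => pd_const_mul (contDiff_poly b c) t i
    have h2 : ∀ c i k, pd i (fun y => t * pd k (poly b c) y) = fun y => t * pd i (pd k (poly b c)) y :=
      fun c i k => pd_const_mul ((contDiff_poly b c).pd k) t i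
    have h3 : ∀ c i k l, pd i (fun y => t * pd k (pd l (poly b c)) y) =
        fun y => t * pd i (pd k (pd l (poly b c))) y :=
      fun c i k l => pd_const_mul (((contDiff_poly b c).pd l).pd k) t i
    have z : ∀ x i, pd i (fun _ : E3 => (0 : ℝ)) x = 0 := fun x i => by simp [pd]
    simp only [jetAt, h1, h2, h3, Pi.zero_apply, z]
    refine Prod.ext ?_ (Prod.ext ?_ rfl)
    · simp
    · ext d i; simp
  rw [hp, jetAt_add (fun c => (contDiff_poly a c).contDiffAt.of_le (by norm_cast))
    (fun c => (contDiff_const.mul (contDiff_poly b c)).contDiffAt.of_le (by norm_cast)), hb]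

/-- The polynomial perturbations for which a jet in a given thin set occurs form a set of positive
Hausdorff codimension: four equations are imposed on the three coordinates of the point. -/
theorem dimH_params_lt {S : Set Jet} (hS : Jet.IsThin S) {U : Set E3} (hU : IsOpen U)
    {A : E3 → Fin 2 → ℝ} {F : Fin 2 → E3 → ℝ} (hA : ContDiffOn ℝ 2 A U)
    (hF : ∀ c, ContDiffOn ℝ 4 (F c) U) :
    dimH {a : Params | ∃ x ∈ U, jetAt A (fun c y => F c y + poly a c y) x ∈ S} <
      Module.finrank ℝ Params := by
  obtain ⟨h, hh⟩ := hS
  have hjet : ∀ (a : Params), ∀ x ∈ U, jetAt A (fun c y => F c y + poly a c y) x =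
      jetAt A F x + jetAt 0 (poly a) x := fun a x hx =>
    jetAt_add (fun c => ((hF c).contDiffAt (hU.mem_nhds hx)).of_le (by norm_num))
      (fun c => (contDiff_poly a c).contDiffAt.of_le (by norm_cast))
  let J : Params × E3 → Jet := fun z => jetAt A F z.2 + jetAt 0 (poly z.1) z.2
  have hJ : ∀ z : Params × E3, z.2 ∈ U → ContDiffAt ℝ 1 J z := fun z hz =>
    ((contDiffAt_jetAt (hA.contDiffAt (hU.mem_nhds hz)) fun c =>
      (hF c).contDiffAt (hU.mem_nhds hz)).comp z contDiffAt_snd).add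
      (contDiff_jetAt_poly.contDiffAt.of_le (by simp))
  have himg : {a : Params | ∃ x ∈ U, jetAt A (fun c y => F c y + poly a c y) x ∈ S} =
      Prod.fst '' {z : Params × E3 | z.2 ∈ U ∧ J z ∈ S} := by
    ext a
    constructor
    · rintro ⟨x, hx, hxS⟩
      exact ⟨(a, x), ⟨hx, by simpa only [J, ← hjet a x hx] using hxS⟩, rfl⟩
    · rintro ⟨⟨a, x⟩, ⟨hx, hxS⟩, rfl⟩
      exact ⟨x, hx, by rw [hjet a x hx]; exact hxS⟩
  rw [himg]
  refine dimH_fst_image_lt_of_triangular (by simp) ?_ (fun k z => h k (J z)) ?_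
  · exact Module.finrank_pos
  · rintro ⟨a, x⟩ ⟨hx, hxS⟩
    obtain ⟨h0, hC, δ, m, hδ, hm, hlow, hdiag⟩ := hh _ hxS
    refine ⟨fun k => (hC k).comp (a, x) (hJ (a, x) hx), h0, ?_⟩
    choose v hv using fun i => exists_poly_jet (hδ i) x
    have hline : ∀ i (t : ℝ), J (a + t • v i, x) = J (a, x) + t • δ i := fun i t => by
      simp only [J, jetAt_poly_add_smul, hv, add_assoc]
    refine ⟨v, fun i k => if k = i then m i else 0, fun i k hk => ?_, fun i k hk => ?_, fun i => ?_⟩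
    · simp only [hline]
      by_cases hki : k = i
      · subst hki
        simp only [hdiag, if_true]
        simpa using ((hasDerivAt_id (0 : ℝ)).mul_const (m k)).const_add (h k (J (a, x)))
      · simp only [hlow i k (lt_of_le_of_ne hk hki), if_neg hki]
        exact hasDerivAt_const _ _
    · simp [hk.ne]
    · simpa using hm i

/-- For a dense set of polynomial perturbations no bad jet occurs. -/
theorem dense_good_params {U : Set E3} (hU : IsOpen U) {A : E3 → Fin 2 → ℝ} {F : Fin 2 → E3 → ℝ}
    (hA : ContDiffOn ℝ 2 A U) (hF : ∀ c, ContDiffOn ℝ 4 (F c) U) :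
    Dense {a : Params | ∀ x ∈ U, ¬ (jetAt A (fun c y => F c y + poly a c y) x).Bad} := by
  obtain ⟨l, hl⟩ := Jet.exists_thin_cover
  have hlt : ∀ l : List {S : Set Jet // Jet.IsThin S},
      dimH {a : Params | ∃ x ∈ U, ∃ S ∈ l, jetAt A (fun c y => F c y + poly a c y) x ∈ S.1} <
        Module.finrank ℝ Params := by
    intro l
    induction l with
    | nil =>
      simp only [List.not_mem_nil, false_and, exists_false, and_false]
      have : (0 : ℕ) < Module.finrank ℝ Params := Module.finrank_pos
      simpa using this
    | cons S l ih =>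
      refine lt_of_le_of_lt (dimH_mono (t := {a : Params | ∃ x ∈ U,
        jetAt A (fun c y => F c y + poly a c y) x ∈ S.1} ∪ {a : Params | ∃ x ∈ U, ∃ S ∈ l,
        jetAt A (fun c y => F c y + poly a c y) x ∈ S.1}) ?_) ?_
      · rintro a ⟨x, hx, T, hT, hxT⟩
        rcases List.mem_cons.1 hT with rfl | hT
        · exact Or.inl ⟨x, hx, hxT⟩
        · exact Or.inr ⟨x, hx, T, hT, hxT⟩
      · rw [dimH_union]
        exact max_lt (dimH_params_lt S.2 hU hA hF) ih
  have hd := dense_compl_of_dimH_lt_finrank (hlt l)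
  refine hd.mono ?_
  intro a ha x hx hbad
  obtain ⟨S, hS, hxS⟩ := hl _ hbad
  exact ha ⟨x, hx, S, hS, hxS⟩

/-! ### Openness of the good sections -/

/-- The first two components of the coordinate expression of a vector field. -/
def comps {M : Type*} [TopologicalSpace M] [ChartedSpace E3 M] (φ : OpenPartialHomeomorph M E3)
    (X : ∀ p : M, TangentSpace (𝓡 3) p) : Fin 2 → E3 → ℝ :=
  fun c y => chartRep φ X y c.castSucc

theorem pd_iteratedFDeriv {F : E3 → E3} {x : E3} {n : ℕ} (hF : ContDiffAt ℝ (n + 1 : ℕ) F x)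
    (m : Fin n → E3) (c : Fin 3) (i : Fin 3) :
    pd i (fun y => iteratedFDeriv ℝ n F y m c) x =
      iteratedFDeriv ℝ (n + 1) F x (Fin.cons (EuclideanSpace.single i 1) m) c := by
  have hd : DifferentiableAt ℝ (iteratedFDeriv ℝ n F) x :=
    hF.differentiableAt_iteratedFDeriv (by exact_mod_cast Nat.lt_succ_self n)
  let L : (E3 [×n]→L[ℝ] E3) →L[ℝ] ℝ := (EuclideanSpace.proj c : E3 →L[ℝ] ℝ).comp
    (ContinuousMultilinearMap.apply ℝ (fun _ : Fin n => E3) E3 m)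
  have h := (L.hasFDerivAt.comp x hd.hasFDerivAt).fderiv
  rw [iteratedFDeriv_succ_apply_left]
  change fderiv ℝ (L ∘ iteratedFDeriv ℝ n F) x _ = _
  rw [h]
  rfl

/-- The part of a jet which depends on the vector field, read off from its iterated derivatives. -/
def jetOfDeriv (A : E3 → Fin 2 → ℝ) (x : E3) (D₀ : E3 [×0]→L[ℝ] E3) (D₁ : E3 [×1]→L[ℝ] E3)
    (D₂ : E3 [×2]→L[ℝ] E3) (D₃ : E3 [×3]→L[ℝ] E3) : Jet :=
  (A x, fun d i => pd i (fun y => A y d) x, fun c => D₀ ![] c.castSucc,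
    fun c i => D₁ ![EuclideanSpace.single i 1] c.castSucc,
    fun c i k => D₂ ![EuclideanSpace.single i 1, EuclideanSpace.single k 1] c.castSucc,
    fun c i k l => D₃ ![EuclideanSpace.single i 1, EuclideanSpace.single k 1,
      EuclideanSpace.single l 1] c.castSucc)

theorem jetAt_eq_jetOfDeriv (A : E3 → Fin 2 → ℝ) {F : E3 → E3} {x : E3}
    (hF : ContDiffAt ℝ 3 F x) :
    jetAt A (fun c y => F y c.castSucc) x = jetOfDeriv A x (iteratedFDeriv ℝ 0 F x)
      (iteratedFDeriv ℝ 1 F x) (iteratedFDeriv ℝ 2 F x) (iteratedFDeriv ℝ 3 F x) := by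
  have h0 : ∀ c : Fin 2, (fun y => F y c.castSucc) =
      fun y => iteratedFDeriv ℝ 0 F y ![] c.castSucc := fun c => by ext y; simp
  have hev : ∀ᶠ y in 𝓝 x, ContDiffAt ℝ 3 F y := hF.eventually (by simp)
  have h1 : ∀ (c : Fin 2) (l : Fin 3), pd l (fun y => F y c.castSucc) =ᶠ[𝓝 x] fun y =>
      iteratedFDeriv ℝ 1 F y ![EuclideanSpace.single l 1] c.castSucc := fun c l => by
    filter_upwards [hev] with y hy
    rw [h0]; exact pd_iteratedFDeriv (hy.of_le (by norm_num)) _ _ _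
  have h2 : ∀ (c : Fin 2) (k l : Fin 3), pd k (pd l (fun y => F y c.castSucc)) =ᶠ[𝓝 x] fun y =>
      iteratedFDeriv ℝ 2 F y ![EuclideanSpace.single k 1, EuclideanSpace.single l 1]
        c.castSucc := fun c k l => by
    refine (pd_congr (h1 c l) k).trans ?_
    filter_upwards [hev] with y hy
    exact pd_iteratedFDeriv (hy.of_le (by norm_num)) _ _ _
  have h3 : ∀ (c : Fin 2) (i k l : Fin 3), pd i (pd k (pd l (fun y => F y c.castSucc))) =ᶠ[𝓝 x]
      fun y => iteratedFDeriv ℝ 3 F y ![EuclideanSpace.single i 1, EuclideanSpace.single k 1,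
        EuclideanSpace.single l 1] c.castSucc := fun c i k l => by
    refine (pd_congr (h2 c k l) i).trans ?_
    filter_upwards [hev] with y hy
    exact pd_iteratedFDeriv (hy.of_le (by norm_num)) _ _ _
  have q1 := fun c l => (h1 c l).self_of_nhds
  have q2 := fun c k l => (h2 c k l).self_of_nhds
  have q3 := fun c i k l => (h3 c i k l).self_of_nhds
  simp only [jetAt, q1, q2, q3, jetOfDeriv]
  simp

theorem dist_jetOfDeriv_le (A : E3 → Fin 2 → ℝ) (x : E3) {ε : ℝ} (hε : 0 ≤ ε)
    {D₀ D₀' : E3 [×0]→L[ℝ] E3} {D₁ D₁' : E3 [×1]→L[ℝ] E3} {D₂ D₂' : E3 [×2]→L[ℝ] E3}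
    {D₃ D₃' : E3 [×3]→L[ℝ] E3} (h₀ : dist D₀ D₀' ≤ ε) (h₁ : dist D₁ D₁' ≤ ε)
    (h₂ : dist D₂ D₂' ≤ ε) (h₃ : dist D₃ D₃' ≤ ε) :
    dist (jetOfDeriv A x D₀ D₁ D₂ D₃) (jetOfDeriv A x D₀' D₁' D₂' D₃') ≤ ε := by
  have key : ∀ {n : ℕ} {D D' : E3 [×n]→L[ℝ] E3}, dist D D' ≤ ε → ∀ (m : Fin n → E3),
      (∀ i, ‖m i‖ = 1) → ∀ c, dist (D m c) (D' m c) ≤ ε := by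
    intro n D D' h m hm c
    have h1 : ‖(D - D') m‖ ≤ ‖D - D'‖ := by
      simpa [hm] using (D - D').le_opNorm m
    have h2 : ‖((D - D') m) c‖ ≤ ‖(D - D') m‖ := PiLp.norm_apply_le _ c
    rw [dist_eq_norm] at h
    rw [dist_eq_norm]
    exact (h2.trans h1).trans h
  have hs : ∀ i : Fin 3, ‖(EuclideanSpace.single i 1 : E3)‖ = 1 := fun i => by simp
  simp only [jetOfDeriv, Prod.dist_eq, dist_self, max_le_iff]
  refine ⟨hε, hε, ?_, ?_, ?_, ?_⟩
  · exact (dist_pi_le_iff hε).2 fun c => key h₀ _ (fun i => i.elim0) _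
  · refine (dist_pi_le_iff hε).2 fun c => (dist_pi_le_iff hε).2 fun i => key h₁ _ ?_ _
    intro a; fin_cases a; exact hs _
  · refine (dist_pi_le_iff hε).2 fun c => (dist_pi_le_iff hε).2 fun i =>
      (dist_pi_le_iff hε).2 fun k => key h₂ _ ?_ _
    intro a; fin_cases a <;> exact hs _
  · refine (dist_pi_le_iff hε).2 fun c => (dist_pi_le_iff hε).2 fun i =>
      (dist_pi_le_iff hε).2 fun k => (dist_pi_le_iff hε).2 fun l => key h₃ _ ?_ _
    intro a; fin_cases a <;> exact hs _

section Sections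

variable {M : Type*} [TopologicalSpace M] [ChartedSpace E3 M] [IsManifold (𝓡 3) ∞ M]
  {r : ℕ∞} {η : PlaneField r M} {φ : OpenPartialHomeomorph M E3}

theorem PlaneField.Sections.contDiffAt_chartRep (X : η.Sections)
    (hφ : φ ∈ IsManifold.maximalAtlas (𝓡 3) ∞ M) {x : E3} (hx : x ∈ φ.target) :
    ContDiffAt ℝ r (chartRep φ X.field) x :=
  _root_.contDiffAt_chartRep hφ hx X.1.contMDiff.contMDiffAt

/-- A map into the space of sections converges if and only if the derivatives of the coordinate
expressions converge uniformly on compact sets. -/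
theorem PlaneField.Sections.tendsto_iff {ι : Type*} {l : Filter ι} {u : ι → η.Sections}
    {X : η.Sections} :
    Tendsto u l (𝓝 X) ↔ ∀ φ ∈ IsManifold.maximalAtlas (𝓡 3) ∞ M, ∀ k : ℕ, (k : ℕ∞) ≤ r →
      ∀ K : Set E3, IsCompact K → K ⊆ φ.target → TendstoUniformlyOn
        (fun i => iteratedFDeriv ℝ k (chartRep φ (u i).field))
        (iteratedFDeriv ℝ k (chartRep φ X.field)) l K := by
  have hn : 𝓝 X = ⨅ φ ∈ IsManifold.maximalAtlas (𝓡 3) ∞ M, ⨅ k : ℕ, ⨅ _ : (k : ℕ∞) ≤ r,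
      comap (fun X : η.Sections =>
        UniformOnFun.ofFun {K : Set E3 | IsCompact K ∧ K ⊆ φ.target}
          (iteratedFDeriv ℝ k (chartRep φ X.field))) (𝓝 (UniformOnFun.ofFun
            {K : Set E3 | IsCompact K ∧ K ⊆ φ.target}
            (iteratedFDeriv ℝ k (chartRep φ X.field)))) := by
    rw [show (PlaneField.Sections.topology η) = _ from rfl]
    simp only [nhds_iInf, nhds_induced]
  rw [hn]
  simp only [tendsto_iInf, tendsto_comap_iff, UniformOnFun.tendsto_iff_tendstoUniformlyOn]
  exact ⟨fun h φ hφ k hk K hK hKφ => h φ hφ k hk K ⟨hK, hKφ⟩,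
    fun h φ hφ k hk K hK => h φ hφ k hk K hK.1 hK.2⟩

/-- On a compact set, not to have bad jets is an open condition on the section in the `C^3`
topology. -/
theorem isOpen_not_bad_on (hr : 4 ≤ r) (hφ : φ ∈ IsManifold.maximalAtlas (𝓡 3) ∞ M)
    {A : E3 → Fin 2 → ℝ} (hA : ContDiffOn ℝ r A φ.target) {K : Set E3} (hK : IsCompact K)
    (hKφ : K ⊆ φ.target) :
    IsOpen {X : η.Sections | ∀ x ∈ K, ¬ (jetAt A (comps φ X.field) x).Bad} := by
  have hr4 : ((4 : ℕ∞) : WithTop ℕ∞) ≤ (r : WithTop ℕ∞) := by exact_mod_cast hr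
  have hr2 : ((2 : ℕ∞) : WithTop ℕ∞) ≤ (r : WithTop ℕ∞) := by
    exact_mod_cast le_trans (by norm_num) hr
  rw [isOpen_iff_mem_nhds]
  intro X hX
  have hC : ∀ (Y : η.Sections), ∀ x ∈ K, ContDiffAt ℝ 4 (chartRep φ Y.field) x := fun Y x hx =>
    (Y.contDiffAt_chartRep hφ (hKφ hx)).of_le hr4
  have hcont : ContinuousOn (jetAt A (comps φ X.field)) K := fun x hx =>
    ((contDiffAt_jetAt ((hA.contDiffAt (φ.open_target.mem_nhds (hKφ hx))).of_le hr2)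
      fun c => by have := hC X x hx; unfold comps; fun_prop).continuousAt).continuousWithinAt
  obtain ⟨δ, hδ, hsub⟩ := (hK.image_of_continuousOn hcont).exists_thickening_subset_open
    Jet.isOpen_not_bad (by rintro _ ⟨x, hx, rfl⟩; exact hX x hx)
  have hu : ∀ k : ℕ, k ≤ 3 → ∀ᶠ Y : η.Sections in 𝓝 X, ∀ x ∈ K,
      dist (iteratedFDeriv ℝ k (chartRep φ X.field) x)
        (iteratedFDeriv ℝ k (chartRep φ Y.field) x) < δ / 2 := fun k hk =>
    Metric.tendstoUniformlyOn_iff.1 (PlaneField.Sections.tendsto_iff.1 tendsto_id φ hφ k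
      (le_trans (by norm_cast; omega) hr) K hK hKφ) _ (half_pos hδ)
  filter_upwards [hu 0 (by norm_num), hu 1 (by norm_num), hu 2 (by norm_num), hu 3 le_rfl]
    with Y h0 h1 h2 h3 x hx
  refine hsub (Metric.mem_thickening_iff.2 ⟨_, ⟨x, hx, rfl⟩, ?_⟩)
  have e : ∀ Z : η.Sections, jetAt A (comps φ Z.field) x = _ := fun Z =>
    jetAt_eq_jetOfDeriv A ((hC Z x hx).of_le (by norm_num))
  rw [e, e, dist_comm]
  exact (dist_jetOfDeriv_le A x (half_pos hδ).le (h0 x hx).le (h1 x hx).le (h2 x hx).le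
    (h3 x hx).le).trans_lt (half_lt_self hδ)

end Sections

/-! ### Density of the good sections -/

section Density

variable {M : Type*} [TopologicalSpace M] [ChartedSpace E3 M] [IsManifold (𝓡 3) ∞ M]
  {r : ℕ∞} {η : PlaneField r M} {φ : OpenPartialHomeomorph M E3}

/-- `A` is the pair of slope functions of the plane field in the chart: the plane is the graph of
the linear form with coefficients `A`. -/
def IsSlopes (η : PlaneField r M) (φ : OpenPartialHomeomorph M E3) (A : E3 → Fin 2 → ℝ) : Prop :=
  ContDiffOn ℝ r A φ.target ∧ ∀ p ∈ φ.source, ∀ v : TangentSpace (𝓡 3) p,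
    v ∈ η.plane p ↔ let w : E3 := mfderiv (𝓡 3) (𝓡 3) φ p v
      w 2 = A (φ p) 0 * w 0 + A (φ p) 1 * w 1

theorem AdaptedAtlas.exists_isSlopes (𝒜 : AdaptedAtlas η) (hφ : φ ∈ 𝒜.charts) :
    ∃ A, IsSlopes η φ A := by
  obtain ⟨A, hA, h⟩ := exists_slopes η (𝒜.smooth hφ) (𝒜.transverse φ hφ)
  exact ⟨A, hA, fun p hp v => h p hp v⟩

/-- Near a point of a chart there are sections of the plane field whose first two components are
given smooth functions. -/
theorem exists_section_of_comps [T2Space M] (hφ : φ ∈ IsManifold.maximalAtlas (𝓡 3) ∞ M)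
    {A : E3 → Fin 2 → ℝ} (hA : IsSlopes η φ A) {x₀ : E3} {ρ R : ℝ} (hρ : 0 < ρ) (hR : ρ < R)
    (hball : Metric.closedBall x₀ R ⊆ φ.target) (P : Fin 2 → E3 → ℝ)
    (hP : ∀ c, ContDiff ℝ ∞ (P c)) :
    ∃ s : η.Sections, ∀ x ∈ Metric.ball x₀ ρ, ∀ c, comps φ s.field c x = P c x := by
  classical
  -- cut off the field whose third component is determined by the slopes of the plane field
  let χ : ContDiffBump x₀ := ⟨ρ, R, hρ, hR⟩
  let Y : E3 → E3 := fun x => !₂[P 0 x, P 1 x, A x 0 * P 0 x + A x 1 * P 1 x]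
  let c : M → ℝ := φ.source.indicator fun p => χ (φ p)
  have hcs : ∀ p ∈ φ.source, c p = χ (φ p) := fun p hp => indicator_of_mem hp _
  have hsupp : tsupport c ⊆ φ.source := by
    have hKc : IsCompact (φ.symm '' Metric.closedBall x₀ R) :=
      (isCompact_closedBall x₀ R).image_of_continuousOn (φ.continuousOn_symm.mono hball)
    have : tsupport c ⊆ φ.symm '' Metric.closedBall x₀ R := by
      refine closure_minimal ?_ hKc.isClosed
      intro p hp
      have hps : p ∈ φ.source := by
        by_contra h
        exact hp (indicator_of_notMem h _)
      refine ⟨φ p, ?_, φ.left_inv hps⟩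
      rw [Function.mem_support, hcs p hps] at hp
      exact Metric.ball_subset_closedBall (χ.support_eq ▸ (Function.mem_support.2 hp))
    refine this.trans ?_
    rintro _ ⟨x, hx, rfl⟩
    exact φ.map_target (hball hx)
  have hY : ∀ x ∈ φ.target, ContDiffAt ℝ r Y x := by
    intro x hx
    have hAx := hA.1.contDiffAt (φ.open_target.mem_nhds hx)
    have h0 : ∀ c, ContDiffAt ℝ r (fun x => P c x) x := fun c =>
      (hP c).contDiffAt.of_le (by exact_mod_cast le_top)
    have hA' : ∀ d, ContDiffAt ℝ r (fun y => A y d) x := fun d => contDiffAt_pi.1 hAx d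
    rw [contDiffAt_euclidean]
    intro i
    fin_cases i
    · exact h0 0
    · exact h0 1
    · exact ((hA' 0).mul (h0 0)).add ((hA' 1).mul (h0 1))
  have hcsm : ContMDiffOn (𝓡 3) 𝓘(ℝ, ℝ) r c φ.source := by
    have h1 : ContMDiffOn (𝓡 3) 𝓘(ℝ, ℝ) ∞ (fun p => χ (φ p)) φ.source :=
      (χ.contDiff (n := ⊤)).contMDiff.comp_contMDiffOn (contMDiffOn_of_mem_maximalAtlas hφ)
    exact (h1.congr fun p hp => hcs p hp).of_le (by exact_mod_cast le_top)
  have hsm := ContMDiffOn.smul_section_of_tsupport (V := fun p : M => TangentSpace (𝓡 3) p)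
    hcsm φ.open_source hsupp (fun p hp =>
      (contMDiffAt_fieldOfChart hφ hp (hY _ (φ.map_source hp))).contMDiffWithinAt)
  have hmem : ∀ p, (c • fieldOfChart φ Y) p ∈ η.plane p := by
    intro p
    by_cases hp : p ∈ φ.source
    · refine Submodule.smul_mem _ _ ((hA.2 p hp _).2 ?_)
      have : mfderiv (𝓡 3) (𝓡 3) φ p (fieldOfChart φ Y p) = Y (φ p) := by
        rw [← chartDeriv_apply hφ hp, fieldOfChart_apply hφ hp]
        exact (chartDeriv hφ hp).apply_symm_apply _
      rw [this]
      simp [Y]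
    · have : (c • fieldOfChart φ Y) p = 0 := by
        change c p • fieldOfChart φ Y p = 0
        rw [show c p = 0 from indicator_of_notMem hp _, zero_smul]
      rw [this]; exact Submodule.zero_mem _
  refine ⟨⟨⟨c • fieldOfChart φ Y, hsm⟩, hmem⟩, fun x hx d => ?_⟩
  have hxt : x ∈ φ.target := hball (Metric.ball_subset_closedBall
    (Metric.ball_subset_ball hR.le hx))
  have h1 := chartRep_smul_fieldOfChart hφ hxt c Y
  have h2 : comps φ (c • fieldOfChart φ Y) d x = (c (φ.symm x) • Y x) d.castSucc :=
    congrArg (fun v : E3 => v d.castSucc) h1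
  refine h2.trans ?_
  rw [hcs _ (φ.map_target hxt), φ.right_inv hxt,
    χ.one_of_mem_closedBall (Metric.ball_subset_closedBall hx), one_smul]
  fin_cases d <;> rfl

/-- The linear combinations `X + ∑ aᵢ sᵢ` of sections. -/
def PlaneField.Sections.addSum {ι : Type*} [Fintype ι] (X : η.Sections) (s : ι → η.Sections)
    (a : ι → ℝ) : η.Sections :=
  ⟨X.1 + ∑ i, a i • (s i).1, fun p => by
    have : (X.1 + ∑ i, a i • (s i).1) p = X.1 p + ∑ i, a i • (s i).1 p := by
      rw [ContMDiffSection.coe_add, Pi.add_apply]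
      congr 1
      have h := map_sum (ContMDiffSection.coeAddHom (𝓡 3) E3 r
        (fun p : M => TangentSpace (𝓡 3) p)) (fun i => a i • (s i).1) Finset.univ
      have h' := congrFun h p
      rw [Finset.sum_apply] at h'
      exact h'
    rw [this]
    exact Submodule.add_mem _ (X.2 p) (Submodule.sum_mem _ fun i _ =>
      Submodule.smul_mem _ _ ((s i).2 p))⟩

theorem PlaneField.Sections.addSum_field {ι : Type*} [Fintype ι] (X : η.Sections)
    (s : ι → η.Sections) (a : ι → ℝ) (p : M) :
    (X.addSum s a).field p = X.field p + ∑ i, a i • (s i).field p := by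
  change (X.1 + ∑ i, a i • (s i).1) p = X.1 p + ∑ i, a i • (s i).1 p
  rw [ContMDiffSection.coe_add, Pi.add_apply]
  congr 1
  have h := map_sum (ContMDiffSection.coeAddHom (𝓡 3) E3 r
    (fun p : M => TangentSpace (𝓡 3) p)) (fun i => a i • (s i).1) Finset.univ
  have h' := congrFun h p
  rw [Finset.sum_apply] at h'
  exact h'

theorem PlaneField.Sections.chartRep_addSum {ι : Type*} [Fintype ι] (X : η.Sections)
    (s : ι → η.Sections) (a : ι → ℝ) :
    chartRep φ (X.addSum s a).field =
      fun x => chartRep φ X.field x + ∑ i, a i • chartRep φ (s i).field x := by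
  ext1 x
  simp only [chartRep, X.addSum_field]
  erw [map_add, map_sum]
  congr 1
  exact Finset.sum_congr rfl fun i _ => map_smul _ _ _

theorem PlaneField.Sections.addSum_zero {ι : Type*} [Fintype ι] (X : η.Sections)
    (s : ι → η.Sections) : X.addSum s 0 = X := by
  refine Subtype.ext ?_
  simp only [addSum, Pi.zero_apply]
  rw [Finset.sum_eq_zero fun i _ => zero_smul ℝ (s i).1, add_zero]

theorem PlaneField.Sections.continuous_addSum {ι : Type*} [Fintype ι] (X : η.Sections)
    (s : ι → η.Sections) : Continuous (X.addSum s) := by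
  rw [continuous_iff_continuousAt]
  intro a
  refine PlaneField.Sections.tendsto_iff.2 fun ψ hψ k hk K hK hKψ => ?_
  have hC : ∀ (Y : η.Sections), ∀ x ∈ K, ContDiffAt ℝ k (chartRep ψ Y.field) x := fun Y x hx =>
    (Y.contDiffAt_chartRep hψ (hKψ hx)).of_le (by exact_mod_cast hk)
  have hD : ∀ b, ∀ x ∈ K, iteratedFDeriv ℝ k (chartRep ψ (X.addSum s b).field) x =
      iteratedFDeriv ℝ k (chartRep ψ X.field) x +
        ∑ i, b i • iteratedFDeriv ℝ k (chartRep ψ (s i).field) x := by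
    intro b x hx
    rw [PlaneField.Sections.chartRep_addSum]
    refine (iteratedFDeriv_add_apply (hC X x hx)
      (ContDiffAt.sum fun i _ => (hC (s i) x hx).const_smul (b i))).trans ?_
    rw [iteratedFDeriv_fun_sum_apply fun i _ => (hC (s i) x hx).const_smul (b i)]
    congr 1
    exact Finset.sum_congr rfl fun i _ => iteratedFDeriv_const_smul_apply' (hC (s i) x hx)
  have hb : ∀ i, ∃ C, ∀ x ∈ K, ‖iteratedFDeriv ℝ k (chartRep ψ (s i).field) x‖ ≤ C := fun i =>
    hK.exists_bound_of_continuousOn fun x hx =>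
      (ContDiffAt.continuousAt_iteratedFDeriv (hC (s i) x hx) le_rfl).continuousWithinAt
  choose C hCb using hb
  refine Metric.tendstoUniformlyOn_iff.2 fun ε hε => ?_
  have hlim : Tendsto (fun b : ι → ℝ => ∑ i, |a i - b i| * C i) (𝓝 a) (𝓝 0) := by
    have : Continuous fun b : ι → ℝ => ∑ i, |a i - b i| * C i := by fun_prop
    simpa using this.tendsto a
  filter_upwards [hlim.eventually (gt_mem_nhds hε)] with b hbε x hx
  rw [hD a x hx, hD b x hx, dist_add_left, dist_eq_norm, ← Finset.sum_sub_distrib]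
  refine (norm_sum_le _ _).trans_lt (lt_of_le_of_lt (Finset.sum_le_sum fun i _ => ?_) hbε)
  rw [← sub_smul, norm_smul, Real.norm_eq_abs]
  exact mul_le_mul_of_nonneg_left (hCb i x hx) (abs_nonneg _)

/-- Any section can be perturbed by a small combination of sections whose components are polynomials
on the ball so that it has no bad jets there. -/
theorem dense_not_bad_on [T2Space M] (hr : 4 ≤ r) (hφ : φ ∈ IsManifold.maximalAtlas (𝓡 3) ∞ M)
    {A : E3 → Fin 2 → ℝ} (hA : IsSlopes η φ A) {x₀ : E3} {ρ R : ℝ} (hρ : 0 < ρ) (hR : ρ < R)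
    (hball : Metric.closedBall x₀ R ⊆ φ.target) :
    Dense {X : η.Sections | ∀ x ∈ Metric.ball x₀ ρ, ¬ (jetAt A (comps φ X.field) x).Bad} := by
  have hsub : Metric.ball x₀ ρ ⊆ φ.target :=
    (Metric.ball_subset_closedBall.trans (Metric.closedBall_subset_closedBall hR.le)).trans hball
  have hr4 : ((4 : ℕ∞) : WithTop ℕ∞) ≤ (r : WithTop ℕ∞) := by exact_mod_cast hr
  have hr2 : ((2 : ℕ∞) : WithTop ℕ∞) ≤ (r : WithTop ℕ∞) := by
    exact_mod_cast le_trans (by norm_num) hr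
  intro X
  -- finitely many sections whose components on the ball are the monomials spanning the polynomials
  let mono : Fin 2 × Fin 4 × Fin 4 × Fin 4 → Fin 2 → E3 → ℝ := fun I =>
    Pi.single I.1 fun x => affCoord x I.2.1 * affCoord x I.2.2.1 * affCoord x I.2.2.2
  have hmono : ∀ I c, ContDiff ℝ ∞ (mono I c) := by
    intro I c
    by_cases h : c = I.1
    · subst h; simp only [mono, Pi.single_eq_same]; fun_prop
    · simp only [mono, Pi.single_eq_of_ne h]; exact contDiff_const
  choose s hs using fun I => exists_section_of_comps hφ hA hρ hR hball (mono I) (hmono I)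
  let flat : Params → Fin 2 × Fin 4 × Fin 4 × Fin 4 → ℝ := fun a I => a I.1 I.2.1 I.2.2.1 I.2.2.2
  have hcont : Continuous fun a : Params => X.addSum s (flat a) :=
    (X.continuous_addSum s).comp (by fun_prop)
  have hcomps : ∀ a, ∀ x ∈ Metric.ball x₀ ρ, ∀ c, comps φ (X.addSum s (flat a)).field c x =
      comps φ X.field c x + poly a c x := by
    intro a x hx c
    have h1 : comps φ (X.addSum s (flat a)).field c x = comps φ X.field c x +
        ∑ I, flat a I * comps φ (s I).field c x := by
      simp [comps, PlaneField.Sections.chartRep_addSum]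
    rw [h1]
    congr 1
    simp only [fun I => hs I x hx c, Fintype.sum_prod_type, poly, flat, mono]
    rw [Finset.sum_eq_single c]
    · simp
    · intro c' _ h
      simp [Pi.single_eq_of_ne h.symm]
    · simp
  have hzero : X.addSum s (flat 0) = X := X.addSum_zero s
  have hd := dense_good_params (U := Metric.ball x₀ ρ) (A := A) (F := comps φ X.field)
    Metric.isOpen_ball ((hA.1.mono hsub).of_le hr2) (fun c x hx => by
      have := (X.contDiffAt_chartRep hφ (hsub hx)).of_le hr4
      unfold comps
      exact ContDiffAt.contDiffWithinAt (by fun_prop))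
  refine mem_closure_iff_nhds.2 fun N hN => ?_
  have hN' : (fun a : Params => X.addSum s (flat a)) ⁻¹' N ∈ 𝓝 (0 : Params) :=
    hcont.continuousAt (by rw [hzero]; exact hN)
  obtain ⟨a, haN, ha⟩ := mem_closure_iff_nhds.1 (hd 0) _ hN'
  refine ⟨_, haN, fun x hx => ?_⟩
  rw [jetAt_congr (G := fun c y => comps φ X.field c y + poly a c y) fun c => ?_]
  · exact ha x hx
  · filter_upwards [Metric.isOpen_ball.mem_nhds hx] with y hy
    exact hcomps a y hy c

/-- No jet of the section in a chart of the atlas is bad. -/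
def IsGood (𝒜 : AdaptedAtlas η) (X : η.Sections) : Prop :=
  ∀ φ ∈ 𝒜.charts, ∃ A, IsSlopes η φ A ∧ ∀ x ∈ φ.target, ¬ (jetAt A (comps φ X.field) x).Bad

/-- In each of the countably many charts, countably many closed balls cover the target, and on each
of these the condition is open and dense. -/
theorem residual_isGood [T2Space M] (hr : 4 ≤ r) (𝒜 : AdaptedAtlas η) :
    {X : η.Sections | IsGood 𝒜 X} ∈ residual η.Sections := by
  have hs : ∀ φ : 𝒜.charts, ∃ A, IsSlopes η φ.1 A := fun φ => 𝒜.exists_isSlopes φ.2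
  choose A hA using hs
  have key : ∀ φ : 𝒜.charts, {X : η.Sections | ∀ x ∈ φ.1.target,
      ¬ (jetAt (A φ) (comps φ.1 X.field) x).Bad} ∈ residual η.Sections := by
    rintro φ
    have hφ := 𝒜.smooth φ.2
    have hR : ∀ x : E3, ∃ R : ℝ, 0 < R ∧ (x ∈ φ.1.target → Metric.closedBall x R ⊆ φ.1.target) := by
      intro x
      by_cases hx : x ∈ φ.1.target
      · obtain ⟨R, hR, h⟩ := Metric.nhds_basis_closedBall.mem_iff.1 (φ.1.open_target.mem_nhds hx)
        exact ⟨R, hR, fun _ => h⟩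
      · exact ⟨1, one_pos, fun h => absurd h hx⟩
    choose R hR hRs using hR
    obtain ⟨t, ht, htc, hcov⟩ := TopologicalSpace.countable_cover_nhdsWithin
      (f := fun x => Metric.closedBall x (R x / 3)) (s := φ.1.target)
      (fun x _ => mem_nhdsWithin_of_mem_nhds (Metric.closedBall_mem_nhds x (by linarith [hR x])))
    have h1 : ⋂ x ∈ t, {X : η.Sections | ∀ y ∈ Metric.closedBall x (R x / 3),
        ¬ (jetAt (A φ) (comps φ.1 X.field) y).Bad} ∈ residual η.Sections := by
      refine (countable_bInter_mem htc).2 fun x hx => residual_of_dense_open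
        (isOpen_not_bad_on hr hφ (hA φ).1 (isCompact_closedBall _ _)
          ((Metric.closedBall_subset_closedBall (by linarith [hR x])).trans (hRs x (ht hx)))) ?_
      refine (dense_not_bad_on hr hφ (hA φ) (x₀ := x) (ρ := R x / 2) (by linarith [hR x])
        (by linarith [hR x]) (hRs x (ht hx))).mono ?_
      exact fun X hX y hy => hX y (Metric.closedBall_subset_ball (by linarith [hR x]) hy)
    refine mem_of_superset h1 fun X hX y hy => ?_
    obtain ⟨x, hx, hyx⟩ := mem_iUnion₂.1 (hcov hy)
    exact mem_iInter₂.1 hX x hx y hyx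
  have : Countable 𝒜.charts := 𝒜.countable
  refine mem_of_superset (countable_iInter_mem.2 key) fun X hX φ hφ =>
    ⟨A ⟨φ, hφ⟩, hA ⟨φ, hφ⟩, ?_⟩
  exact mem_iInter.1 hX ⟨φ, hφ⟩

end Density

/-! ### Regular zero sets are arcs -/

theorem fderiv_eq_sum_pd (f : E3 → ℝ) (x v : E3) :
    fderiv ℝ f x v = v 0 * pd 0 f x + v 1 * pd 1 f x + v 2 * pd 2 f x := by
  have hv : v = v 0 • (EuclideanSpace.single 0 1 : E3) + v 1 • (EuclideanSpace.single 1 1 : E3) +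
      v 2 • (EuclideanSpace.single 2 1 : E3) := by
    ext i; fin_cases i <;> simp
  conv_lhs => rw [hv]
  simp [pd]

/-- Two vectors with nonzero cross product, together with the cross product, form a basis. -/
theorem eq_zero_of_orthogonal {a b v : Fin 3 → ℝ}
    (hk : ¬ (a 1 * b 2 - a 2 * b 1 = 0 ∧ a 2 * b 0 - a 0 * b 2 = 0 ∧ a 0 * b 1 - a 1 * b 0 = 0))
    (ha : v 0 * a 0 + v 1 * a 1 + v 2 * a 2 = 0) (hb : v 0 * b 0 + v 1 * b 1 + v 2 * b 2 = 0)
    (hc : v 0 * (a 1 * b 2 - a 2 * b 1) + v 1 * (a 2 * b 0 - a 0 * b 2) +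
      v 2 * (a 0 * b 1 - a 1 * b 0) = 0) : v = 0 := by
  generalize h0 : a 1 * b 2 - a 2 * b 1 = k0 at hk hc
  generalize h1 : a 2 * b 0 - a 0 * b 2 = k1 at hk hc
  generalize h2 : a 0 * b 1 - a 1 * b 0 = k2 at hk hc
  -- `v` is parallel to the cross product, and orthogonal to it
  have e0 : v 1 * k2 - v 2 * k1 = 0 := by
    rw [← h1, ← h2]; linear_combination a 0 * hb - b 0 * ha
  have e1 : v 2 * k0 - v 0 * k2 = 0 := by
    rw [← h0, ← h2]; linear_combination a 1 * hb - b 1 * ha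
  have e2 : v 0 * k1 - v 1 * k0 = 0 := by
    rw [← h0, ← h1]; linear_combination a 2 * hb - b 2 * ha
  have hkk : 0 < k0 ^ 2 + k1 ^ 2 + k2 ^ 2 := by
    by_contra h
    have hz : k0 ^ 2 + k1 ^ 2 + k2 ^ 2 = 0 := le_antisymm (not_lt.1 h) (by positivity)
    exact hk ⟨by nlinarith [sq_nonneg k0, sq_nonneg k1, sq_nonneg k2],
      by nlinarith [sq_nonneg k0, sq_nonneg k1, sq_nonneg k2],
      by nlinarith [sq_nonneg k0, sq_nonneg k1, sq_nonneg k2]⟩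
  have f0 : (k0 ^ 2 + k1 ^ 2 + k2 ^ 2) * v 0 = 0 := by
    linear_combination k0 * hc - k2 * e1 + k1 * e2
  have f1 : (k0 ^ 2 + k1 ^ 2 + k2 ^ 2) * v 1 = 0 := by
    linear_combination k1 * hc + k2 * e0 - k0 * e2
  have f2 : (k0 ^ 2 + k1 ^ 2 + k2 ^ 2) * v 2 = 0 := by
    linear_combination k2 * hc - k1 * e0 + k0 * e1
  ext i
  fin_cases i
  · exact (mul_eq_zero.1 f0).resolve_left hkk.ne'
  · exact (mul_eq_zero.1 f1).resolve_left hkk.ne'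
  · exact (mul_eq_zero.1 f2).resolve_left hkk.ne'

/-- Near a regular zero, the zero set of a pair of functions is an arc `c`, and the parameter of the
arc is the restriction of a linear function `θ`. -/
theorem exists_arc_of_regular {r : ℕ∞} (hr : 1 ≤ r) {U : Set E3} (hU : IsOpen U)
    {F : Fin 2 → E3 → ℝ} (hF : ∀ c, ContDiffOn ℝ r (F c) U) {x₀ : E3} (hx₀ : x₀ ∈ U)
    (h0 : ∀ c, F c x₀ = 0) {A : E3 → Fin 2 → ℝ} (hk : (jetAt A F x₀).ker ≠ 0) :
    ∃ (c : ℝ → E3) (θ : E3 → ℝ) (ε : ℝ), 0 < ε ∧ c 0 = x₀ ∧ Differentiable ℝ θ ∧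
      ∀ s, |s| < ε → c s ∈ U ∧ (∀ d, F d (c s) = 0) ∧ θ (c s) = s ∧ ContDiffAt ℝ r c s ∧
        ∀ᶠ x in 𝓝 (c s), (∀ d, F d x = 0) → c (θ x) = x := by
  have hr1 : ((1 : ℕ∞) : WithTop ℕ∞) ≤ (r : WithTop ℕ∞) := by exact_mod_cast hr
  have hr0 : (r : WithTop ℕ∞) ≠ 0 := fun h => by rw [h] at hr1; simp at hr1
  set k := (jetAt A F x₀).ker with hkdef
  let θ : E3 → ℝ := fun x => k 0 * (x 0 - x₀ 0) + k 1 * (x 1 - x₀ 1) + k 2 * (x 2 - x₀ 2)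
  have hθ : ContDiff ℝ r θ := by fun_prop
  -- the pair of functions is completed to a local diffeomorphism `G` by the linear function `θ`
  -- along the cross product of the gradients
  let G : E3 → E3 := fun x => !₂[F 0 x, F 1 x, θ x]
  have hG : ∀ x ∈ U, ContDiffAt ℝ r G x := by
    intro x hx
    rw [contDiffAt_euclidean]
    intro i
    fin_cases i
    · exact (hF 0).contDiffAt (hU.mem_nhds hx)
    · exact (hF 1).contDiffAt (hU.mem_nhds hx)
    · exact hθ.contDiffAt
  have hGi : ∀ i : Fin 3, DifferentiableAt ℝ (fun x => G x i) x₀ := fun i =>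
    (contDiffAt_euclidean.1 (hG x₀ hx₀) i).differentiableAt hr0
  have hinj : Function.Injective (fderiv ℝ G x₀) := by
    rw [injective_iff_map_eq_zero]
    intro v hv
    have hcomp : ∀ i : Fin 3, fderiv ℝ (fun x => G x i) x₀ v = 0 := by
      intro i
      have h1 : HasFDerivAt (fun x => G x i) ((EuclideanSpace.proj i : E3 →L[ℝ] ℝ).comp
          (fderiv ℝ G x₀)) x₀ := (EuclideanSpace.proj i : E3 →L[ℝ] ℝ).hasFDerivAt.comp x₀
        ((hG x₀ hx₀).differentiableAt hr0).hasFDerivAt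
      rw [h1.fderiv]
      simp [hv]
    have hθ' : fderiv ℝ θ x₀ v = v 0 * k 0 + v 1 * k 1 + v 2 * k 2 := by
      have hp : ∀ i, HasFDerivAt (fun x : E3 => k i * (x i - x₀ i))
          (k i • (EuclideanSpace.proj i : E3 →L[ℝ] ℝ)) x₀ := fun i =>
        ((EuclideanSpace.proj i : E3 →L[ℝ] ℝ).hasFDerivAt.sub_const _).const_mul _
      have hs : HasFDerivAt θ _ x₀ := ((hp 0).add (hp 1)).add (hp 2)
      rw [hs.fderiv]
      simp [mul_comm]
    have e0 := hcomp 0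
    have e1 := hcomp 1
    have e2 := hcomp 2
    change fderiv ℝ (F 0) x₀ v = 0 at e0
    change fderiv ℝ (F 1) x₀ v = 0 at e1
    change fderiv ℝ θ x₀ v = 0 at e2
    rw [fderiv_eq_sum_pd] at e0 e1
    rw [hθ'] at e2
    have := eq_zero_of_orthogonal (a := fun i => pd i (F 0) x₀) (b := fun i => pd i (F 1) x₀)
      (v := fun i => v i) ?_ e0 e1 e2
    · ext i; exact congrFun this i
    · rintro ⟨q0, q1, q2⟩
      refine hk ?_
      ext i; fin_cases i
      · exact q0
      · exact q1
      · exact q2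
  let G' : E3 ≃L[ℝ] E3 :=
    (LinearEquiv.ofInjectiveEndo (fderiv ℝ G x₀ : E3 →ₗ[ℝ] E3) hinj).toContinuousLinearEquiv
  have hG' : HasFDerivAt G (G' : E3 →L[ℝ] E3) x₀ := by
    convert! ((hG x₀ hx₀).differentiableAt hr0).hasFDerivAt
  -- the points of `U` at which the derivative is still invertible
  obtain ⟨V, hVsub, hVo, hxV⟩ : ∃ V ⊆ {x | x ∈ U ∧ ∃ e : E3 ≃L[ℝ] E3,
      (e : E3 →L[ℝ] E3) = fderiv ℝ G x}, IsOpen V ∧ x₀ ∈ V := by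
    rw [← mem_nhds_iff]
    refine inter_mem (hU.mem_nhds hx₀) ?_
    have hc : ContinuousAt (fderiv ℝ G) x₀ := (hG x₀ hx₀).continuousAt_fderiv hr0
    have hn : range ((↑) : (E3 ≃L[ℝ] E3) → E3 →L[ℝ] E3) ∈ 𝓝 (fderiv ℝ G x₀) := by
      rw [hG'.fderiv]; exact ContinuousLinearEquiv.nhds G'
    exact hc hn
  let ψ := ((hG x₀ hx₀).toOpenPartialHomeomorph G hG' hr0).restrOpen V hVo
  have hψ : ∀ x, ψ x = G x := fun x => rfl
  have hψs : x₀ ∈ ψ.source :=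
    ⟨(hG x₀ hx₀).mem_toOpenPartialHomeomorph_source hG' hr0, hxV⟩
  have hψV : ψ.source ⊆ V := fun x hx => hx.2
  let c : ℝ → E3 := fun s => ψ.symm !₂[0, 0, s]
  have hline : Continuous fun s : ℝ => (!₂[0, 0, s] : E3) := by fun_prop
  have hG0 : G x₀ = !₂[0, 0, 0] := by simp [G, θ, h0]
  have htar : ∀ᶠ s in 𝓝 (0 : ℝ), (!₂[0, 0, s] : E3) ∈ ψ.target := by
    refine hline.continuousAt.eventually (ψ.open_target.mem_nhds ?_)
    change (!₂[0, 0, 0] : E3) ∈ ψ.target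
    rw [← hG0]
    exact ψ.map_source hψs
  obtain ⟨ε, hε, hball⟩ := Metric.eventually_nhds_iff.1 htar
  refine ⟨c, θ, ε, hε, ?_, hθ.differentiable hr0, fun s hs => ?_⟩
  · change ψ.symm !₂[0, 0, 0] = x₀
    rw [← hG0]; exact ψ.left_inv hψs
  · have hst : (!₂[0, 0, s] : E3) ∈ ψ.target := hball (by simpa using hs)
    have hsV := hψV (ψ.map_target hst)
    have hGc : G (c s) = !₂[0, 0, s] := ψ.right_inv hst
    have hg : ∀ i, G (c s) i = (!₂[0, 0, s] : E3) i := fun i => by rw [hGc]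
    refine ⟨(hVsub hsV).1, ?_, hg 2, ?_, ?_⟩
    · intro d
      fin_cases d
      · exact hg 0
      · exact hg 1
    · obtain ⟨e, he⟩ := (hVsub hsV).2
      have hd := hG _ (hVsub hsV).1
      have h1 := ψ.contDiffAt_symm (f₀' := e) hst
        (by rw [he]; exact (hd.differentiableAt hr0).hasFDerivAt) hd
      exact h1.comp s (by rw [contDiffAt_euclidean]; intro i; fin_cases i <;> simp <;> fun_prop)
    · filter_upwards [ψ.open_source.mem_nhds (ψ.map_target hst)] with x hx hFx
      have : G x = !₂[0, 0, θ x] := by simp [G, hFx]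
      change ψ.symm !₂[0, 0, θ x] = x
      rw [← this]; exact ψ.left_inv hx

/-- A positive function on an interval is the derivative of a change of parameter `S`, with
inverse `T`. -/
theorem exists_reparametrization {r : ℕ∞} {σ : ℝ → ℝ} {ε : ℝ} (hε : 0 < ε)
    (hσ : ContDiffOn ℝ r σ (Ioo (-ε) ε)) (hpos : ∀ u ∈ Ioo (-ε) ε, 0 < σ u) :
    ∃ (S T : ℝ → ℝ) (δ : ℝ), 0 < δ ∧ T 0 = 0 ∧ (∀ u ∈ Ioo (-ε) ε, HasDerivAt S (σ u) u) ∧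
      ∀ s, |s| < δ → T s ∈ Ioo (-ε) ε ∧ S (T s) = s ∧ ContDiffAt ℝ (r + 1 : ℕ∞) T s ∧
        ∀ᶠ u in 𝓝 (T s), T (S u) = u := by
  have hcont : ContinuousOn σ (Ioo (-ε) ε) := hσ.continuousOn
  have h0 : (0 : ℝ) ∈ Ioo (-ε) ε := ⟨by linarith, hε⟩
  let S : ℝ → ℝ := fun u => ∫ w in (0 : ℝ)..u, σ w
  have hS : ∀ u ∈ Ioo (-ε) ε, HasDerivAt S (σ u) u := fun u hu => by
    have hsub : uIcc 0 u ⊆ Ioo (-ε) ε := (ordConnected_Ioo).uIcc_subset h0 hu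
    exact intervalIntegral.integral_hasDerivAt_right (hcont.mono hsub).intervalIntegrable
      (hcont.stronglyMeasurableAtFilter isOpen_Ioo u hu) (hcont.continuousAt (isOpen_Ioo.mem_nhds hu))
  have hSC : ContDiffOn ℝ (r + 1 : ℕ∞) S (Ioo (-ε) ε) := by
    have : ((r + 1 : ℕ∞) : WithTop ℕ∞) = (r : WithTop ℕ∞) + 1 := by simp
    rw [this, contDiffOn_succ_iff_deriv_of_isOpen isOpen_Ioo]
    refine ⟨fun u hu => (hS u hu).differentiableAt.differentiableWithinAt, fun h => ?_, ?_⟩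
    · exact absurd h (by simp)
    · exact hσ.congr fun u hu => (hS u hu).deriv
  have hSAt : ∀ u ∈ Ioo (-ε) ε, ContDiffAt ℝ (r + 1 : ℕ∞) S u := fun u hu =>
    hSC.contDiffAt (isOpen_Ioo.mem_nhds hu)
  have hn : ((r + 1 : ℕ∞) : WithTop ℕ∞) ≠ 0 := by
    intro h
    have : (r + 1 : ℕ∞) = 0 := by exact_mod_cast h
    simp at this
  have hd0 := (hS 0 h0).hasFDerivAt_equiv (hpos 0 h0).ne'
  let ψ := ((hSAt 0 h0).toOpenPartialHomeomorph S hd0 hn).restrOpen (Ioo (-ε) ε) isOpen_Ioo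
  have hψs : (0 : ℝ) ∈ ψ.source := ⟨(hSAt 0 h0).mem_toOpenPartialHomeomorph_source hd0 hn, h0⟩
  have hS0 : S 0 = 0 := by simp [S]
  have ht0 : (0 : ℝ) ∈ ψ.target := by
    have := ψ.map_source hψs
    change S 0 ∈ _ at this
    rwa [hS0] at this
  obtain ⟨δ, hδ, hball⟩ := Metric.isOpen_iff.1 ψ.open_target 0 ht0
  refine ⟨S, ψ.symm, δ, hδ, ?_, hS, fun s hs => ?_⟩
  · have := ψ.left_inv hψs
    change ψ.symm (S 0) = 0 at this
    rwa [hS0] at this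
  · have hst : s ∈ ψ.target := hball (by simpa using hs)
    have hTs := ψ.map_target hst
    have hI : ψ.symm s ∈ Ioo (-ε) ε := hTs.2
    refine ⟨hI, ψ.right_inv hst, ?_, ?_⟩
    · exact ψ.contDiffAt_symm_deriv (hpos _ hI).ne' hst (hS _ hI) (hSAt _ hI)
    · filter_upwards [ψ.open_source.mem_nhds hTs] with u hu
      exact ψ.left_inv hu

/-! ### Sets which are locally regular arcs are links -/

section Arcs

variable {M : Type*} [TopologicalSpace M] [ChartedSpace E3 M]

/-- The curve `c`, restricted to `(-ε, ε)`, parametrizes an open subset of `L` and is of class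
`C^r`, and the function `θ` recovers its parameter. -/
structure IsRegularArc (r : ℕ∞) (L : Set M) (c : ℝ → M) (θ : M → ℝ) (ε : ℝ) : Prop where
  pos : 0 < ε
  mem : ∀ s, |s| < ε → c s ∈ L
  left_inv : ∀ s, |s| < ε → θ (c s) = s
  contMDiffAt : ∀ s, |s| < ε → ContMDiffAt 𝓘(ℝ, ℝ) (𝓡 3) r c s
  mdifferentiableAt : ∀ s, |s| < ε → MDifferentiableAt (𝓡 3) 𝓘(ℝ, ℝ) θ (c s)
  right_inv : ∀ s, |s| < ε → ∀ᶠ m in 𝓝 (c s), m ∈ L → c (θ m) = m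

theorem eventually_abs_lt {s ε : ℝ} (hs : |s| < ε) : ∀ᶠ u in 𝓝 s, |u| < ε :=
  continuous_abs.continuousAt.eventually (gt_mem_nhds hs)

theorem hasDerivAt_comp_of_mdifferentiableAt {E' : Type*} [NormedAddCommGroup E']
    [NormedSpace ℝ E'] {γ : ℝ → M} {Φ : M → E'} {t : ℝ}
    (hΦ : MDifferentiableAt (𝓡 3) 𝓘(ℝ, E') Φ (γ t))
    (hγ : MDifferentiableAt 𝓘(ℝ, ℝ) (𝓡 3) γ t) :
    HasDerivAt (Φ ∘ γ) (mfderiv (𝓡 3) 𝓘(ℝ, E') Φ (γ t) (mfderiv 𝓘(ℝ, ℝ) (𝓡 3) γ t (1 : ℝ)) : E')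
      t := by
  let A : E3 →L[ℝ] E' := mfderiv (𝓡 3) 𝓘(ℝ, E') Φ (γ t)
  let B : ℝ →L[ℝ] E3 := mfderiv 𝓘(ℝ, ℝ) (𝓡 3) γ t
  have h : HasFDerivAt (Φ ∘ γ) (A.comp B) t :=
    (hΦ.hasMFDerivAt.comp t hγ.hasMFDerivAt).hasFDerivAt
  exact h.hasDerivAt

/-- A curve along which some function has nonzero derivative is regular. -/
theorem mfderiv_ne_zero_of_comp {γ : ℝ → M} {θ : M → ℝ} {t a : ℝ}
    (hθ : MDifferentiableAt (𝓡 3) 𝓘(ℝ, ℝ) θ (γ t))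
    (hγ : MDifferentiableAt 𝓘(ℝ, ℝ) (𝓡 3) γ t) (h : HasDerivAt (θ ∘ γ) a t) (ha : a ≠ 0) :
    mfderiv 𝓘(ℝ, ℝ) (𝓡 3) γ t (1 : ℝ) ≠ 0 := by
  intro h0
  have h1 := (hasDerivAt_comp_of_mdifferentiableAt hθ hγ).unique h
  rw [h0] at h1
  erw [map_zero] at h1
  exact ha h1.symm

namespace IsRegularArc

variable {r : ℕ∞} {L : Set M} {c : ℝ → M} {θ : M → ℝ} {ε : ℝ}

theorem mdifferentiableAt_arc (hr : 1 ≤ r) (h : IsRegularArc r L c θ ε) {s : ℝ} (hs : |s| < ε) :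
    MDifferentiableAt 𝓘(ℝ, ℝ) (𝓡 3) c s :=
  (h.contMDiffAt s hs).mdifferentiableAt (by
    intro h0
    have : r = 0 := by exact_mod_cast h0
    simp [this] at hr)

theorem mfderiv_ne_zero (hr : 1 ≤ r) (h : IsRegularArc r L c θ ε) {s : ℝ} (hs : |s| < ε) :
    mfderiv 𝓘(ℝ, ℝ) (𝓡 3) c s (1 : ℝ) ≠ 0 := by
  refine mfderiv_ne_zero_of_comp (h.mdifferentiableAt s hs) (h.mdifferentiableAt_arc hr hs)
    (a := 1) ?_ one_ne_zero
  refine (hasDerivAt_id s).congr_of_eventuallyEq ?_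
  filter_upwards [eventually_abs_lt hs] with u hu
  exact h.left_inv u hu

/-- The parameter of an arc is continuous at its points. -/
theorem tendsto_param (h : IsRegularArc r L c θ ε) {s : ℝ} (hs : |s| < ε) :
    Tendsto θ (𝓝 (c s)) (𝓝 s) := by
  have := (h.mdifferentiableAt s hs).continuousAt
  rwa [ContinuousAt, h.left_inv s hs] at this

variable {E' : Type*} [NormedAddCommGroup E'] [InnerProductSpace ℝ E'] {Φ : M → E'}

/-- Parametrization of a regular arc by its arc length in an immersion of `M`. -/
theorem exists_unit_speed (hr : 1 ≤ r) (h : IsRegularArc r L c θ ε)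
    (hΦ : ContMDiff (𝓡 3) 𝓘(ℝ, E') ∞ Φ)
    (hinj : ∀ p, Function.Injective (mfderiv (𝓡 3) 𝓘(ℝ, E') Φ p)) :
    ∃ c' θ' ε', IsRegularArc r L c' θ' ε' ∧ c' 0 = c 0 ∧
      ∀ s, |s| < ε' → ‖deriv (Φ ∘ c') s‖ = 1 := by
  obtain ⟨r', rfl⟩ : ∃ r', r = r' + 1 := le_iff_exists_add'.1 hr
  have hΦd : ∀ p, MDifferentiableAt (𝓡 3) 𝓘(ℝ, E') Φ p := fun p =>
    hΦ.contMDiffAt.mdifferentiableAt (by simp)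
  have habs : ∀ {u}, u ∈ Ioo (-ε) ε ↔ |u| < ε := abs_lt.symm
  have hder : ∀ u, |u| < ε → HasDerivAt (Φ ∘ c) (deriv (Φ ∘ c) u) u := fun u hu =>
    (hasDerivAt_comp_of_mdifferentiableAt (hΦd _)
      (h.mdifferentiableAt_arc hr hu)).differentiableAt.hasDerivAt
  have hne : ∀ u, |u| < ε → deriv (Φ ∘ c) u ≠ 0 := fun u hu h0 => by
    rw [(hasDerivAt_comp_of_mdifferentiableAt (hΦd _) (h.mdifferentiableAt_arc hr hu)).deriv] at h0
    refine h.mfderiv_ne_zero hr hu (hinj _ (h0.trans ?_))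
    exact (map_zero (mfderiv (𝓡 3) 𝓘(ℝ, E') Φ (c u))).symm
  have hC : ContDiffOn ℝ r' (deriv (Φ ∘ c)) (Ioo (-ε) ε) := by
    have h1 : ContDiffOn ℝ (r' + 1 : ℕ∞) (Φ ∘ c) (Ioo (-ε) ε) := fun u hu =>
      (contMDiffAt_iff_contDiffAt.1 ((hΦ.of_le (by exact_mod_cast le_top)).contMDiffAt.comp u
        (h.contMDiffAt u (habs.1 hu)))).contDiffWithinAt
    have : ((r' + 1 : ℕ∞) : WithTop ℕ∞) = (r' : WithTop ℕ∞) + 1 := by simp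
    rw [this, contDiffOn_succ_iff_deriv_of_isOpen isOpen_Ioo] at h1
    exact h1.2.2
  obtain ⟨S, T, δ, hδ, hT0, hS, hT⟩ := exists_reparametrization (σ := fun u => ‖deriv (Φ ∘ c) u‖)
    h.pos (fun u hu => ((hC.contDiffAt (isOpen_Ioo.mem_nhds hu)).norm ℝ
      (hne u (habs.1 hu))).contDiffWithinAt) (fun u hu => norm_pos_iff.2 (hne u (habs.1 hu)))
  have hTε : ∀ s, |s| < δ → |T s| < ε := fun s hs => habs.1 (hT s hs).1
  refine ⟨c ∘ T, S ∘ θ, δ, ⟨hδ, fun s hs => h.mem _ (hTε s hs), fun s hs => ?_, fun s hs => ?_,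
    fun s hs => ?_, fun s hs => ?_⟩, by simp [hT0], fun s hs => ?_⟩
  · simp only [Function.comp, h.left_inv _ (hTε s hs), (hT s hs).2.1]
  · exact (h.contMDiffAt _ (hTε s hs)).comp s (contMDiffAt_iff_contDiffAt.2 (hT s hs).2.2.1)
  · have h1 := (hS _ (hT s hs).1).differentiableAt.mdifferentiableAt
    rw [← h.left_inv _ (hTε s hs)] at h1
    exact MDifferentiableAt.comp (c (T s)) h1 (h.mdifferentiableAt _ (hTε s hs))
  · filter_upwards [h.right_inv _ (hTε s hs), (h.tendsto_param (hTε s hs)).eventually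
      (hT s hs).2.2.2] with m h1 h2 hm
    simp only [Function.comp, h2, h1 hm]
  · have hTd : HasDerivAt T (deriv T s) s :=
      ((hT s hs).2.2.1.differentiableAt (by simp)).hasDerivAt
    have h1 : HasDerivAt (S ∘ T) (‖deriv (Φ ∘ c) (T s)‖ * deriv T s) s :=
      (hS _ (hT s hs).1).comp s hTd
    have h2 : HasDerivAt (S ∘ T) 1 s := by
      refine (hasDerivAt_id s).congr_of_eventuallyEq ?_
      filter_upwards [eventually_abs_lt hs] with u hu
      exact (hT u hu).2.1
    have h3 := h1.unique h2
    have h4 : HasDerivAt (Φ ∘ c ∘ T) (deriv T s • deriv (Φ ∘ c) (T s)) s :=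
      (hder _ (hTε s hs)).scomp s hTd
    have h5 : deriv (Φ ∘ (c ∘ T)) s = deriv T s • deriv (Φ ∘ c) (T s) := h4.deriv
    rw [h5, norm_smul, Real.norm_eq_abs, ← abs_norm (deriv (Φ ∘ c) (T s)), ← abs_mul, mul_comm, h3,
      abs_one]

/-- Two arcs parametrized by arc length agree near a common point up to translation and reflection
of the parameter. -/
theorem exists_sign (hr : 1 ≤ r) {d : ℝ → M} {θ' : M → ℝ} {ε' : ℝ} (h : IsRegularArc r L c θ ε)
    (h' : IsRegularArc r L d θ' ε') (hΦ : ContMDiff (𝓡 3) 𝓘(ℝ, E') ∞ Φ)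
    (hc : ∀ s, |s| < ε → ‖deriv (Φ ∘ c) s‖ = 1) (hd : ∀ s, |s| < ε' → ‖deriv (Φ ∘ d) s‖ = 1)
    {s t : ℝ} (hs : |s| < ε) (ht : |t| < ε') (hst : c s = d t) :
    ∃ e : ℝ, (e = 1 ∨ e = -1) ∧ ∀ᶠ u in 𝓝 (0 : ℝ), c (s + u) = d (t + e * u) := by
  have hΦd : ∀ p, MDifferentiableAt (𝓡 3) 𝓘(ℝ, E') Φ p := fun p =>
    hΦ.contMDiffAt.mdifferentiableAt (by simp)
  let τ : ℝ → ℝ := fun u => θ' (c (s + u))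
  have hτ0 : τ 0 = t := by simp only [τ, add_zero, hst, h'.left_inv t ht]
  have hshift : Tendsto (fun u => s + u) (𝓝 0) (𝓝 s) := by
    have : ContinuousAt (fun u => s + u) 0 := by fun_prop
    simpa [ContinuousAt] using this
  have hcs : Tendsto (fun u => c (s + u)) (𝓝 0) (𝓝 (d t)) := by
    rw [← hst]; exact (h.contMDiffAt s hs).continuousAt.tendsto.comp hshift
  have hτ : Tendsto τ (𝓝 0) (𝓝 t) := (h'.tendsto_param ht).comp hcs
  have hev : ∀ᶠ u in 𝓝 (0 : ℝ), |s + u| < ε ∧ |τ u| < ε' ∧ d (τ u) = c (s + u) := by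
    filter_upwards [hshift.eventually (eventually_abs_lt hs), hτ.eventually (eventually_abs_lt ht),
      hcs.eventually (h'.right_inv t ht)] with u h1 h2 h3
    exact ⟨h1, h2, h3 (h.mem _ h1)⟩
  obtain ⟨ρ, hρ, hball⟩ := Metric.eventually_nhds_iff_ball.1 hev
  have hτd : ∀ u ∈ Metric.ball (0 : ℝ) ρ, HasDerivAt τ (deriv τ u) u := by
    intro u hu
    obtain ⟨h1, h2, h3⟩ := hball u hu
    have h4 := h'.mdifferentiableAt _ h2
    rw [h3] at h4
    have h5 := (hasDerivAt_comp_of_mdifferentiableAt h4 (h.mdifferentiableAt_arc hr h1))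
    exact (h5.comp_const_add s u).differentiableAt.hasDerivAt
  -- the transition between the two parameters preserves the speed, so it has derivative `±1`
  have hτabs : ∀ u ∈ Metric.ball (0 : ℝ) ρ, |deriv τ u| = 1 := by
    intro u hu
    obtain ⟨h1, h2, h3⟩ := hball u hu
    have e1 : HasDerivAt (fun v => (Φ ∘ c) (s + v)) (deriv (Φ ∘ c) (s + u)) u :=
      (hasDerivAt_comp_of_mdifferentiableAt (hΦd _)
        (h.mdifferentiableAt_arc hr h1)).differentiableAt.hasDerivAt.comp_const_add s u
    have e2 : HasDerivAt ((Φ ∘ d) ∘ τ) (deriv τ u • deriv (Φ ∘ d) (τ u)) u :=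
      (hasDerivAt_comp_of_mdifferentiableAt (hΦd _)
        (h'.mdifferentiableAt_arc hr h2)).differentiableAt.hasDerivAt.scomp u (hτd u hu)
    have e3 : (fun v => (Φ ∘ c) (s + v)) =ᶠ[𝓝 u] (Φ ∘ d) ∘ τ := by
      filter_upwards [Metric.isOpen_ball.mem_nhds hu] with v hv
      simp only [Function.comp, (hball v hv).2.2]
    have e4 := congrArg norm (e1.unique (e2.congr_of_eventuallyEq e3))
    rw [hc _ h1, norm_smul, hd _ h2, mul_one] at e4
    exact e4.symm
  obtain ⟨e, he, hee⟩ : ∃ e : ℝ, (e = 1 ∨ e = -1) ∧ ∀ u ∈ Metric.ball (0 : ℝ) ρ,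
      deriv τ u = e := by
    rcases hasDerivWithinAt_forall_lt_or_forall_gt_of_forall_ne (convex_ball (0 : ℝ) ρ)
      (fun u hu => (hτd u hu).hasDerivWithinAt) (m := 0)
      (fun u hu h0 => by have := hτabs u hu; simp [h0] at this) with hl | hl
    · refine ⟨-1, Or.inr rfl, fun u hu => ?_⟩
      have := hτabs u hu
      rw [abs_of_neg (hl u hu)] at this; linarith
    · refine ⟨1, Or.inl rfl, fun u hu => ?_⟩
      have := hτabs u hu
      rwa [abs_of_pos (hl u hu)] at this
  refine ⟨e, he, ?_⟩
  filter_upwards [Metric.ball_mem_nhds (0 : ℝ) hρ] with u hu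
  have hder : ∀ v ∈ Metric.ball (0 : ℝ) ρ, HasDerivAt (fun v => τ v - e * v) 0 v := by
    intro v hv
    have : HasDerivAt (fun v => τ v - e * v) _ v :=
      (hτd v hv).sub ((hasDerivAt_id v).const_mul e)
    exact this.congr_deriv (by rw [hee v hv]; simp)
  have hconst := Metric.isOpen_ball.is_const_of_deriv_eq_zero
    (convex_ball (0 : ℝ) ρ).isPreconnected
    (fun v hv => (hder v hv).differentiableAt.differentiableWithinAt)
    (fun v hv => (hder v hv).deriv) hu (Metric.mem_ball_self hρ)
  simp only [hτ0, mul_zero, sub_zero] at hconst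
  rw [← (hball u hu).2.2, ← hconst]
  congr 1; ring

end IsRegularArc

variable [IsManifold (𝓡 3) ∞ M]

/-- A compact set which is a regular arc near each of its points is a link. -/
theorem exists_isLink [T2Space M] [CompactSpace M] {r : ℕ∞} (hr : 1 ≤ r) {L : Set M}
    (hL : IsCompact L)
    (harc : ∀ p ∈ L, ∃ c θ ε, IsRegularArc r L c θ ε ∧ c 0 = p) :
    ∃ (n : ℕ) (γ : Fin n → ℝ → M), IsLink r L γ := by
  classical
  -- arc length is measured in a Euclidean embedding of the manifold
  obtain ⟨N, Φ, hΦ, -, hinj⟩ := exists_embedding_euclidean_of_compact (I := 𝓡 3) (M := M)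
  have harc' : ∀ p : L, ∃ c θ ε, IsRegularArc r L c θ ε ∧ c 0 = p ∧
      ∀ s, |s| < ε → ‖deriv (Φ ∘ c) s‖ = 1 := by
    rintro ⟨p, hp⟩
    obtain ⟨c, θ, ε, h, h0⟩ := harc p hp
    obtain ⟨c', θ', ε', h', h0', hsp⟩ := h.exists_unit_speed hr hΦ hinj
    exact ⟨c', θ', ε', h', h0'.trans h0, hsp⟩
  choose c θ ε hreg h0 hspeed using harc'
  have hval : ∀ (p : L) (s : ℝ), |s| < ε p →
      ((if h : c p s ∈ L then ⟨c p s, h⟩ else p : L) : M) = c p s := fun p s hs => by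
    rw [dif_pos ((hreg p).mem s hs)]
  let 𝒮 : RigidArcs L :=
    { rad := ε
      arc := fun p s => if h : c p s ∈ L then ⟨c p s, h⟩ else p
      rad_pos := fun p => (hreg p).pos
      arc_zero := fun p => Subtype.ext (by
        rw [hval p 0 (by simpa using (hreg p).pos), h0])
      cont := fun p s hs => by
        rw [Topology.IsInducing.subtypeVal.continuousAt_iff]
        refine ((hreg p).contMDiffAt s hs).continuousAt.congr ?_
        filter_upwards [eventually_abs_lt hs] with u hu
        exact (hval p u hu).symm
      inj := fun p s t hs ht hst => by
        have := congrArg Subtype.val hst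
        rw [hval p s hs, hval p t ht] at this
        rw [← (hreg p).left_inv s hs, this, (hreg p).left_inv t ht]
      isOpen_image := fun p s hs U hU => by
        rw [nhds_subtype_eq_comap, hval p s hs]
        refine mem_comap.2 ⟨{m | (m ∈ L → c p (θ p m) = m) ∧ θ p m ∈ U ∧ |θ p m| < ε p}, ?_, ?_⟩
        · filter_upwards [(hreg p).right_inv s hs, (hreg p).tendsto_param hs hU,
            ((hreg p).tendsto_param hs).eventually (eventually_abs_lt hs)] with m h1 h2 h3
          exact ⟨h1, h2, h3⟩
        · rintro ⟨m, hm⟩ ⟨h1, h2, h3⟩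
          exact ⟨θ p m, h2, Subtype.ext ((hval p _ h3).trans (h1 hm))⟩
      compat := fun p q s t hs ht hst => by
        have := congrArg Subtype.val hst
        rw [hval p s hs, hval q t ht] at this
        obtain ⟨e, he, hu⟩ := (hreg p).exists_sign hr (hreg q) hΦ (hspeed p) (hspeed q) hs ht this
        refine ⟨e, he, ?_⟩
        have hs' : ∀ᶠ u in 𝓝 (0 : ℝ), |s + u| < ε p :=
          RigidArcs.eventually_shift.2 (eventually_abs_lt hs)
        have ht' : ∀ᶠ u in 𝓝 (0 : ℝ), |t + e * u| < ε q :=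
          RigidArcs.tendsto_sign_mul.eventually
            (RigidArcs.eventually_shift.2 (eventually_abs_lt ht))
        filter_upwards [hu, hs', ht'] with u h1 h2 h3
        exact Subtype.ext ((hval p _ h2).trans (h1.trans (hval q _ h3).symm)) }
  have : CompactSpace L := isCompact_iff_compactSpace.1 hL
  obtain ⟨n, γ, T, hT, hgeo, hper, hmod, hdisj, hcov⟩ := 𝒮.exists_circles
  -- the circles are regular curves of class `C^r`
  have hγ : ∀ i t, ContMDiffAt 𝓘(ℝ, ℝ) (𝓡 3) r (fun t => (γ i t : M)) t ∧
      ∃ (θ : M → ℝ) (e : ℝ), e ≠ 0 ∧ MDifferentiableAt (𝓡 3) 𝓘(ℝ, ℝ) θ (γ i t) ∧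
        HasDerivAt (fun t => θ (γ i t)) e t := by
    intro i t
    obtain ⟨p, s, e, hs, he, hu⟩ := hgeo i t
    have he0 : e ≠ 0 := by rcases he with rfl | rfl <;> simp
    have hloc : ∀ᶠ w in 𝓝 t, (γ i w : M) = c p (s + e * (w - t)) ∧ |s + e * (w - t)| < ε p := by
      refine RigidArcs.eventually_shift.1 ?_
      filter_upwards [hu, RigidArcs.tendsto_sign_mul.eventually
        (RigidArcs.eventually_shift.2 (eventually_abs_lt hs))] with u h1 h2
      rw [add_sub_cancel_left, h1]
      exact ⟨hval p _ h2, h2⟩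
    have hst : s + e * (t - t) = s := by ring
    have h1 : ContMDiffAt 𝓘(ℝ, ℝ) 𝓘(ℝ, ℝ) r (fun w => s + e * (w - t)) t :=
      contMDiffAt_iff_contDiffAt.2 (by fun_prop)
    refine ⟨?_, θ p, e, he0, ?_, ?_⟩
    · have h2 : ContMDiffAt 𝓘(ℝ, ℝ) (𝓡 3) r (c p) (s + e * (t - t)) := by
        rw [hst]; exact (hreg p).contMDiffAt s hs
      exact (ContMDiffAt.comp t h2 h1).congr_of_eventuallyEq (hloc.mono fun w hw => hw.1)
    · rw [hloc.self_of_nhds.1]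
      exact (hreg p).mdifferentiableAt _ hloc.self_of_nhds.2
    · have h2 : HasDerivAt (fun w => s + e * (w - t)) e t := by
        simpa using (((hasDerivAt_id t).sub_const t).const_mul e).const_add s
      refine h2.congr_of_eventuallyEq ?_
      filter_upwards [hloc] with w hw
      rw [hw.1, (hreg p).left_inv _ hw.2]
  have hr0 : (r : WithTop ℕ∞) ≠ 0 := by
    intro h0
    have : r = 0 := by exact_mod_cast h0
    simp [this] at hr
  have hrange : ∀ i, range (fun t => (γ i (T i * t) : M)) = Subtype.val '' range (γ i) := by
    intro i
    ext m
    constructor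
    · rintro ⟨t, rfl⟩
      exact ⟨_, ⟨T i * t, rfl⟩, rfl⟩
    · rintro ⟨_, ⟨t, rfl⟩, rfl⟩
      refine ⟨t / T i, ?_⟩
      simp only
      rw [mul_div_cancel₀ _ (hT i).ne']
  refine ⟨n, fun i t => (γ i (T i * t) : M), ⟨fun i => ⟨fun t => ?_, fun t => ?_, ?_, fun t => ?_⟩,
    fun i j hij => ?_, ?_⟩⟩
  · exact ContMDiffAt.comp (g := fun t => (γ i t : M)) t (hγ i (T i * t)).1
      (contMDiffAt_iff_contDiffAt.2 (by fun_prop))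
  · simp only [mul_add, mul_one, hper i (T i * t)]
  · intro s t hst
    obtain ⟨m, hm⟩ := hmod i _ _ (Subtype.ext hst)
    refine ⟨m, ?_⟩
    exact mul_left_cancel₀ (hT i).ne' (by rw [hm]; ring)
  · obtain ⟨θ', e, he, hθ, hd⟩ := (hγ i (T i * t)).2
    have h1 : HasDerivAt (fun t => T i * t) (T i) t := by
      simpa using (hasDerivAt_id t).const_mul (T i)
    refine mfderiv_ne_zero_of_comp (γ := fun t => (γ i (T i * t) : M)) hθ ?_ (hd.comp t h1)
      (mul_ne_zero he (hT i).ne')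
    exact (ContMDiffAt.comp (g := fun t => (γ i t : M)) t (hγ i (T i * t)).1
      (contMDiffAt_iff_contDiffAt.2 (by fun_prop))).mdifferentiableAt hr0
  · simp only [hrange]
    exact (disjoint_image_iff Subtype.val_injective).2 (hdisj hij)
  · simp only [hrange, ← image_iUnion, hcov, image_univ, Subtype.range_coe]

end Arcs

/-! ### The linearization in charts -/

section Linearization

variable {M : Type*} [TopologicalSpace M] [ChartedSpace E3 M]
  {φ ψ : OpenPartialHomeomorph M E3}

theorem fderiv_transition (hφ : φ ∈ IsManifold.maximalAtlas (𝓡 3) ∞ M)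
    (hψ : ψ ∈ IsManifold.maximalAtlas (𝓡 3) ∞ M) {x : E3} (hx : x ∈ φ.target)
    (hxψ : φ.symm x ∈ ψ.source) (v : E3) : fderiv ℝ (ψ ∘ φ.symm) x v =
      chartDeriv hψ hxψ ((chartDeriv hφ (φ.map_target hx)).symm v) := by
  have h1 : mfderiv (𝓡 3) (𝓡 3) (ψ ∘ φ.symm) x = _ := mfderiv_comp x
    ((contMDiffAt_chart hψ hxψ).mdifferentiableAt (by simp))
    ((contMDiffAt_chart_symm hφ hx).mdifferentiableAt (by simp))
  rw [mfderiv_eq_fderiv, mfderiv_chart_symm_eq hφ hx] at h1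
  exact DFunLike.congr_fun h1 v

theorem chartRep_transition (hφ : φ ∈ IsManifold.maximalAtlas (𝓡 3) ∞ M)
    (hψ : ψ ∈ IsManifold.maximalAtlas (𝓡 3) ∞ M) {x : E3} (hx : x ∈ φ.target)
    (hxψ : φ.symm x ∈ ψ.source) (X : ∀ p : M, TangentSpace (𝓡 3) p) :
    chartRep ψ X ((ψ ∘ φ.symm) x) = fderiv ℝ (ψ ∘ φ.symm) x (chartRep φ X x) := by
  have h1 := chartRep_apply hφ (φ.map_target hx) X
  rw [φ.right_inv hx] at h1
  rw [fderiv_transition hφ hψ hx hxψ, Function.comp, chartRep_apply hψ hxψ, h1,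
    ContinuousLinearEquiv.symm_apply_apply]

/-- The derivative at a zero of a vector field is conjugated by a change of coordinates. -/
theorem fderiv_conj_of_transition {κ Y Z : E3 → E3} {x : E3} (hκ : ContDiffAt ℝ 2 κ x)
    (hY : DifferentiableAt ℝ Y x) (hZ : DifferentiableAt ℝ Z (κ x)) (h0 : Y x = 0)
    (h : ∀ᶠ y in 𝓝 x, Z (κ y) = fderiv ℝ κ y (Y y)) (v : E3) :
    fderiv ℝ Z (κ x) (fderiv ℝ κ x v) = fderiv ℝ κ x (fderiv ℝ Y x v) := by
  have h1 : HasFDerivAt (fun y => Z (κ y)) _ x :=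
    hZ.hasFDerivAt.comp x (hκ.differentiableAt (by norm_num)).hasFDerivAt
  have h2 : DifferentiableAt ℝ (fderiv ℝ κ) x :=
    (hκ.fderiv_right (m := 1) (by norm_num)).differentiableAt (by norm_num)
  have h3 := (h2.hasFDerivAt.clm_apply hY.hasFDerivAt).congr_of_eventuallyEq h
  have h4 := DFunLike.congr_fun (h1.unique h3) v
  simpa [h0] using h4

variable [IsManifold (𝓡 3) ∞ M] {r : ℕ∞} {η : PlaneField r M}

theorem PlaneField.Sections.differentiableAt_chartRep (hr : 1 ≤ r) (X : η.Sections)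
    (hφ : φ ∈ IsManifold.maximalAtlas (𝓡 3) ∞ M) {x : E3} (hx : x ∈ φ.target) :
    DifferentiableAt ℝ (chartRep φ X.field) x :=
  ((X.contDiffAt_chartRep hφ hx).of_le (m := 1) (by exact_mod_cast hr)).differentiableAt
    (by norm_num)

/-- The linearization at a zero can be computed in any chart. -/
theorem chartDeriv_linearization (hr : 1 ≤ r) (X : η.Sections)
    (hφ : φ ∈ IsManifold.maximalAtlas (𝓡 3) ∞ M) {p : M} (hp : p ∈ φ.source)
    (h0 : X.field p = 0) (v : TangentSpace (𝓡 3) p) :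
    chartDeriv hφ hp (linearization X.field p v) =
      fderiv ℝ (chartRep φ X.field) (φ p) (chartDeriv hφ hp v) := by
  set ψ := chartAt E3 p
  have hψ : ψ ∈ IsManifold.maximalAtlas (𝓡 3) ∞ M := IsManifold.chart_mem_maximalAtlas p
  have hpψ : p ∈ ψ.source := mem_chart_source E3 p
  have hx : ψ p ∈ ψ.target := ψ.map_source hpψ
  have hlin : linearization X.field p v = (chartDeriv hψ hpψ).symm
      (fderiv ℝ (chartRep ψ X.field) (ψ p) (chartDeriv hψ hpψ v)) := by
    have hinv : (mfderiv (𝓡 3) (𝓡 3) ψ p : TangentSpace (𝓡 3) p →L[ℝ] E3).inverse =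
        ((chartDeriv hψ hpψ).symm : E3 →L[ℝ] TangentSpace (𝓡 3) p) :=
      ContinuousLinearMap.inverse_equiv (chartDeriv hψ hpψ)
    exact DFunLike.congr_fun hinv (fderiv ℝ (chartRep ψ X.field) (ψ p) (chartDeriv hψ hpψ v))
  have hxφ : ψ.symm (ψ p) ∈ φ.source := by rwa [ψ.left_inv hpψ]
  have hκp : (φ ∘ ψ.symm) (ψ p) = φ p := by simp [ψ.left_inv hpψ]
  have hκ : ContDiffAt ℝ 2 (φ ∘ ψ.symm) (ψ p) := by
    refine ContDiffAt.of_le (contMDiffAt_iff_contDiffAt.1 (ContMDiffAt.comp (ψ p)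
      (contMDiffAt_chart hφ hxφ) (contMDiffAt_chart_symm hψ hx))) ?_
    norm_cast
  have hev : ∀ᶠ y in 𝓝 (ψ p), chartRep φ X.field ((φ ∘ ψ.symm) y) =
      fderiv ℝ (φ ∘ ψ.symm) y (chartRep ψ X.field y) := by
    filter_upwards [ψ.open_target.mem_nhds hx, (ψ.continuousAt_symm hx).eventually
      (φ.open_source.mem_nhds hxφ)] with y hy hyφ
    exact chartRep_transition hψ hφ hy hyφ X.field
  have hd : ∀ w : TangentSpace (𝓡 3) p, fderiv ℝ (φ ∘ ψ.symm) (ψ p) (chartDeriv hψ hpψ w) =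
      chartDeriv hφ hp w := by
    have aux : ∀ q (hq : q ∈ ψ.source) (hqφ : q ∈ φ.source), q = p →
        ∀ w : E3, chartDeriv hφ hqφ ((chartDeriv hψ hq).symm w) =
          chartDeriv hφ hp ((chartDeriv hψ hpψ).symm w) := by
      rintro q hq hqφ rfl w; rfl
    intro w
    rw [fderiv_transition hψ hφ hx hxφ, aux _ _ _ (ψ.left_inv hpψ),
      ContinuousLinearEquiv.symm_apply_apply]
  have hz : chartRep ψ X.field (ψ p) = 0 := (chartRep_eq_zero_iff hψ hpψ X.field).2 h0
  have h1 := fderiv_conj_of_transition hκ (X.differentiableAt_chartRep hr hψ hx)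
    (by rw [hκp]; exact X.differentiableAt_chartRep hr hφ (φ.map_source hp)) hz hev
    (chartDeriv hψ hpψ v)
  rw [hκp, hd] at h1
  rw [h1, hlin, ← hd, ContinuousLinearEquiv.apply_symm_apply]

variable {A : E3 → Fin 2 → ℝ}

theorem IsSlopes.chartRep_two (hA : IsSlopes η φ A)
    (hφ : φ ∈ IsManifold.maximalAtlas (𝓡 3) ∞ M) (X : η.Sections) {x : E3} (hx : x ∈ φ.target) :
    chartRep φ X.field x 2 =
      A x 0 * comps φ X.field 0 x + A x 1 * comps φ X.field 1 x := by
  have h1 := (hA.2 _ (φ.map_target hx) _).1 (X.2 (φ.symm x))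
  have h2 := chartRep_apply hφ (φ.map_target hx) X.field
  rw [φ.right_inv hx] at h1 h2
  unfold comps
  rw [h2]
  exact h1

/-- The third component is determined by the first two, so a section vanishes where these do. -/
theorem comps_eq_zero_iff (hA : IsSlopes η φ A) (hφ : φ ∈ IsManifold.maximalAtlas (𝓡 3) ∞ M)
    (X : η.Sections) {p : M} (hp : p ∈ φ.source) :
    (∀ c, comps φ X.field c (φ p) = 0) ↔ X.field p = 0 := by
  rw [← chartRep_eq_zero_iff hφ hp]
  constructor
  · intro h
    have h2 := hA.chartRep_two hφ X (φ.map_source hp)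
    rw [h 0, h 1] at h2
    ext i
    fin_cases i
    · exact h 0
    · exact h 1
    · simpa using h2
  · intro h c
    simp only [comps, h]; rfl

theorem comps_contDiffAt (X : η.Sections) (hφ : φ ∈ IsManifold.maximalAtlas (𝓡 3) ∞ M) {x : E3}
    (hx : x ∈ φ.target) (c : Fin 2) : ContDiffAt ℝ r (comps φ X.field c) x := by
  have := X.contDiffAt_chartRep hφ hx
  unfold comps; fun_prop

theorem fderiv_comps (hr : 1 ≤ r) (X : η.Sections)
    (hφ : φ ∈ IsManifold.maximalAtlas (𝓡 3) ∞ M) {x : E3} (hx : x ∈ φ.target) (c : Fin 2)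
    (v : E3) : fderiv ℝ (comps φ X.field c) x v = fderiv ℝ (chartRep φ X.field) x v c.castSucc := by
  have h1 : HasFDerivAt (comps φ X.field c) ((EuclideanSpace.proj c.castSucc : E3 →L[ℝ] ℝ).comp
      (fderiv ℝ (chartRep φ X.field) x)) x :=
    (EuclideanSpace.proj c.castSucc : E3 →L[ℝ] ℝ).hasFDerivAt.comp x
      (X.differentiableAt_chartRep hr hφ hx).hasFDerivAt
  rw [h1.fderiv]; rfl

/-- At a zero, the derivative of the coordinate expression takes values in the plane field. -/
theorem IsSlopes.fderiv_chartRep_two (hr : 1 ≤ r) (hA : IsSlopes η φ A)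
    (hφ : φ ∈ IsManifold.maximalAtlas (𝓡 3) ∞ M) (X : η.Sections) {p : M} (hp : p ∈ φ.source)
    (h0 : X.field p = 0) (v : E3) :
    fderiv ℝ (chartRep φ X.field) (φ p) v 2 =
      A (φ p) 0 * fderiv ℝ (chartRep φ X.field) (φ p) v 0 +
        A (φ p) 1 * fderiv ℝ (chartRep φ X.field) (φ p) v 1 := by
  have hx := φ.map_source hp
  have hz := (comps_eq_zero_iff hA hφ X hp).2 h0
  have hr0 : (r : WithTop ℕ∞) ≠ 0 := by
    intro h
    have : r = 0 := by exact_mod_cast h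
    simp [this] at hr
  have h1 : HasFDerivAt (fun x => chartRep φ X.field x 2)
      ((EuclideanSpace.proj 2 : E3 →L[ℝ] ℝ).comp (fderiv ℝ (chartRep φ X.field) (φ p))) (φ p) :=
    (EuclideanSpace.proj 2 : E3 →L[ℝ] ℝ).hasFDerivAt.comp (φ p)
      (X.differentiableAt_chartRep hr hφ hx).hasFDerivAt
  have hAd : ∀ d, DifferentiableAt ℝ (fun x => A x d) (φ p) := fun d =>
    (contDiffAt_pi.1 (hA.1.contDiffAt (φ.open_target.mem_nhds hx)) d).differentiableAt hr0
  have hcd : ∀ c, DifferentiableAt ℝ (comps φ X.field c) (φ p) := fun c =>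
    (comps_contDiffAt X hφ hx c).differentiableAt hr0
  have h2 := (((hAd 0).hasFDerivAt.mul (hcd 0).hasFDerivAt).add
    ((hAd 1).hasFDerivAt.mul (hcd 1).hasFDerivAt)).congr_of_eventuallyEq
    (f₁ := fun x => chartRep φ X.field x 2) (by
      filter_upwards [φ.open_target.mem_nhds hx] with y hy
      exact hA.chartRep_two hφ X hy)
  have h3 := DFunLike.congr_fun (h1.unique h2) v
  simp only [hz, zero_smul, add_zero, add_apply, smul_apply,
    fderiv_comps hr X hφ hx, smul_eq_mul] at h3
  exact h3

/-- The derivative of the coordinate expression annihilates the velocity of a curve of zeros. -/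
theorem fderiv_comps_velocity (hr : 1 ≤ r) (X : η.Sections)
    (hφ : φ ∈ IsManifold.maximalAtlas (𝓡 3) ∞ M) {γ : ℝ → M} {t : ℝ}
    (hγ0 : ∀ s, X.field (γ s) = 0) (hγ : MDifferentiableAt 𝓘(ℝ, ℝ) (𝓡 3) γ t)
    (hp : γ t ∈ φ.source) :
    fderiv ℝ (chartRep φ X.field) (φ (γ t))
      (chartDeriv hφ hp (mfderiv 𝓘(ℝ, ℝ) (𝓡 3) γ t (1 : ℝ))) = 0 := by
  have h1 : HasDerivAt (φ ∘ γ) _ t := hasDerivAt_comp_of_mdifferentiableAt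
    ((contMDiffAt_chart hφ hp).mdifferentiableAt (by simp)) hγ
  have h2 := (X.differentiableAt_chartRep hr hφ (φ.map_source hp)).hasFDerivAt.comp_hasDerivAt t h1
  have h3 : HasDerivAt (chartRep φ X.field ∘ φ ∘ γ) 0 t := by
    refine (hasDerivAt_const t (0 : E3)).congr_of_eventuallyEq ?_
    filter_upwards [hγ.continuousAt.eventually (φ.open_source.mem_nhds hp)] with s hs
    exact (chartRep_eq_zero_iff hφ hs X.field).2 (hγ0 s)
  exact h2.unique h3

/-- A vector annihilated by both differentials is a multiple of any nonzero such vector. -/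
theorem exists_smul_eq_of_ker_ne_zero {F : Fin 2 → E3 → ℝ} {x : E3}
    (hk : (jetAt A F x).ker ≠ 0) {w v : E3} (hw0 : w ≠ 0) (hw : ∀ c, fderiv ℝ (F c) x w = 0)
    (hv : ∀ c, fderiv ℝ (F c) x v = 0) : ∃ a : ℝ, a • w = v := by
  set k := (jetAt A F x).ker with hkdef
  have hk' : ¬ (k 0 = 0 ∧ k 1 = 0 ∧ k 2 = 0) := by
    rintro ⟨h0, h1, h2⟩
    refine hk ?_
    ext i; fin_cases i
    · exact h0
    · exact h1
    · exact h2
  have key : ∀ u : E3, (∀ c, fderiv ℝ (F c) x u = 0) → u 0 * k 0 + u 1 * k 1 + u 2 * k 2 = 0 →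
      u = 0 := by
    intro u hu huk
    have h0 := hu 0
    have h1 := hu 1
    rw [fderiv_eq_sum_pd] at h0 h1
    have := eq_zero_of_orthogonal (a := fun i => pd i (F 0) x) (b := fun i => pd i (F 1) x)
      (v := fun i => u i) hk' h0 h1 huk
    ext i; exact congrFun this i
  set a := w 0 * k 0 + w 1 * k 1 + w 2 * k 2 with ha
  set b := v 0 * k 0 + v 1 * k 1 + v 2 * k 2 with hb
  have ha0 : a ≠ 0 := fun h => hw0 (key w hw h)
  refine ⟨b / a, ?_⟩
  have := key ((b / a) • w - v) (fun c => by rw [map_sub, map_smul, hw, hv]; simp) (by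
    simp only [PiLp.sub_apply, PiLp.smul_apply, smul_eq_mul]
    have : b / a * a = b := div_mul_cancel₀ b ha0
    rw [ha] at this
    linear_combination this)
  exact sub_eq_zero.1 this

open Classical in
/-- Along a curve of regular zeros, the transverse linearization has the trace and the determinant
of the matrix in the jet. -/
theorem transverseCharpoly_eq (hr : 1 ≤ r) (hA : IsSlopes η φ A)
    (hφ : φ ∈ IsManifold.maximalAtlas (𝓡 3) ∞ M) (X : η.Sections) {γ : ℝ → M} {t : ℝ}
    (hγ0 : ∀ s, X.field (γ s) = 0) (hγ : MDifferentiableAt 𝓘(ℝ, ℝ) (𝓡 3) γ t)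
    (hreg : mfderiv 𝓘(ℝ, ℝ) (𝓡 3) γ t (1 : ℝ) ≠ 0) (hp : γ t ∈ φ.source)
    (hk : (jetAt A (comps φ X.field) (φ (γ t))).ker ≠ 0) :
    transverseCharpoly X.field γ t = Polynomial.X ^ 2 -
      Polynomial.C (jetAt A (comps φ X.field) (φ (γ t))).tr * Polynomial.X +
        Polynomial.C (jetAt A (comps φ X.field) (φ (γ t))).det := by
  set p := γ t with hpdef
  set j := jetAt A (comps φ X.field) (φ p) with hj
  set w : TangentSpace (𝓡 3) p := mfderiv 𝓘(ℝ, ℝ) (𝓡 3) γ t (1 : ℝ) with hw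
  have hx := φ.map_source hp
  have hwz : fderiv ℝ (chartRep φ X.field) (φ p) (chartDeriv hφ hp w) = 0 :=
    fderiv_comps_velocity hr X hφ hγ0 hγ hp
  have hlin := chartDeriv_linearization hr X hφ hp (hγ0 t)
  -- the differentials of the two components identify the normal space with the plane
  let Λ : TangentSpace (𝓡 3) p →ₗ[ℝ] (Fin 2 → ℝ) := LinearMap.pi fun c =>
    (fderiv ℝ (comps φ X.field c) (φ p)).toLinearMap ∘ₗ (chartDeriv hφ hp).toLinearEquiv.toLinearMap
  have hΛ : ∀ v c, Λ v c = fderiv ℝ (comps φ X.field c) (φ p) (chartDeriv hφ hp v) := fun v c => rfl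
  have hker : LinearMap.ker Λ = tangentLine γ t := by
    apply le_antisymm
    · intro v hv
      have hv' : ∀ c, fderiv ℝ (comps φ X.field c) (φ p) (chartDeriv hφ hp v) = 0 := fun c => by
        rw [← hΛ, LinearMap.mem_ker.1 hv]; rfl
      obtain ⟨a, ha⟩ := exists_smul_eq_of_ker_ne_zero hk
        (w := chartDeriv hφ hp w) (v := chartDeriv hφ hp v)
        ((chartDeriv hφ hp).map_ne_zero_iff.2 hreg)
        (fun c => by rw [fderiv_comps hr X hφ hx, hwz]; rfl) hv'
      refine Submodule.mem_span_singleton.2 ⟨a, (chartDeriv hφ hp).injective ?_⟩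
      rw [map_smul]; exact ha
    · refine (Submodule.span_singleton_le_iff_mem _ _).2 (LinearMap.mem_ker.2 ?_)
      ext c
      rw [hΛ, fderiv_comps hr X hφ hx]
      exact congrArg (fun v : E3 => v c.castSucc) hwz
  have hfin : Module.finrank ℝ (TangentSpace (𝓡 3) p) = 3 := by
    rw [LinearEquiv.finrank_eq (chartDeriv hφ hp).toLinearEquiv]; simp
  have hsurj : Function.Surjective Λ := by
    rw [← LinearMap.range_eq_top]
    apply Submodule.eq_top_of_finrank_eq
    have h1 := LinearMap.finrank_range_add_finrank_ker Λ
    have h2 : Module.finrank ℝ (LinearMap.ker Λ) = 1 := by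
      rw [hker]; exact finrank_span_singleton hreg
    rw [hfin, h2] at h1
    simp only [Module.finrank_fin_fun]
    omega
  have hmat : ∀ v, Λ (linearization X.field p v) = Matrix.toLin' (Matrix.of j.mat) (Λ v) := by
    intro v
    ext c
    have e2 := hA.fderiv_chartRep_two hr hφ X hp (hγ0 t) (chartDeriv hφ hp v)
    have e0 := fderiv_comps hr X hφ hx 0 (chartDeriv hφ hp v)
    have e1 := fderiv_comps hr X hφ hx 1 (chartDeriv hφ hp v)
    rw [hΛ, hlin, fderiv_eq_sum_pd, e2]
    simp only [Matrix.toLin'_apply, Matrix.mulVec, dotProduct, Fin.sum_univ_two, Matrix.of_apply,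
      hΛ, e0, e1]
    simp only [Jet.mat, Jet.y1, Jet.slope, hj, jetAt]
    change _ = (pd 0 _ _ + _) * fderiv ℝ (chartRep φ X.field) (φ p) (chartDeriv hφ hp v) 0 +
      (pd 1 _ _ + _) * fderiv ℝ (chartRep φ X.field) (φ p) (chartDeriv hφ hp v) 1
    ring
  have hle : tangentLine γ t ≤ (tangentLine γ t).comap (linearization X.field (γ t)) := by
    intro v hv
    rw [← hker] at hv
    rw [Submodule.mem_comap, ← hker, LinearMap.mem_ker]
    refine (hmat v).trans ?_
    rw [LinearMap.mem_ker.1 hv, map_zero]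
  let e : (TangentSpace (𝓡 3) p ⧸ tangentLine γ t) ≃ₗ[ℝ] (Fin 2 → ℝ) :=
    (Submodule.quotEquivOfEq _ _ hker.symm).trans (Λ.quotKerEquivOfSurjective hsurj)
  have he : ∀ v, e (Submodule.Quotient.mk v) = Λ v := fun v => rfl
  have hconj : e.conj (transverseLinearization X.field γ t) = Matrix.toLin' (Matrix.of j.mat) := by
    apply LinearMap.ext
    intro y
    obtain ⟨v, rfl⟩ := hsurj y
    rw [LinearEquiv.conj_apply_apply, ← he, LinearEquiv.symm_apply_apply, transverseLinearization,
      dif_pos hle, he]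
    exact hmat v
  have hcp : (transverseLinearization X.field γ t).charpoly = (Matrix.of j.mat).charpoly := by
    rw [← LinearEquiv.charpoly_conj e, hconj, Matrix.charpoly_toLin']
  rw [transverseCharpoly, hcp, Matrix.charpoly_fin_two, Matrix.trace_fin_two, Matrix.det_fin_two]
  rfl

end Linearization

/-! ### The Hopf coefficient in terms of jets -/

/-- The derivative in the direction `u`. -/
def dd (u : E3) (f : E3 → ℝ) : E3 → ℝ := fun x => fderiv ℝ f x u

theorem ContDiffAt.dd {f : E3 → ℝ} {x : E3} {m n : WithTop ℕ∞} (hf : ContDiffAt ℝ n f x)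
    (hmn : m + 1 ≤ n) (u : E3) : ContDiffAt ℝ m (dd u f) x :=
  (hf.fderiv_right hmn).clm_apply contDiffAt_const

theorem dd_congr {f g : E3 → ℝ} {x : E3} (h : f =ᶠ[𝓝 x] g) (u : E3) :
    dd u f =ᶠ[𝓝 x] dd u g :=
  h.fderiv.fun_comp fun L => L u

theorem dd_eq_sum_pd (f : E3 → ℝ) (u : E3) : dd u f = fun x => ∑ i, u i * pd i f x := by
  ext x
  rw [dd, fderiv_eq_sum_pd, Fin.sum_univ_three]

theorem dd_linComb {ι : Type*} (s : Finset ι) (a : ι → ℝ) {f : ι → E3 → ℝ} {x : E3}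
    (hf : ∀ i, ContDiffAt ℝ 1 (f i) x) (u : E3) :
    dd u (fun y => ∑ i ∈ s, a i * f i y) =ᶠ[𝓝 x] fun y => ∑ i ∈ s, a i * dd u (f i) y := by
  have hev : ∀ᶠ y in 𝓝 x, ∀ i ∈ s, ContDiffAt ℝ 1 (f i) y :=
    (Filter.eventually_all_finset s).2 fun i _ => (hf i).eventually (by simp)
  filter_upwards [hev] with y hy
  have hd : ∀ i ∈ s, HasFDerivAt (fun y => a i * f i y) (a i • fderiv ℝ (f i) y) y := fun i hi =>
    ((hy i hi).differentiableAt (by simp)).hasFDerivAt.const_mul (a i)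
  have h := HasFDerivAt.fun_sum hd
  rw [dd, h.fderiv]
  simp [dd]

/-- Second directional derivatives in terms of partial derivatives. -/
theorem dd_dd_eq_sum {f : E3 → ℝ} {x : E3} (hf : ContDiffAt ℝ 2 f x) (u v : E3) :
    dd u (dd v f) x = ∑ i, ∑ k, pd i (pd k f) x * (u i * v k) := by
  rw [dd_eq_sum_pd f v, (dd_linComb Finset.univ (fun k => v k)
    (fun k => hf.pd (by norm_num) k) u).self_of_nhds]
  simp only [dd_eq_sum_pd, Fin.sum_univ_three]
  ring

/-- Third directional derivatives in terms of partial derivatives. -/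
theorem dd_dd_dd_eq_sum {f : E3 → ℝ} {x : E3} (hf : ContDiffAt ℝ 3 f x) (u v w : E3) :
    dd u (dd v (dd w f)) x =
      ∑ i, ∑ k, ∑ l, pd i (pd k (pd l f)) x * (u i * (v k * w l)) := by
  have h1 := dd_linComb Finset.univ (fun k => w k)
    (fun k => hf.pd (m := 1) (by norm_num) k) v
  rw [← dd_eq_sum_pd f w] at h1
  have h2 := ((dd_congr h1 u).trans (dd_linComb Finset.univ (fun k => w k)
    (fun k => (hf.pd (m := 2) (by norm_num) k).dd (by norm_num) v) u)).self_of_nhds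
  have h3 : ∀ l, dd u (dd v (pd l f)) x = ∑ i, ∑ k, pd i (pd k (pd l f)) x * (u i * v k) :=
    fun l => dd_dd_eq_sum (hf.pd (m := 2) (by norm_num) l) u v
  rw [h2]
  simp only [h3, Fin.sum_univ_three]
  ring

/-- The restriction of a function to an affine plane, in linear coordinates. -/
def onPlane (x u v : E3) (f : E3 → ℝ) : ℝ → ℝ → ℝ := fun a b => f (x + a • u + b • v)

/-- Equality of functions of two variables near the origin. -/
def EqNearZero (F G : ℝ → ℝ → ℝ) : Prop := ∀ᶠ z : ℝ × ℝ in 𝓝 0, F z.1 z.2 = G z.1 z.2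

theorem EqNearZero.eq {F G : ℝ → ℝ → ℝ} (h : EqNearZero F G) : F 0 0 = G 0 0 := h.self_of_nhds

theorem EqNearZero.trans {F G H : ℝ → ℝ → ℝ} (h : EqNearZero F G) (h' : EqNearZero G H) :
    EqNearZero F H := by
  filter_upwards [h, h'] with z h1 h2 using h1.trans h2

theorem EqNearZero.partialX {F G : ℝ → ℝ → ℝ} (h : EqNearZero F G) :
    EqNearZero (partialX F) (partialX G) := by
  filter_upwards [h.eventually_nhds] with z hz
  have : Tendsto (fun s : ℝ => (s, z.2)) (𝓝 z.1) (𝓝 z) := by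
    have : ContinuousAt (fun s : ℝ => (s, z.2)) z.1 := by fun_prop
    exact this
  exact Filter.EventuallyEq.deriv_eq (this.eventually hz)

theorem EqNearZero.partialY {F G : ℝ → ℝ → ℝ} (h : EqNearZero F G) :
    EqNearZero (partialY F) (partialY G) := by
  filter_upwards [h.eventually_nhds] with z hz
  have : Tendsto (fun s : ℝ => (z.1, s)) (𝓝 z.2) (𝓝 z) := by
    have : ContinuousAt (fun s : ℝ => (z.1, s)) z.2 := by fun_prop
    exact this
  exact Filter.EventuallyEq.deriv_eq (this.eventually hz)

theorem eventually_onPlane {x u v : E3} {P : E3 → Prop} (h : ∀ᶠ y in 𝓝 x, P y) :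
    ∀ᶠ z : ℝ × ℝ in 𝓝 0, P (x + z.1 • u + z.2 • v) := by
  have : ContinuousAt (fun z : ℝ × ℝ => x + z.1 • u + z.2 • v) 0 := by fun_prop
  refine this.eventually (p := P) ?_
  simpa using h

theorem partialX_onPlane {x u v : E3} {f : E3 → ℝ} (hf : ContDiffAt ℝ 1 f x) :
    EqNearZero (partialX (onPlane x u v f)) (onPlane x u v (dd u f)) := by
  filter_upwards [eventually_onPlane (u := u) (v := v) (hf.eventually (by simp))] with z hz
  have h1 : HasDerivAt (fun s : ℝ => x + s • u + z.2 • v) u z.1 := by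
    simpa using (((hasDerivAt_id z.1).smul_const u).const_add x).add_const (z.2 • v)
  exact ((hz.differentiableAt (by simp)).hasFDerivAt.comp_hasDerivAt z.1 h1).deriv

theorem partialY_onPlane {x u v : E3} {f : E3 → ℝ} (hf : ContDiffAt ℝ 1 f x) :
    EqNearZero (partialY (onPlane x u v f)) (onPlane x u v (dd v f)) := by
  filter_upwards [eventually_onPlane (u := u) (v := v) (hf.eventually (by simp))] with z hz
  have h1 : HasDerivAt (fun s : ℝ => x + z.1 • u + s • v) v z.2 := by
    simpa using ((hasDerivAt_id z.2).smul_const v).const_add (x + z.1 • u)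
  exact ((hz.differentiableAt (by simp)).hasFDerivAt.comp_hasDerivAt z.2 h1).deriv

theorem onPlane_zero (x u v : E3) (f : E3 → ℝ) : onPlane x u v f 0 0 = f x := by simp [onPlane]

/-- The Hopf coefficient of the restriction to a plane, in terms of directional derivatives. -/
theorem hopfCoefficient_onPlane {x u v : E3} {f g : E3 → ℝ} (hf : ContDiffAt ℝ 3 f x)
    (hg : ContDiffAt ℝ 3 g x) (freq : ℝ) :
    hopfCoefficient freq (onPlane x u v f) (onPlane x u v g) =
      (1 / 16) * (dd u (dd u (dd u f)) x + dd u (dd v (dd v f)) x + dd u (dd u (dd v g)) x +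
          dd v (dd v (dd v g)) x) +
        (1 / (16 * freq)) * (dd u (dd v f) x * (dd u (dd u f) x + dd v (dd v f) x) -
          dd u (dd v g) x * (dd u (dd u g) x + dd v (dd v g) x) -
          dd u (dd u f) x * dd u (dd u g) x + dd v (dd v f) x * dd v (dd v g) x) := by
  have key : ∀ h : E3 → ℝ, ContDiffAt ℝ 3 h x →
      partialX (partialX (onPlane x u v h)) 0 0 = dd u (dd u h) x ∧
      partialX (partialY (onPlane x u v h)) 0 0 = dd u (dd v h) x ∧
      partialY (partialY (onPlane x u v h)) 0 0 = dd v (dd v h) x ∧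
      partialX (partialX (partialX (onPlane x u v h))) 0 0 = dd u (dd u (dd u h)) x ∧
      partialX (partialY (partialY (onPlane x u v h))) 0 0 = dd u (dd v (dd v h)) x ∧
      partialX (partialX (partialY (onPlane x u v h))) 0 0 = dd u (dd u (dd v h)) x ∧
      partialY (partialY (partialY (onPlane x u v h))) 0 0 = dd v (dd v (dd v h)) x := by
    intro h hh
    have c1 : ∀ w, ContDiffAt ℝ 2 (dd w h) x := fun w => hh.dd (by norm_num) w
    have c2 : ∀ w w', ContDiffAt ℝ 1 (dd w (dd w' h)) x := fun w w' =>
      (c1 w').dd (by norm_num) w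
    have X1 := partialX_onPlane (u := u) (v := v) (hh.of_le (by norm_num))
    have Y1 := partialY_onPlane (u := u) (v := v) (hh.of_le (by norm_num))
    have X2 := fun w => partialX_onPlane (u := u) (v := v) ((c1 w).of_le (by norm_num))
    have Y2 := fun w => partialY_onPlane (u := u) (v := v) ((c1 w).of_le (by norm_num))
    have XX := X1.partialX.trans (X2 u)
    have XY := Y1.partialX.trans (X2 v)
    have YY := Y1.partialY.trans (Y2 v)
    have X3 := fun w w' => partialX_onPlane (u := u) (v := v) (c2 w w')
    have Y3 := fun w w' => partialY_onPlane (u := u) (v := v) (c2 w w')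
    exact ⟨XX.eq.trans (onPlane_zero _ _ _ _), XY.eq.trans (onPlane_zero _ _ _ _),
      YY.eq.trans (onPlane_zero _ _ _ _),
      (XX.partialX.trans (X3 _ _)).eq.trans (onPlane_zero _ _ _ _),
      (YY.partialX.trans (X3 _ _)).eq.trans (onPlane_zero _ _ _ _),
      (XY.partialX.trans (X3 _ _)).eq.trans (onPlane_zero _ _ _ _),
      (YY.partialY.trans (Y3 _ _)).eq.trans (onPlane_zero _ _ _ _)⟩
  obtain ⟨f1, f2, f3, f4, f5, -, -⟩ := key f hf
  obtain ⟨g1, g2, g3, -, -, g6, g7⟩ := key g hg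
  simp only [hopfCoefficient, f1, f2, f3, f4, f5, g1, g2, g3, g6, g7]

/-- The Hopf coefficient of the projection to the plane field, in a basis putting the linear part in
normal form, is the Lyapunov coefficient of the jet. -/
theorem hopfCoefficient_eq_lyapunov {A : E3 → Fin 2 → ℝ} {F : Fin 2 → E3 → ℝ} {x : E3}
    (hF : ∀ c, ContDiffAt ℝ 3 (F c) x) {e₁ e₂ : E3} (h₁ : ∀ i, e₁ i = (jetAt A F x).hopf₁ i)
    (h₂ : ∀ i, e₂ i = (jetAt A F x).hopf₂ i) :
    hopfCoefficient (jetAt A F x).freq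
      (onPlane x e₁ e₂ fun y => (jetAt A F x).coord₁ fun c => F c y)
      (onPlane x e₁ e₂ fun y => (jetAt A F x).coord₂ fun c => F c y) = (jetAt A F x).lyapunov := by
  set j := jetAt A F x with hj
  -- the coordinates are linear combinations of the components
  obtain ⟨a, ha⟩ : ∃ a : Fin 2 → ℝ, ∀ v, j.coord₁ v = ∑ c, a c * v c :=
    ⟨![1, -(j.mat 0 0 / j.mat 1 0)], fun v => by simp [Jet.coord₁, Fin.sum_univ_two]; ring⟩
  obtain ⟨b, hb⟩ : ∃ b : Fin 2 → ℝ, ∀ v, j.coord₂ v = ∑ c, b c * v c :=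
    ⟨![0, j.freq / j.mat 1 0], fun v => by simp [Jet.coord₂, Fin.sum_univ_two]⟩
  have q2 : ∀ c (u v : E3), dd u (dd v (F c)) x = j.quad (fun i => u i) (fun i => v i) c :=
    fun c u v => dd_dd_eq_sum ((hF c).of_le (by norm_num)) u v
  have q3 : ∀ c (u v w : E3), dd u (dd v (dd w (F c))) x =
      j.cubic (fun i => u i) (fun i => v i) (fun i => w i) c :=
    fun c u v w => dd_dd_dd_eq_sum (hF c) u v w
  have l2 : ∀ (a : Fin 2 → ℝ) (u v : E3), dd u (dd v fun y => ∑ c, a c * F c y) x =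
      ∑ c, a c * j.quad (fun i => u i) (fun i => v i) c := fun a u v => by
    rw [((dd_congr (dd_linComb _ a (fun c => (hF c).of_le (by norm_num)) v) u).trans
      (dd_linComb _ a (fun c => (hF c).dd (by norm_num) v) u)).self_of_nhds]
    simp only [q2]
  have l3 : ∀ (a : Fin 2 → ℝ) (u v w : E3), dd u (dd v (dd w fun y => ∑ c, a c * F c y)) x =
      ∑ c, a c * j.cubic (fun i => u i) (fun i => v i) (fun i => w i) c := fun a u v w => by
    rw [((dd_congr ((dd_congr (dd_linComb _ a (fun c => (hF c).of_le (by norm_num)) w) v).trans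
      (dd_linComb _ a (fun c => (hF c).dd (by norm_num) w) v)) u).trans
      (dd_linComb _ a (fun c => ((hF c).dd (m := 2) (by norm_num) w).dd
        (by norm_num) v) u)).self_of_nhds]
    simp only [q3]
  have hs : ∀ a : Fin 2 → ℝ, ContDiffAt ℝ 3 (fun y => ∑ c, a c * F c y) x := fun a =>
    ContDiffAt.sum fun c _ => contDiffAt_const.mul (hF c)
  have e1 : (fun i => e₁ i) = j.hopf₁ := funext h₁
  have e2 : (fun i => e₂ i) = j.hopf₂ := funext h₂
  simp only [ha, hb]
  rw [hopfCoefficient_onPlane (hs a) (hs b)]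
  simp only [l2, l3, e1, e2, Jet.lyapunov, ha, hb]

/-! ### Transverse eigenvalues along the fixed circles -/

theorem pd_mul_apply {f g : E3 → ℝ} {x : E3} (hf : DifferentiableAt ℝ f x)
    (hg : DifferentiableAt ℝ g x) (i : Fin 3) :
    pd i (fun y => f y * g y) x = pd i f x * g x + f x * pd i g x := by
  simp only [pd]
  rw [fderiv_fun_mul hf hg]
  simp
  ring

theorem pd_add_apply {f g : E3 → ℝ} {x : E3} (hf : DifferentiableAt ℝ f x)
    (hg : DifferentiableAt ℝ g x) (i : Fin 3) :
    pd i (fun y => f y + g y) x = pd i f x + pd i g x := by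
  simp only [pd]
  rw [fderiv_fun_add hf hg]
  rfl

theorem pd_sub_apply {f g : E3 → ℝ} {x : E3} (hf : DifferentiableAt ℝ f x)
    (hg : DifferentiableAt ℝ g x) (i : Fin 3) :
    pd i (fun y => f y - g y) x = pd i f x - pd i g x := by
  simp only [pd]
  rw [fderiv_fun_sub hf hg]
  rfl

section Jets

variable {A : E3 → Fin 2 → ℝ} {F : Fin 2 → E3 → ℝ} {x : E3}

theorem differentiableAt_jetAt_comp {f : Jet → ℝ} (hf : ContDiff ℝ ∞ f) (hA : ContDiffAt ℝ 2 A x)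
    (hF : ∀ c, ContDiffAt ℝ 4 (F c) x) : DifferentiableAt ℝ (fun y => f (jetAt A F y)) x :=
  (hf.differentiable (by simp)).differentiableAt.comp x
    ((contDiffAt_jetAt hA hF).differentiableAt (by norm_num))

theorem pd_mat (hA : ContDiffAt ℝ 2 A x) (hF : ∀ c, ContDiffAt ℝ 4 (F c) x) (i : Fin 3)
    (c d : Fin 2) : pd i (fun y => (jetAt A F y).mat c d) x = (jetAt A F x).dmat i c d := by
  have hd : ∀ k, DifferentiableAt ℝ (pd k (F c)) x := fun k =>
    ((hF c).pd (m := 1) (by norm_num) k).differentiableAt (by norm_num)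
  have hAd : DifferentiableAt ℝ (fun y => A y d) x :=
    (contDiffAt_pi.1 hA d).differentiableAt (by norm_num)
  change pd i (fun y => pd d.castSucc (F c) y + A y d * pd 2 (F c) y) x = _
  rw [pd_add_apply (hd _) (hAd.fun_mul (hd _)), pd_mul_apply hAd (hd _)]
  simp only [Jet.dmat, Jet.y2, Jet.y1, Jet.dslope, Jet.slope, jetAt]
  ring

theorem pd_tr (hA : ContDiffAt ℝ 2 A x) (hF : ∀ c, ContDiffAt ℝ 4 (F c) x) (i : Fin 3) :
    pd i (fun y => (jetAt A F y).tr) x = (jetAt A F x).dtr i := by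
  have hm := fun c d => differentiableAt_jetAt_comp (Jet.contDiff_mat c d) hA hF
  simp only [Jet.tr]
  rw [pd_add_apply (hm _ _) (hm _ _), pd_mat hA hF, pd_mat hA hF]
  rfl

theorem pd_det (hA : ContDiffAt ℝ 2 A x) (hF : ∀ c, ContDiffAt ℝ 4 (F c) x) (i : Fin 3) :
    pd i (fun y => (jetAt A F y).det) x = (jetAt A F x).ddet i := by
  have hm := fun c d => differentiableAt_jetAt_comp (Jet.contDiff_mat c d) hA hF
  simp only [Jet.det]
  rw [pd_sub_apply ((hm _ _).fun_mul (hm _ _)) ((hm _ _).fun_mul (hm _ _)), pd_mul_apply (hm _ _) (hm _ _),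
    pd_mul_apply (hm _ _) (hm _ _), pd_mat hA hF, pd_mat hA hF, pd_mat hA hF, pd_mat hA hF]
  rfl

/-- The vector `ker` of a jet spans the common kernel of the differentials. -/
theorem exists_eq_mul_ker (hk : (jetAt A F x).ker ≠ 0) {v : E3} (hv0 : v ≠ 0)
    (hv : ∀ c, fderiv ℝ (F c) x v = 0) :
    ∃ a : ℝ, a ≠ 0 ∧ ∀ i, v i = a * (jetAt A F x).ker i := by
  let w : E3 := WithLp.toLp 2 (jetAt A F x).ker
  have hw : ∀ c, fderiv ℝ (F c) x w = 0 := by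
    intro c
    rw [fderiv_eq_sum_pd]
    simp only [w, Jet.ker, Jet.y1, jetAt, Matrix.cons_val]
    fin_cases c <;> simp only [Fin.zero_eta, Fin.mk_one] <;> ring
  have hw0 : w ≠ 0 := fun h => hk (by
    have := congrArg WithLp.ofLp h
    exact this)
  obtain ⟨a, ha⟩ := exists_smul_eq_of_ker_ne_zero hk hw0 hw hv
  refine ⟨a, ?_, fun i => ?_⟩
  · rintro rfl
    exact hv0 (by rw [← ha, zero_smul])
  · rw [← ha]; rfl

end Jets

/-- The eigenvalues of a real `2 × 2` matrix with trace `T` and determinant `D` avoid the imaginary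
axis unless `D = 0`, or `T = 0` and `D > 0`. -/
theorem forall_root_re_ne_zero_iff (T D : ℝ) :
    (∀ z : ℂ, ((Polynomial.X ^ 2 - Polynomial.C T * Polynomial.X + Polynomial.C D :
      Polynomial ℝ).map (algebraMap ℝ ℂ)).IsRoot z → z.re ≠ 0) ↔
      ¬ (D = 0 ∨ (T = 0 ∧ 0 < D)) := by
  have hroot : ∀ z : ℂ, ((Polynomial.X ^ 2 - Polynomial.C T * Polynomial.X + Polynomial.C D :
      Polynomial ℝ).map (algebraMap ℝ ℂ)).IsRoot z ↔ z ^ 2 - T * z + D = 0 := by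
    intro z
    simp [Polynomial.IsRoot.def]
  simp only [hroot]
  constructor
  · rintro h (rfl | ⟨rfl, hD⟩)
    · exact h 0 (by simp) rfl
    · refine h (Complex.I * (√ D : ℝ)) ?_ (by simp)
      rw [mul_pow, Complex.I_sq, ← Complex.ofReal_pow, Real.sq_sqrt hD.le]
      simp
  · intro h z hz h0
    have hre := congrArg Complex.re hz
    have him := congrArg Complex.im hz
    simp [pow_two, h0] at hre him
    apply h
    rcases him with rfl | him
    · by_cases hy : z.im = 0
      · left; simpa [hy] using hre
      · right
        refine ⟨rfl, ?_⟩
        have : 0 < z.im * z.im := mul_self_pos.2 hy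
        linarith
    · left; simpa [him] using hre

section Saddle

open Polynomial

/-- A simple zero of the determinant with nonzero trace gives a saddle-node. -/
theorem exists_saddleNode_eigenvalues {T D : ℝ → ℝ} {T' D' t₀ : ℝ} (hT : HasDerivAt T T' t₀)
    (hD : HasDerivAt D D' t₀) (hT0 : T t₀ ≠ 0) (hD0 : D t₀ = 0) (hD' : D' ≠ 0) :
    ∃ ev₁ ev₂ : ℝ → ℝ, ∃ speed : ℝ,
      (∀ᶠ t in 𝓝 t₀, (X ^ 2 - C (T t) * X + C (D t) : ℝ[X]) = (X - C (ev₁ t)) * (X - C (ev₂ t))) ∧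
      ev₁ t₀ = 0 ∧ ev₂ t₀ ≠ 0 ∧ HasDerivAt ev₁ speed t₀ ∧ speed ≠ 0 := by
  -- the sign of the square root for which `ev₂` is the eigenvalue which does not vanish
  obtain ⟨σ, hσ, hσT⟩ : ∃ σ : ℝ, σ * σ = 1 ∧ σ * |T t₀| = T t₀ := by
    rcases lt_or_gt_of_ne hT0 with h | h
    · exact ⟨-1, by norm_num, by rw [abs_of_neg h]; ring⟩
    · exact ⟨1, by norm_num, by rw [abs_of_pos h]; ring⟩
  let q : ℝ → ℝ := fun t => T t ^ 2 - 4 * D t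
  have hq0 : q t₀ = T t₀ ^ 2 := by simp [q, hD0]
  have hqpos : 0 < q t₀ := by rw [hq0]; positivity
  have hqd : HasDerivAt q (2 * T t₀ * T' - 4 * D') t₀ := by
    have h : HasDerivAt q _ t₀ := (hT.pow 2).sub (hD.const_mul 4)
    exact h.congr_deriv (by simp)
  let ev₂ : ℝ → ℝ := fun t => (T t + σ * √ (q t)) / 2
  have hev0 : ev₂ t₀ = T t₀ := by
    simp only [ev₂, hq0, Real.sqrt_sq_eq_abs, hσT]; ring
  have hev₂0 : ev₂ t₀ ≠ 0 := by rwa [hev0]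
  have hevd : DifferentiableAt ℝ ev₂ t₀ :=
    ((hT.add ((hqd.sqrt hqpos.ne').const_mul σ)).div_const 2).differentiableAt
  refine ⟨fun t => D t / ev₂ t, ev₂, D' / ev₂ t₀, ?_, by simp [hD0], hev₂0, ?_,
    div_ne_zero hD' hev₂0⟩
  · filter_upwards [hevd.continuousAt.eventually_ne hev₂0,
      hqd.continuousAt.eventually (lt_mem_nhds hqpos)] with t h1 h2
    have h3 : ev₂ t * ev₂ t - T t * ev₂ t + D t = 0 := by
      have hs : √ (q t) * √ (q t) = q t := Real.mul_self_sqrt h2.le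
      have hqt : q t = T t ^ 2 - 4 * D t := rfl
      have hev : ev₂ t = (T t + σ * √ (q t)) / 2 := rfl
      rw [hev]
      linear_combination (1 / 4) * (√ (q t)) ^ 2 * hσ + (1 / 4) * hs + (1 / 4) * hqt
    have h4 : D t / ev₂ t = T t - ev₂ t := by
      rw [div_eq_iff h1]; linear_combination h3
    have h5 : T t = D t / ev₂ t + ev₂ t := by rw [h4]; ring
    have h6 : D t = D t / ev₂ t * ev₂ t := (div_mul_cancel₀ _ h1).symm
    have h7 : (C (T t) : ℝ[X]) = C (D t / ev₂ t) + C (ev₂ t) := by rw [← C_add, ← h5]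
    have h8 : (C (D t) : ℝ[X]) = C (D t / ev₂ t) * C (ev₂ t) := by rw [← C_mul, ← h6]
    rw [h7, h8]; ring
  · have := hD.div hevd.hasDerivAt hev₂0
    refine this.congr_deriv ?_
    rw [hD0]; field_simp; ring

/-- A simple zero of the trace with positive determinant gives a crossing of the imaginary axis. -/
theorem exists_imaginary_crossing {T D : ℝ → ℝ} {T' t₀ : ℝ} (hT : HasDerivAt T T' t₀)
    (hD : ContinuousAt D t₀) (hT0 : T t₀ = 0) (hD0 : 0 < D t₀) (hT' : T' ≠ 0) :
    ∃ a b : ℝ → ℝ, ∃ speed : ℝ,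
      (∀ᶠ t in 𝓝 t₀, (X ^ 2 - C (T t) * X + C (D t) : ℝ[X]) = (X - C (a t)) ^ 2 + C (b t ^ 2)) ∧
      a t₀ = 0 ∧ b t₀ ≠ 0 ∧ HasDerivAt a speed t₀ ∧ speed ≠ 0 := by
  have hc : ContinuousAt (fun t => D t - (T t / 2) ^ 2) t₀ :=
    hD.sub ((hT.continuousAt.div_const 2).pow 2)
  have hpos : 0 < D t₀ - (T t₀ / 2) ^ 2 := by simpa [hT0] using hD0
  refine ⟨fun t => T t / 2, fun t => √ (D t - (T t / 2) ^ 2), T' / 2, ?_, by simp [hT0],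
    (Real.sqrt_pos.2 hpos).ne', hT.div_const 2, by simpa using hT'⟩
  filter_upwards [hc.eventually (lt_mem_nhds hpos)] with t ht
  rw [Real.sq_sqrt ht.le]
  have h1 : (C (T t) : ℝ[X]) = 2 * C (T t / 2) := by
    rw [show (2 : ℝ[X]) = C 2 from rfl, ← C_mul]; congr 1; ring
  have h2 : (C (D t - (T t / 2) ^ 2) : ℝ[X]) = C (D t) - C (T t / 2) ^ 2 := by simp
  rw [h1, h2]; ring

end Saddle

section Circles

variable {M : Type*} [TopologicalSpace M] [ChartedSpace E3 M] [IsManifold (𝓡 3) ∞ M]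
  {r : ℕ∞} {η : PlaneField r M} {φ : OpenPartialHomeomorph M E3} {A : E3 → Fin 2 → ℝ}

/-- The jet of a section at a point, in a chart with given slopes. -/
def PlaneField.Sections.jet (X : η.Sections) (φ : OpenPartialHomeomorph M E3) (A : E3 → Fin 2 → ℝ)
    (p : M) : Jet := jetAt A (comps φ X.field) (φ p)

theorem PlaneField.Sections.jet_y0 (hA : IsSlopes η φ A)
    (hφ : φ ∈ IsManifold.maximalAtlas (𝓡 3) ∞ M) (X : η.Sections) {p : M} (hp : p ∈ φ.source)
    (h0 : X.field p = 0) : (X.jet φ A p).y0 = 0 :=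
  funext ((comps_eq_zero_iff hA hφ X hp).2 h0)

/-- The derivatives of the trace and the determinant along a regular curve of zeros. -/
theorem hasDerivAt_tr_det (hr : 4 ≤ r) (hA : IsSlopes η φ A)
    (hφ : φ ∈ IsManifold.maximalAtlas (𝓡 3) ∞ M) (X : η.Sections) {γ : ℝ → M} {t : ℝ}
    (hγ0 : ∀ s, X.field (γ s) = 0) (hγ : MDifferentiableAt 𝓘(ℝ, ℝ) (𝓡 3) γ t)
    (hreg : mfderiv 𝓘(ℝ, ℝ) (𝓡 3) γ t (1 : ℝ) ≠ 0) (hp : γ t ∈ φ.source)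
    (hk : (X.jet φ A (γ t)).ker ≠ 0) :
    ∃ a : ℝ, a ≠ 0 ∧
      HasDerivAt (fun s => (X.jet φ A (γ s)).tr) (a * (X.jet φ A (γ t)).trAlong) t ∧
      HasDerivAt (fun s => (X.jet φ A (γ s)).det) (a * (X.jet φ A (γ t)).detAlong) t := by
  have hr1 : 1 ≤ r := le_trans (by norm_num) hr
  have hr4 : ((4 : ℕ∞) : WithTop ℕ∞) ≤ (r : WithTop ℕ∞) := by exact_mod_cast hr
  have hr2 : ((2 : ℕ∞) : WithTop ℕ∞) ≤ (r : WithTop ℕ∞) := by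
    exact_mod_cast le_trans (by norm_num) hr
  have hx := φ.map_source hp
  have hA2 : ContDiffAt ℝ 2 A (φ (γ t)) :=
    (hA.1.contDiffAt (φ.open_target.mem_nhds hx)).of_le hr2
  have hF4 : ∀ c, ContDiffAt ℝ 4 (comps φ X.field c) (φ (γ t)) := fun c =>
    (comps_contDiffAt X hφ hx c).of_le hr4
  set w : E3 := chartDeriv hφ hp (mfderiv 𝓘(ℝ, ℝ) (𝓡 3) γ t (1 : ℝ)) with hw
  have hδ : HasDerivAt (φ ∘ γ) w t := hasDerivAt_comp_of_mdifferentiableAt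
    ((contMDiffAt_chart hφ hp).mdifferentiableAt (by simp)) hγ
  have hwz : fderiv ℝ (chartRep φ X.field) (φ (γ t)) w = 0 :=
    fderiv_comps_velocity hr1 X hφ hγ0 hγ hp
  obtain ⟨a, ha, hak⟩ := exists_eq_mul_ker (v := w) hk
    ((chartDeriv hφ hp).map_ne_zero_iff.2 hreg)
    (fun c => by rw [fderiv_comps hr1 X hφ hx, hwz]; rfl)
  refine ⟨a, ha, ?_, ?_⟩
  · have h1 := (differentiableAt_jetAt_comp Jet.contDiff_tr hA2 hF4).hasFDerivAt.comp_hasDerivAt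
      t hδ
    refine HasDerivAt.congr_deriv (f := fun s => (X.jet φ A (γ s)).tr) h1 ?_
    rw [fderiv_eq_sum_pd, pd_tr hA2 hF4, pd_tr hA2 hF4, pd_tr hA2 hF4, hak, hak, hak]
    simp only [Jet.trAlong, PlaneField.Sections.jet]
    ring
  · have h1 := (differentiableAt_jetAt_comp Jet.contDiff_det hA2 hF4).hasFDerivAt.comp_hasDerivAt
      t hδ
    refine HasDerivAt.congr_deriv (f := fun s => (X.jet φ A (γ s)).det) h1 ?_
    rw [fderiv_eq_sum_pd, pd_det hA2 hF4, pd_det hA2 hF4, pd_det hA2 hF4, hak, hak, hak]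
    simp only [Jet.detAlong, PlaneField.Sections.jet]
    ring

end Circles

/-! ### Good sections are nondegenerate -/

section Nondegenerate

variable {M : Type*} [TopologicalSpace M] [ChartedSpace E3 M] [IsManifold (𝓡 3) ∞ M]
  {r : ℕ∞} {η : PlaneField r M} {φ : OpenPartialHomeomorph M E3} {A : E3 → Fin 2 → ℝ}

/-- On vectors of the plane, the derivative at a zero is given by the matrix of the jet. -/
theorem fderiv_chartRep_of_mem_graph (hr : 1 ≤ r) (hφ : φ ∈ IsManifold.maximalAtlas (𝓡 3) ∞ M)
    (X : η.Sections) {p : M} (hp : p ∈ φ.source) {y : E3}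
    (hy : y 2 = A (φ p) 0 * y 0 + A (φ p) 1 * y 1) (c : Fin 2) :
    fderiv ℝ (chartRep φ X.field) (φ p) y c.castSucc =
      (X.jet φ A p).mat c 0 * y 0 + (X.jet φ A p).mat c 1 * y 1 := by
  rw [← fderiv_comps hr X hφ (φ.map_source hp), fderiv_eq_sum_pd, hy]
  simp only [Jet.mat, Jet.y1, Jet.slope, PlaneField.Sections.jet, jetAt]
  change _ = (pd 0 _ _ + _) * _ + (pd 1 _ _ + _) * _
  ring

/-- The basis and the coordinate functionals required by the definition of the Hopf coefficient are
those of the jet: the functionals do not involve the third coordinate, so they factor through the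
projection along `∂/∂z`. -/
theorem hasNonzeroHopfCoefficient_of_lyapunov_ne_zero (hr : 4 ≤ r) (hA : IsSlopes η φ A)
    (hφ : φ ∈ IsManifold.maximalAtlas (𝓡 3) ∞ M) (X : η.Sections) {p : M} (hp : p ∈ φ.source)
    (h0 : X.field p = 0) (ht : (X.jet φ A p).tr = 0) (hd : 0 < (X.jet φ A p).det)
    (hl : (X.jet φ A p).lyapunov ≠ 0) :
    HasNonzeroHopfCoefficient φ X.field p (η.plane p) := by
  have hr1 : 1 ≤ r := le_trans (by norm_num) hr
  have hr3 : ((3 : ℕ∞) : WithTop ℕ∞) ≤ (r : WithTop ℕ∞) := by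
    exact_mod_cast le_trans (by norm_num) hr
  have hx := φ.map_source hp
  set j := X.jet φ A p with hj
  have hw : j.freq ≠ 0 := (Real.sqrt_pos.2 hd).ne'
  have hww : j.freq * j.freq = j.det := Real.mul_self_sqrt hd.le
  have hm : j.mat 1 0 ≠ 0 := Jet.mat_one_zero_ne_zero ht hd
  have hs : ∀ d, j.slope d = A (φ p) d := fun d => rfl
  have hm11 : j.mat 1 1 = -j.mat 0 0 := by simp only [Jet.tr] at ht; linarith
  have hdet : j.det = -(j.mat 0 0 * j.mat 0 0) - j.mat 0 1 * j.mat 1 0 := by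
    rw [Jet.det, hm11]; ring
  let E₁ : E3 := WithLp.toLp 2 j.hopf₁
  let E₂ : E3 := WithLp.toLp 2 j.hopf₂
  have hE₁ : E₁ 2 = A (φ p) 0 * E₁ 0 + A (φ p) 1 * E₁ 1 := by simp [E₁, Jet.hopf₁, hs]
  have hE₂ : E₂ 2 = A (φ p) 0 * E₂ 0 + A (φ p) 1 * E₂ 1 := by
    simp only [E₂, Jet.hopf₂, hs, Matrix.cons_val]; ring
  have h10 : E₁ 0 = 1 := rfl
  have h11 : E₁ 1 = 0 := rfl
  have h20 : E₂ 0 = j.mat 0 0 / j.freq := rfl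
  have h21 : E₂ 1 = j.mat 1 0 / j.freq := rfl
  -- a vector of the plane is determined by its first two components
  have hext : ∀ u v : E3, u 2 = A (φ p) 0 * u 0 + A (φ p) 1 * u 1 →
      v 2 = A (φ p) 0 * v 0 + A (φ p) 1 * v 1 → u 0 = v 0 → u 1 = v 1 → u = v := by
    intro u v hu hv e0 e1
    ext i
    fin_cases i
    · exact e0
    · exact e1
    · change u 2 = v 2
      rw [hu, hv, e0, e1]
  have hD := fun v : E3 => hA.fderiv_chartRep_two hr1 hφ X hp h0 v
  have hG₁ := fderiv_chartRep_of_mem_graph hr1 hφ X hp hE₁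
  have hG₂ := fderiv_chartRep_of_mem_graph hr1 hφ X hp hE₂
  have hlin₁ : fderiv ℝ (chartRep φ X.field) (φ p) E₁ = j.freq • E₂ := by
    refine hext _ _ (hD _) ?_ ?_ ?_
    · simp only [PiLp.smul_apply, smul_eq_mul, hE₂]; ring
    · refine (hG₁ 0).trans ?_
      change _ = j.freq * E₂ 0
      rw [h10, h11, h20, mul_div_cancel₀ _ hw]; ring
    · refine (hG₁ 1).trans ?_
      change _ = j.freq * E₂ 1
      rw [h10, h11, h21, mul_div_cancel₀ _ hw]; ring
  have hlin₂ : fderiv ℝ (chartRep φ X.field) (φ p) E₂ = -(j.freq • E₁) := by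
    refine hext _ _ (hD _) ?_ ?_ ?_
    · simp only [PiLp.neg_apply, PiLp.smul_apply, smul_eq_mul, hE₁]; ring
    · refine (hG₂ 0).trans ?_
      change _ = -(j.freq * E₁ 0)
      rw [h10, h20, h21]
      field_simp
      linear_combination hww.trans hdet
    · refine (hG₂ 1).trans ?_
      change _ = -(j.freq * E₁ 1)
      rw [h11, h20, h21, hm11]
      field_simp
      ring
  let e := chartDeriv hφ hp
  unfold HasNonzeroHopfCoefficient
  intro dφ
  have he₁ : dφ (e.symm E₁) = E₁ := e.apply_symm_apply E₁
  have he₂ : dφ (e.symm E₂) = E₂ := e.apply_symm_apply E₂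
  have hlinz := fun v => chartDeriv_linearization hr1 X hφ hp h0 v
  let ℓ₁ : E3 →ₗ[ℝ] ℝ := (EuclideanSpace.proj 0 : E3 →L[ℝ] ℝ).toLinearMap -
    (j.mat 0 0 / j.mat 1 0) • (EuclideanSpace.proj 1 : E3 →L[ℝ] ℝ).toLinearMap
  let ℓ₂ : E3 →ₗ[ℝ] ℝ := (j.freq / j.mat 1 0) • (EuclideanSpace.proj 1 : E3 →L[ℝ] ℝ).toLinearMap
  have hℓ₁ : ∀ v, ℓ₁ v = v 0 - j.mat 0 0 / j.mat 1 0 * v 1 := fun v => rfl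
  have hℓ₂ : ∀ v, ℓ₂ v = j.freq / j.mat 1 0 * v 1 := fun v => rfl
  refine ⟨j.freq, hw, e.symm E₁, ?_, e.symm E₂, ?_, ℓ₁, ℓ₂, ?_, ?_, ?_, ?_, ?_, ?_, ?_, ?_, ?_⟩
  · refine (hA.2 p hp _).2 ?_
    change (dφ (e.symm E₁)) 2 = A (φ p) 0 * (dφ (e.symm E₁)) 0 + A (φ p) 1 * (dφ (e.symm E₁)) 1
    rw [he₁]; exact hE₁
  · refine (hA.2 p hp _).2 ?_
    change (dφ (e.symm E₂)) 2 = A (φ p) 0 * (dφ (e.symm E₂)) 0 + A (φ p) 1 * (dφ (e.symm E₂)) 1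
    rw [he₂]; exact hE₂
  · apply e.injective
    rw [map_smul, hlinz, e.apply_symm_apply, e.apply_symm_apply, hlin₁]
  · apply e.injective
    rw [map_neg, map_smul, hlinz, e.apply_symm_apply, e.apply_symm_apply, hlin₂]
  · rw [he₁, hℓ₁, h10, h11]; ring
  · rw [he₂, hℓ₁, h20, h21]; field_simp; ring
  · rw [hℓ₁]; simp
  · rw [he₁, hℓ₂, h11]; ring
  · rw [he₂, hℓ₂, h21]; field_simp
  · rw [hℓ₂]; simp
  · have hF : ∀ c, ContDiffAt ℝ 3 (comps φ X.field c) (φ p) := fun c =>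
      (comps_contDiffAt X hφ hx c).of_le hr3
    have := hopfCoefficient_eq_lyapunov (A := A) hF (e₁ := E₁) (e₂ := E₂) (fun _ => rfl)
      (fun _ => rfl)
    rw [he₁, he₂]
    change hopfCoefficient (jetAt A (comps φ X.field) (φ p)).freq
      (onPlane (φ p) E₁ E₂ fun y => (jetAt A (comps φ X.field) (φ p)).coord₁
        fun c => comps φ X.field c y)
      (onPlane (φ p) E₁ E₂ fun y => (jetAt A (comps φ X.field) (φ p)).coord₂
        fun c => comps φ X.field c y) ≠ 0
    rw [this]
    exact hl

/-- Simple zeros of the determinant, and of the trace where the determinant is positive, are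
isolated. -/
theorem eventually_nonresonant {T D : ℝ → ℝ} {T' D' t₀ : ℝ} (hT : HasDerivAt T T' t₀)
    (hD : HasDerivAt D D' t₀) (h1 : D t₀ = 0 → T t₀ ≠ 0 ∧ D' ≠ 0)
    (h2 : T t₀ = 0 → 0 < D t₀ → T' ≠ 0) :
    ∀ᶠ t in 𝓝[≠] t₀, ¬ (D t = 0 ∨ (T t = 0 ∧ 0 < D t)) := by
  rcases lt_trichotomy (D t₀) 0 with hd | hd | hd
  · filter_upwards [mem_nhdsWithin_of_mem_nhds (hD.continuousAt (gt_mem_nhds hd))] with t ht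
    rintro (h | ⟨-, h⟩)
    · exact (ne_of_lt ht) h
    · exact lt_asymm ht h
  · filter_upwards [hD.eventually_ne (h1 hd).2 (c := 0),
      mem_nhdsWithin_of_mem_nhds (hT.continuousAt.eventually_ne (h1 hd).1)] with t ht ht'
    rintro (h | ⟨h, -⟩)
    · exact ht h
    · exact ht' h
  · have hDne : ∀ᶠ t in 𝓝[≠] t₀, D t ≠ 0 :=
      mem_nhdsWithin_of_mem_nhds (hD.continuousAt.eventually_ne hd.ne')
    have hTne : ∀ᶠ t in 𝓝[≠] t₀, T t ≠ 0 := by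
      by_cases ht : T t₀ = 0
      · exact hT.eventually_ne (h2 ht hd)
      · exact mem_nhdsWithin_of_mem_nhds (hT.continuousAt.eventually_ne ht)
    filter_upwards [hDne, hTne] with t ht ht'
    rintro (h | ⟨h, -⟩)
    · exact ht h
    · exact ht' h

theorem isClosed_fixedSet (X : η.Sections) : IsClosed (fixedSet X.field) := by
  rw [← isOpen_compl_iff, isOpen_iff_mem_nhds]
  intro p hp
  set φ := chartAt E3 p
  have hφ : φ ∈ IsManifold.maximalAtlas (𝓡 3) ∞ M := IsManifold.chart_mem_maximalAtlas p
  have hps : p ∈ φ.source := mem_chart_source E3 p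
  have hc : ContinuousAt (fun q => chartRep φ X.field (φ q)) p :=
    ContinuousAt.comp (X.contDiffAt_chartRep hφ (φ.map_source hps)).continuousAt
      (φ.continuousAt hps)
  have hne : chartRep φ X.field (φ p) ≠ 0 := fun h =>
    hp ((chartRep_eq_zero_iff hφ hps X.field).1 h)
  filter_upwards [φ.open_source.mem_nhds hps, hc.eventually_ne hne] with q hq hq0 hqz
  exact hq0 ((chartRep_eq_zero_iff hφ hq X.field).2 hqz)

variable {𝒜 : AdaptedAtlas η} {X : η.Sections}

/-- The conditions satisfied at a zero by a jet which is not bad. -/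
theorem IsGood.jet (hX : IsGood 𝒜 X) (hφ : φ ∈ 𝒜.charts) :
    ∃ A, IsSlopes η φ A ∧ ∀ p ∈ φ.source, X.field p = 0 → (X.jet φ A p).ker ≠ 0 ∧
      ((X.jet φ A p).det = 0 → (X.jet φ A p).tr ≠ 0 ∧ (X.jet φ A p).detAlong ≠ 0) ∧
      ((X.jet φ A p).tr = 0 → 0 < (X.jet φ A p).det → (X.jet φ A p).trAlong ≠ 0 ∧
        (X.jet φ A p).lyapunov ≠ 0) := by
  obtain ⟨A, hA, hbad⟩ := hX φ hφ
  refine ⟨A, hA, fun p hp h0 => ?_⟩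
  have h1 := hbad _ (φ.map_source hp)
  have h2 := X.jet_y0 hA (𝒜.smooth hφ) hp h0
  change ¬ (X.jet φ A p).Bad at h1
  simp only [Jet.Bad] at h1
  refine ⟨fun h => h1 ⟨h2, Or.inl h⟩, fun hd => ⟨fun ht => h1 ⟨h2, ?_⟩, fun h => h1 ⟨h2, ?_⟩⟩,
    fun ht hd => ⟨fun h => h1 ⟨h2, ?_⟩, fun h => h1 ⟨h2, ?_⟩⟩⟩
  · exact Or.inr (Or.inl ⟨ht, hd⟩)
  · exact Or.inr (Or.inr (Or.inl ⟨hd, h⟩))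
  · exact Or.inr (Or.inr (Or.inr (Or.inl ⟨ht, h⟩)))
  · exact Or.inr (Or.inr (Or.inr (Or.inr ⟨ht, hd, h⟩)))

/-- The zero set of a good section is a regular arc near each of its points. -/
theorem IsGood.exists_regularArc (hr : 4 ≤ r) (hX : IsGood 𝒜 X) {p : M} (h0 : X.field p = 0) :
    ∃ c θ ε, IsRegularArc r (fixedSet X.field) c θ ε ∧ c 0 = p := by
  have hr1 : 1 ≤ r := le_trans (by norm_num) hr
  obtain ⟨φ, hφc, hp⟩ := 𝒜.covers p
  have hφ := 𝒜.smooth hφc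
  obtain ⟨A, hA, hgood⟩ := hX.jet hφc
  obtain ⟨c, θ, ε, hε, hc0, hθ, hc⟩ := exists_arc_of_regular hr1 φ.open_target
    (F := comps φ X.field)
    (fun d x hx => (comps_contDiffAt X hφ hx d).contDiffWithinAt) (φ.map_source hp)
    ((comps_eq_zero_iff hA hφ X hp).2 h0) (hgood p hp h0).1
  refine ⟨φ.symm ∘ c, θ ∘ φ, ε, ⟨hε, fun s hs => ?_, fun s hs => ?_, fun s hs => ?_,
    fun s hs => ?_, fun s hs => ?_⟩, by simp [hc0, φ.left_inv hp]⟩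
  all_goals obtain ⟨hcU, hz, hθc, hsm, hright⟩ := hc s hs
  · refine (comps_eq_zero_iff hA hφ X (φ.map_target hcU)).1 fun d => ?_
    rw [φ.right_inv hcU]; exact hz d
  · simp only [Function.comp, φ.right_inv hcU, hθc]
  · exact ((contMDiffAt_chart_symm hφ hcU).of_le (by exact_mod_cast le_top)).comp s
      (contMDiffAt_iff_contDiffAt.2 hsm)
  · exact MDifferentiableAt.comp (φ.symm (c s)) (hθ _).mdifferentiableAt
      ((contMDiffAt_chart hφ (φ.map_target hcU)).mdifferentiableAt (by simp))
  · have h1 : Tendsto φ (𝓝 (φ.symm (c s))) (𝓝 (c s)) := by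
      have := φ.continuousAt (φ.map_target hcU)
      rwa [ContinuousAt, φ.right_inv hcU] at this
    filter_upwards [h1.eventually hright, φ.open_source.mem_nhds (φ.map_target hcU)]
      with m hm hms hmL
    simp only [Function.comp]
    rw [hm ((comps_eq_zero_iff hA hφ X hms).2 hmL), φ.left_inv hms]

section Curve

variable {γ : ℝ → M}

/-- Transverse hyperbolicity in terms of the trace and the determinant of the jet in any chart. -/
theorem IsGood.isTransversallyHyperbolic_iff (hr : 4 ≤ r)
    (hγ0 : ∀ s, X.field (γ s) = 0) (hγ : MDifferentiable 𝓘(ℝ, ℝ) (𝓡 3) γ)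
    (hreg : ∀ t, mfderiv 𝓘(ℝ, ℝ) (𝓡 3) γ t (1 : ℝ) ≠ 0) (hφ : φ ∈ 𝒜.charts)
    (hA : IsSlopes η φ A) {t : ℝ} (hp : γ t ∈ φ.source) (hk : (X.jet φ A (γ t)).ker ≠ 0) :
    IsTransversallyHyperbolic X.field γ t ↔
      ¬ ((X.jet φ A (γ t)).det = 0 ∨ ((X.jet φ A (γ t)).tr = 0 ∧ 0 < (X.jet φ A (γ t)).det)) := by
  rw [IsTransversallyHyperbolic, transverseCharpoly_eq (le_trans (by norm_num) hr) hA
    (𝒜.smooth hφ) X hγ0 (hγ t) (hreg t) hp hk]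
  exact forall_root_re_ne_zero_iff _ _

/-- Points which are not transversally hyperbolic are isolated on the curve. -/
theorem IsGood.eventually_hyperbolic (hr : 4 ≤ r) (hX : IsGood 𝒜 X)
    (hγ0 : ∀ s, X.field (γ s) = 0) (hγ : MDifferentiable 𝓘(ℝ, ℝ) (𝓡 3) γ)
    (hreg : ∀ t, mfderiv 𝓘(ℝ, ℝ) (𝓡 3) γ t (1 : ℝ) ≠ 0) (t₀ : ℝ) :
    ∀ᶠ t in 𝓝[≠] t₀, IsTransversallyHyperbolic X.field γ t := by
  obtain ⟨φ, hφ, hp⟩ := 𝒜.covers (γ t₀)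
  obtain ⟨A, hA, hgood⟩ := hX.jet hφ
  obtain ⟨hk, h1, h2⟩ := hgood _ hp (hγ0 t₀)
  obtain ⟨a, ha, hT, hD⟩ := hasDerivAt_tr_det hr hA (𝒜.smooth hφ) X hγ0 (hγ t₀) (hreg t₀) hp hk
  have hnear : ∀ᶠ t in 𝓝[≠] t₀, γ t ∈ φ.source := mem_nhdsWithin_of_mem_nhds
    ((hγ t₀).continuousAt (φ.open_source.mem_nhds hp))
  filter_upwards [hnear, eventually_nonresonant hT hD
    (fun hd => ⟨(h1 hd).1, mul_ne_zero ha (h1 hd).2⟩)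
    (fun ht hd => mul_ne_zero ha (h2 ht hd).1)] with t ht hnr
  exact (IsGood.isTransversallyHyperbolic_iff hr hγ0 hγ hreg hφ hA ht
    (hgood _ ht (hγ0 t)).1).2 hnr

/-- A point which is not transversally hyperbolic is a saddle-node if the determinant vanishes
there, and a Hopf point if the trace vanishes and the determinant is positive. -/
theorem IsGood.isSaddleNode_or_isHopf (hr : 4 ≤ r) (hX : IsGood 𝒜 X)
    (hγ0 : ∀ s, X.field (γ s) = 0) (hγ : MDifferentiable 𝓘(ℝ, ℝ) (𝓡 3) γ)
    (hreg : ∀ t, mfderiv 𝓘(ℝ, ℝ) (𝓡 3) γ t (1 : ℝ) ≠ 0) {t₀ : ℝ}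
    (hnh : ¬ IsTransversallyHyperbolic X.field γ t₀) :
    IsSaddleNode X.field γ t₀ ∨ IsHopf 𝒜 X.field γ t₀ := by
  have hr1 : 1 ≤ r := le_trans (by norm_num) hr
  obtain ⟨φ, hφ, hp⟩ := 𝒜.covers (γ t₀)
  obtain ⟨A, hA, hgood⟩ := hX.jet hφ
  obtain ⟨hk, h1, h2⟩ := hgood _ hp (hγ0 t₀)
  obtain ⟨a, ha, hT, hD⟩ := hasDerivAt_tr_det hr hA (𝒜.smooth hφ) X hγ0 (hγ t₀) (hreg t₀) hp hk
  have hcp : ∀ᶠ t in 𝓝 t₀, transverseCharpoly X.field γ t = Polynomial.X ^ 2 -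
      Polynomial.C (X.jet φ A (γ t)).tr * Polynomial.X +
        Polynomial.C (X.jet φ A (γ t)).det := by
    filter_upwards [(hγ t₀).continuousAt (φ.open_source.mem_nhds hp)] with t ht
    exact transverseCharpoly_eq hr1 hA (𝒜.smooth hφ) X hγ0 (hγ t) (hreg t) ht
      (hgood _ ht (hγ0 t)).1
  rw [IsGood.isTransversallyHyperbolic_iff hr hγ0 hγ hreg hφ hA hp hk, not_not] at hnh
  rcases hnh with hd | ⟨ht, hd⟩
  · left
    obtain ⟨ev₁, ev₂, sp, hev, h⟩ := exists_saddleNode_eigenvalues hT hD (h1 hd).1 hd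
      (mul_ne_zero ha (h1 hd).2)
    refine ⟨ev₁, ev₂, sp, ?_, h⟩
    filter_upwards [hcp, hev] with t e1 e2
    rw [e1, e2]
  · right
    constructor
    · obtain ⟨f, g, sp, hev, h⟩ := exists_imaginary_crossing hT hD.continuousAt ht hd
        (mul_ne_zero ha (h2 ht hd).1)
      refine ⟨f, g, sp, ?_, h⟩
      filter_upwards [hcp, hev] with t e1 e2
      rw [e1, e2]
    · intro ψ hψ hpψ
      obtain ⟨B, hB, hgoodψ⟩ := hX.jet hψ
      obtain ⟨hkψ, -, h3⟩ := hgoodψ _ hpψ (hγ0 t₀)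
      -- the trace and the determinant do not depend on the chart
      have hpoly := hcp.self_of_nhds.symm.trans (transverseCharpoly_eq hr1 hB (𝒜.smooth hψ) X hγ0
        (hγ t₀) (hreg t₀) hpψ hkψ)
      have c0 := congrArg (Polynomial.eval 0) hpoly
      have c1 := congrArg (Polynomial.eval 1) hpoly
      simp at c0 c1
      change (X.jet φ A (γ t₀)).det = (X.jet ψ B (γ t₀)).det at c0
      change 1 - (X.jet φ A (γ t₀)).tr + (X.jet φ A (γ t₀)).det =
        1 - (X.jet ψ B (γ t₀)).tr + (X.jet ψ B (γ t₀)).det at c1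
      have ht' : (X.jet ψ B (γ t₀)).tr = 0 := by linarith
      have hd' : 0 < (X.jet ψ B (γ t₀)).det := by linarith
      exact hasNonzeroHopfCoefficient_of_lyapunov_ne_zero hr hB (𝒜.smooth hψ) X hpψ (hγ0 t₀) ht' hd'
        (h3 ht' hd').2

end Curve

/-- By compactness the fixed point set is a link, and there are finitely many points which are not
transversally hyperbolic in one period of each circle. -/
theorem IsGood.isNondegenerate [T2Space M] [CompactSpace M] (hr : 4 ≤ r) (hX : IsGood 𝒜 X) :
    IsNondegenerate 𝒜 X := by
  have hr1 : 1 ≤ r := le_trans (by norm_num) hr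
  have hr0 : (r : WithTop ℕ∞) ≠ 0 := by
    intro h
    have : r = 0 := by exact_mod_cast h
    simp [this] at hr
  obtain ⟨n, γ, hlink⟩ := exists_isLink hr1 (isClosed_fixedSet X).isCompact
    (fun p hp => hX.exists_regularArc hr hp)
  have hγ0 : ∀ i s, X.field (γ i s) = 0 := fun i s => by
    have : γ i s ∈ fixedSet X.field := by
      rw [← hlink.iUnion_range]; exact mem_iUnion.2 ⟨i, s, rfl⟩
    exact this
  have hγ : ∀ i, MDifferentiable 𝓘(ℝ, ℝ) (𝓡 3) (γ i) := fun i =>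
    (hlink.embedded i).contMDiff.mdifferentiable hr0
  have hreg := fun i => (hlink.embedded i).regular
  refine ⟨n, γ, hlink, ?_, fun i t h => hX.isSaddleNode_or_isHopf hr (hγ0 i) (hγ i) (hreg i) h⟩
  have hfin : ∀ i, ({t | ¬ IsTransversallyHyperbolic X.field (γ i) t} ∩ Icc 0 1).Finite := by
    intro i
    have hU : ∀ t, {s | s ≠ t → IsTransversallyHyperbolic X.field (γ i) s} ∈ 𝓝 t := fun t =>
      mem_nhdsWithin_iff_eventually.1 (hX.eventually_hyperbolic hr (hγ0 i) (hγ i) (hreg i) t)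
    obtain ⟨F, -, hF⟩ := isCompact_Icc.elim_nhds_subcover (s := Icc (0 : ℝ) 1) _ fun t _ => hU t
    refine F.finite_toSet.subset fun s hs => ?_
    obtain ⟨t, ht, hst⟩ := mem_iUnion₂.1 (hF hs.2)
    by_cases h : s = t
    · rw [h]; exact ht
    · exact absurd (hst h) hs.1
  refine (finite_iUnion fun i => (hfin i).image (γ i)).subset ?_
  rintro p ⟨i, t, rfl, hnh⟩
  obtain ⟨s, hs, hst⟩ := (hlink.embedded i).periodic.exists_mem_Ico₀ one_pos t
  refine mem_iUnion.2 ⟨i, s, ⟨?_, Ico_subset_Icc_self hs⟩, hst.symm⟩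
  -- hyperbolicity depends only on the point of the circle
  obtain ⟨φ, hφ, hp⟩ := 𝒜.covers (γ i t)
  obtain ⟨A, hA, hgood⟩ := hX.jet hφ
  have hk := (hgood _ hp (hγ0 i t)).1
  rw [IsGood.isTransversallyHyperbolic_iff hr (hγ0 i) (hγ i) (hreg i) hφ hA hp hk, hst] at hnh
  rw [hst] at hp hk
  exact fun h => hnh
    ((IsGood.isTransversallyHyperbolic_iff hr (hγ0 i) (hγ i) (hreg i) hφ hA hp hk).1 h)

end Nondegenerate

/-! ### Existence of adapted atlases -/

section Adapted

variable {M : Type*} [TopologicalSpace M] [ChartedSpace E3 M]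

/-- After a permutation of the coordinates, two linearly independent vectors of `ℝ³` project
isomorphically to the first two coordinates. -/
theorem exists_perm_minor_ne_zero {v w : E3} (h : ∀ a b : ℝ, a • v + b • w = 0 → a = 0 ∧ b = 0) :
    ∃ σ : Equiv.Perm (Fin 3), v (σ 0) * w (σ 1) - v (σ 1) * w (σ 0) ≠ 0 := by
  by_contra! H
  have key : ∀ i j : Fin 3, v i * w j - v j * w i = 0 := by
    intro i j
    by_cases hij : i = j
    · subst hij; ring
    obtain ⟨σ, h0, h1⟩ : ∃ σ : Equiv.Perm (Fin 3), σ 0 = i ∧ σ 1 = j := by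
      revert i j; decide
    simpa [h0, h1] using H σ
  have hv : ∃ i, v i ≠ 0 := by
    by_contra! hv
    have : v = 0 := by ext i; exact hv i
    simpa using (h 1 0 (by simp [this])).1
  obtain ⟨i, hi⟩ := hv
  refine hi (neg_eq_zero.1 ?_)
  refine (h (w i) (-v i) ?_).2
  ext j
  have := key i j
  simp only [PiLp.add_apply, PiLp.smul_apply, smul_eq_mul, PiLp.zero_apply]
  linarith

variable [IsManifold (𝓡 3) ∞ M]

/-- Postcomposing a smooth chart with a linear isomorphism of `ℝ³` gives a smooth chart. -/
theorem transHomeomorph_mem_maximalAtlas {φ : OpenPartialHomeomorph M E3}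
    (hφ : φ ∈ IsManifold.maximalAtlas (𝓡 3) ∞ M) (B : E3 ≃L[ℝ] E3) :
    φ.transHomeomorph B.toHomeomorph ∈ IsManifold.maximalAtlas (𝓡 3) ∞ M := by
  refine OpenPartialHomeomorph.mem_maximalAtlas_of_contMDiffOn _ ?_ ?_
  · exact B.contDiff.contMDiff.comp_contMDiffOn (contMDiffOn_of_mem_maximalAtlas hφ)
  · exact (contMDiffOn_symm_of_mem_maximalAtlas hφ).comp B.symm.contDiff.contMDiff.contMDiffOn
      fun x hx => hx

/-- Around every point there is a smooth chart in which `∂/∂z` is everywhere transverse to the plane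
field: a coordinate permutation makes it so at the point, and transversality is an open condition,
the nonvanishing of a minor of a spanning pair. -/
theorem exists_adapted_chart {r : ℕ∞} (η : PlaneField r M) (p : M) :
    ∃ φ ∈ IsManifold.maximalAtlas (𝓡 3) ∞ M, p ∈ φ.source ∧
      ∀ q ∈ φ.source, ∀ v ∈ η.plane q,
        (∃ c : ℝ, mfderiv (𝓡 3) (𝓡 3) φ q v = c • (EuclideanSpace.single 2 1 : E3)) → v = 0 := by
  obtain ⟨U, hU, V, W, hV, hW, hspan⟩ := η.locally_spanned p
  have hφ₀ : chartAt E3 p ∈ IsManifold.maximalAtlas (𝓡 3) ∞ M :=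
    IsManifold.chart_mem_maximalAtlas p
  have hp₀ := mem_chart_source E3 p
  have hfr : Module.finrank ℝ (Submodule.span ℝ {V p, W p}) = 2 := by
    rw [← hspan p (mem_of_mem_nhds hU)]; exact η.finrank_plane p
  obtain ⟨σ, hσ⟩ := exists_perm_minor_ne_zero
    (v := chartDeriv hφ₀ hp₀ (V p)) (w := chartDeriv hφ₀ hp₀ (W p)) (by
      intro a b hab
      refine eq_zero_of_finrank_span_pair hfr ((chartDeriv hφ₀ hp₀).map_eq_zero_iff.1 ?_)
      rw [map_add, map_smul, map_smul]; exact hab)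
  let B : E3 ≃L[ℝ] E3 :=
    (LinearIsometryEquiv.piLpCongrLeft 2 ℝ ℝ σ.symm).toContinuousLinearEquiv
  have hB : ∀ (x : E3) i, B x i = x (σ i) := fun x i => by
    simp [B, LinearIsometryEquiv.piLpCongrLeft_apply, Equiv.piCongrLeft']
  have hφ := transHomeomorph_mem_maximalAtlas hφ₀ B
  set φ := (chartAt E3 p).transHomeomorph B.toHomeomorph with hφdef
  have hp : p ∈ φ.source := hp₀
  have hderiv : ∀ u, chartDeriv hφ hp u = B (chartDeriv hφ₀ hp₀ u) := by
    intro u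
    have h := mfderiv_comp p (g := (B : E3 → E3)) (I' := 𝓡 3) (I'' := 𝓡 3)
      B.differentiable.mdifferentiable.mdifferentiableAt
      ((contMDiffAt_chart hφ₀ hp₀).mdifferentiableAt (by simp))
    rw [chartDeriv_apply, chartDeriv_apply]
    have h2 := congrArg (fun T => T u) h
    refine Eq.trans h2 ?_
    change mfderiv (𝓡 3) (𝓡 3) B (chartAt E3 p p) _ = _
    rw [mfderiv_eq_fderiv, B.fderiv]
    rfl
  let m : E3 → ℝ := fun x =>
    chartRep φ V x 0 * chartRep φ W x 1 - chartRep φ V x 1 * chartRep φ W x 0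
  have hm0 : m (φ p) ≠ 0 := by
    simp only [m, chartRep_apply hφ hp, hderiv, hB]; exact hσ
  have hleft : φ.symm (φ p) = p := φ.left_inv hp
  have hcont : ∀ {X : ∀ q : M, TangentSpace (𝓡 3) q},
      ContMDiffOn (𝓡 3) (𝓡 3).tangent r (fun q => (⟨q, X q⟩ : TangentBundle (𝓡 3) M)) U →
      ∀ i, ContinuousAt (fun x => chartRep φ X x i) (φ p) := by
    intro X hX i
    have h1 : ContMDiffAt (𝓡 3) (𝓡 3).tangent r
        (fun q => (⟨q, X q⟩ : TangentBundle (𝓡 3) M)) (φ.symm (φ p)) := by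
      rw [hleft]; exact hX.contMDiffAt hU
    exact (EuclideanSpace.proj (𝕜 := ℝ) i).continuous.continuousAt.comp
      (contDiffAt_chartRep hφ (φ.map_source hp) h1).continuousAt
  have hmc : ContinuousAt m (φ p) :=
    ((hcont hV 0).mul (hcont hW 1)).sub ((hcont hV 1).mul (hcont hW 0))
  have hev : ∀ᶠ q in 𝓝 p, m (φ q) ≠ 0 :=
    (φ.continuousAt hp).eventually (hmc.eventually_ne hm0)
  obtain ⟨O, hO, hOo, hpO⟩ := mem_nhds_iff.1 (inter_mem hev hU)
  refine ⟨φ.restr O, restr_mem_maximalAtlas _ hφ hOo, ?_, ?_⟩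
  · rw [φ.restr_source, hOo.interior_eq]; exact ⟨hp, hpO⟩
  rintro q hq v hv ⟨c, hc⟩
  rw [φ.restr_source, hOo.interior_eq] at hq
  have hmq := (hO hq.2).1
  rw [hspan q (hO hq.2).2] at hv
  obtain ⟨a, b, rfl⟩ := Submodule.mem_span_pair.1 hv
  have hc' : a • chartDeriv hφ hq.1 (V q) + b • chartDeriv hφ hq.1 (W q) =
      c • (EuclideanSpace.single 2 1 : E3) := by
    rw [← map_smul, ← map_smul, ← map_add]; exact hc
  have hmq' : m (φ q) ≠ 0 := hmq
  simp only [m, chartRep_apply hφ hq.1] at hmq'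
  have e0 := congrArg (fun x : E3 => x 0) hc'
  have e1 := congrArg (fun x : E3 => x 1) hc'
  simp at e0 e1
  have ha : a = 0 := by
    refine (mul_eq_zero.1 ?_).resolve_right hmq'
    linear_combination (chartDeriv hφ hq.1 (W q)) 1 * e0 - (chartDeriv hφ hq.1 (W q)) 0 * e1
  have hb : b = 0 := by
    refine (mul_eq_zero.1 ?_).resolve_right hmq'
    linear_combination (chartDeriv hφ hq.1 (V q)) 0 * e1 - (chartDeriv hφ hq.1 (V q)) 1 * e0
  rw [ha, hb, zero_smul, zero_smul, add_zero]

theorem nonempty_adaptedAtlas [CompactSpace M] {r : ℕ∞} (η : PlaneField r M) :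
    Nonempty (AdaptedAtlas η) := by
  choose φ hφ hp htr using exists_adapted_chart η
  obtain ⟨t, ht⟩ := CompactSpace.elim_nhds_subcover (fun p => (φ p).source)
    fun p => (φ p).open_source.mem_nhds (hp p)
  refine ⟨⟨φ '' t, (t.finite_toSet.image φ).countable, ?_, fun p => ?_, ?_⟩⟩
  · rintro _ ⟨p, -, rfl⟩; exact hφ p
  · obtain ⟨q, hq, hpq⟩ := mem_iUnion₂.1 (ht ▸ mem_univ p : p ∈ ⋃ x ∈ t, (φ x).source)
    exact ⟨φ q, mem_image_of_mem φ hq, hpq⟩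
  · rintro _ ⟨p, -, rfl⟩; exact htr p

end Adapted

end

theorem mainTheorem11 {M : Type*} [TopologicalSpace M] [T2Space M] [CompactSpace M]
    [ChartedSpace E3 M] [IsManifold (𝓡 3) ∞ M]
    (r : ℕ∞) (hr : 4 ≤ r) (η : PlaneField r M) :
    Nonempty (AdaptedAtlas η) ∧
      ∀ 𝒜 : AdaptedAtlas η, {X : η.Sections | IsNondegenerate 𝒜 X} ∈ residual η.Sections :=
  ⟨nonempty_adaptedAtlas η, fun 𝒜 =>
    mem_of_superset (residual_isGood hr 𝒜) fun _ hX => hX.isNondegenerate hr⟩
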